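/- All vector spaces are over $\mathbb C$, and Sweedler notation $\Delta(h)=\sum h^{(1)}\otimes h^{(2)}$, $(\mathrm{id}\otimes\Delta)\Delta(h)=\sum h^{(1)}\otimes h^{(2)}\otimes h^{(3)}$ is used. A weak Hopf algebra $(W,\mu,1,\Delta,\varepsilon,S)$ is a vector space with an associative unital algebra structure, a coassociative counital coalgebra structure and a linear map $S:W\to W$ such that, for all $a,b,u,v,w,h\in W$, $$\Delta(ab)=\Delta(a)\Delta(b),$$ $$(\Delta\otimes\mathrm{id})\Delta(1)=(\Delta(1)\otimes 1)(1\otimes\Delta(1))=(1\otimes\Delta(1))(\Delta(1)\otimes 1),$$ $$\varepsilon(uvw)=\sum\varepsilon(uv^{(1)})\varepsilon(v^{(2)}w)=\sum\varepsilon(uv^{(2)})\varepsilon(v^{(1)}w),$$ $$\sum h^{(1)}S(h^{(2)})=\varepsilon_L(h),\qquad \sum S(h^{(1)})h^{(2)}=\varepsilon_R(h),\qquad \sum S(h^{(1)})h^{(2)}S(h^{(3)})=S(h),$$ where $\varepsilon_L(h)=\sum\varepsilon(1^{(1)}h)1^{(2)}$ and $\varepsilon_R(h)=\sum 1^{(1)}\varepsilon(h1^{(2)})$.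 Put $W_L=\varepsilon_L(W)$, $W_R=\varepsilon_R(W)$. Let $W$ be a finite-dimensional weak Hopf algebra. Let $\hat W=\mathrm{Hom}(W,\mathbb C)$ with the operations transposed from those of $W$: $\langle\varphi\psi,x\rangle=\langle\varphi\otimes\psi,\Delta(x)\rangle$, unit $\varepsilon$, $\langle\hat\Delta(\varphi),x\otimes y\rangle=\langle\varphi,xy\rangle$, $\hat S(\varphi)=\varphi\circ S$. Sweedler components of elements of $\hat W$ refer to $\hat\Delta$. Put $x\rightharpoonup\varphi=\sum\varphi^{(1)}\langle\varphi^{(2)},x\rangle$ and $\varphi\leftharpoonup x=\sum\langle\varphi^{(1)},x\rangle\varphi^{(2)}$. Then the following hold. (a) The antipode $S$ is bijective, and the product $$(\varphi\otimes h)(\psi\otimes g)=\sum\varphi\psi^{(2)}\otimes h^{(2)}g\,\langle\psi^{(1)},S^{-1}(h^{(3)})\rangle\langle\psi^{(3)},h^{(1)}\rangle$$ makes $\hat W\otimes W$ an associative (in general non-unital) algebra, denoted $\hat W^{\rm cop}\otimes W$. (b) The linear span $J$ of the elements $\varphi\otimes xh-\varphi(x\rightharpoonup\varepsilon)\otimes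 h$ ($x\in W_L$) and $\varphi\otimes yh-\varphi(\varepsilon\leftharpoonup y)\otimes h$ ($y\in W_R$), with $\varphi\in\hat W$ and $h\in W$, is a two-sided ideal of $\hat W^{\rm cop}\otimes W$. (c) On the quotient $D(W)=(\hat W^{\rm cop}\otimes W)/J$, with classes $[\varphi\otimes h]$, the following operations are well defined and make $D(W)$ a weak Hopf algebra: the product $[\varphi\otimes h][\psi\otimes g]=\sum[\varphi\psi^{(2)}\otimes h^{(2)}g]\langle\psi^{(1)},S^{-1}(h^{(3)})\rangle\langle\psi^{(3)},h^{(1)}\rangle$; the unit $[\varepsilon\otimes 1]$; the coproduct $\Delta([\varphi\otimes h])=\sum[\varphi^{(2)}\otimes h^{(1)}]\otimes[\varphi^{(1)}\otimes h^{(2)}]$; the counit $\varepsilon([\varphi\otimes h])=\langle\varphi,\varepsilon_R(S^{-1}(h))\rangle$; the antipode $S([\varphi\otimes h])=\sum[\hat S^{-1}(\varphi^{(2)})\otimes S(h^{(2)})]\langle\varphi^{(1)},h^{(3)}\rangle\langle\varphi^{(3)},S^{-1}(h^{(1)})\rangle$. -/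

import Mathlib

open scoped TensorProduct

noncomputable section

namespace WeakHopf

section Axioms

variable {V : Type*} [AddCommGroup V] [Module ℂ V]

/-- The map `(a ⊗ b) ⊗ (c ⊗ d) ↦ a ⊗ (m b c ⊗ d)`, that is `id ⊗ μ ⊗ id`. -/
def mulMiddle (m : V →ₗ[ℂ] V →ₗ[ℂ] V) :
    (V ⊗[ℂ] V) ⊗[ℂ] (V ⊗[ℂ] V) →ₗ[ℂ] V ⊗[ℂ] (V ⊗[ℂ] V) :=
  LinearMap.lTensor V (LinearMap.rTensor V (TensorProduct.lift m) ∘ₗ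
      (TensorProduct.assoc ℂ V V V).symm.toLinearMap) ∘ₗ
    (TensorProduct.assoc ℂ V V (V ⊗[ℂ] V)).toLinearMap

/-- The map `a ⊗ b ↦ ε(u a) ε(b w)`. -/
def counitPair (m : V →ₗ[ℂ] V →ₗ[ℂ] V) (ε : V →ₗ[ℂ] ℂ) (u w : V) : V ⊗[ℂ] V →ₗ[ℂ] ℂ :=
  (TensorProduct.lid ℂ ℂ).toLinearMap ∘ₗ TensorProduct.map (ε ∘ₗ m u) (ε ∘ₗ m.flip w)

/-- The left counital map `ε_L(h) = (ε ⊗ id)(Δ(1)(h ⊗ 1)) = ∑ ε(1⁽¹⁾ h) 1⁽²⁾`. -/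
def counitL (m : V →ₗ[ℂ] V →ₗ[ℂ] V) (one : V) (Δ : V →ₗ[ℂ] V ⊗[ℂ] V) (ε : V →ₗ[ℂ] ℂ) :
    V →ₗ[ℂ] V where
  toFun h := TensorProduct.lid ℂ V (LinearMap.rTensor V (ε ∘ₗ m.flip h) (Δ one))
  map_add' x y := by simp [LinearMap.comp_add, LinearMap.rTensor_add]
  map_smul' c x := by simp [LinearMap.comp_smul, LinearMap.rTensor_smul]

/-- The right counital map `ε_R(h) = (id ⊗ ε)((1 ⊗ h)Δ(1)) = ∑ 1⁽¹⁾ ε(h 1⁽²⁾)`. -/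
def counitR (m : V →ₗ[ℂ] V →ₗ[ℂ] V) (one : V) (Δ : V →ₗ[ℂ] V ⊗[ℂ] V) (ε : V →ₗ[ℂ] ℂ) :
    V →ₗ[ℂ] V where
  toFun h := TensorProduct.rid ℂ V (LinearMap.lTensor V (ε ∘ₗ m h) (Δ one))
  map_add' x y := by simp [LinearMap.comp_add, LinearMap.lTensor_add]
  map_smul' c x := by simp [LinearMap.comp_smul, LinearMap.lTensor_smul]

/-- `(V, m, one, Δ, ε, S)` is a weak Hopf algebra over `ℂ`. -/
structure IsWeakHopfAlgebra (m : V →ₗ[ℂ] V →ₗ[ℂ] V) (one : V) (Δ : V →ₗ[ℂ] V ⊗[ℂ] V)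
    (ε : V →ₗ[ℂ] ℂ) (S : V →ₗ[ℂ] V) : Prop where
  mul_assoc : ∀ a b c, m (m a b) c = m a (m b c)
  one_mul : ∀ a, m one a = a
  mul_one : ∀ a, m a one = a
  coassoc : (TensorProduct.assoc ℂ V V V).toLinearMap ∘ₗ LinearMap.rTensor V Δ ∘ₗ Δ =
    LinearMap.lTensor V Δ ∘ₗ Δ
  counit_left : (TensorProduct.lid ℂ V).toLinearMap ∘ₗ LinearMap.rTensor V ε ∘ₗ Δ =
    LinearMap.id
  counit_right : (TensorProduct.rid ℂ V).toLinearMap ∘ₗ LinearMap.lTensor V ε ∘ₗ Δ =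
    LinearMap.id
  /-- `Δ(ab) = Δ(a)Δ(b)` -/
  comul_mul : ∀ a b, Δ (m a b) =
    TensorProduct.map (TensorProduct.lift m) (TensorProduct.lift m)
      (TensorProduct.tensorTensorTensorComm ℂ V V V V (Δ a ⊗ₜ[ℂ] Δ b))
  /-- `Δ₂(1) = (Δ(1) ⊗ 1)(1 ⊗ Δ(1))` -/
  comul_one : LinearMap.lTensor V Δ (Δ one) = mulMiddle m (Δ one ⊗ₜ[ℂ] Δ one)
  /-- `Δ₂(1) = (1 ⊗ Δ(1))(Δ(1) ⊗ 1)` -/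
  comul_one' : LinearMap.lTensor V Δ (Δ one) =
    mulMiddle m.flip (Δ one ⊗ₜ[ℂ] Δ one)
  /-- `ε(uvw) = ∑ ε(u v⁽¹⁾) ε(v⁽²⁾ w)` -/
  counit_mul : ∀ u v w, ε (m (m u v) w) = counitPair m ε u w (Δ v)
  /-- `ε(uvw) = ∑ ε(u v⁽²⁾) ε(v⁽¹⁾ w)` -/
  counit_mul' : ∀ u v w, ε (m (m u v) w) =
    counitPair m ε u w (TensorProduct.comm ℂ V V (Δ v))
  /-- `∑ h⁽¹⁾ S(h⁽²⁾) = ε_L(h)` -/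
  antipode_left : TensorProduct.lift m ∘ₗ LinearMap.lTensor V S ∘ₗ Δ = counitL m one Δ ε
  /-- `∑ S(h⁽¹⁾) h⁽²⁾ = ε_R(h)` -/
  antipode_right : TensorProduct.lift m ∘ₗ LinearMap.rTensor V S ∘ₗ Δ = counitR m one Δ ε
  /-- `∑ S(h⁽¹⁾) h⁽²⁾ S(h⁽³⁾) = S(h)` -/
  antipode_mul : TensorProduct.lift m ∘ₗ
      TensorProduct.map (TensorProduct.lift m ∘ₗ LinearMap.rTensor V S) S ∘ₗ
      LinearMap.rTensor V Δ ∘ₗ Δ = S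

end Axioms

section Dual

variable (W : Type*) [Ring W] [Algebra ℂ W] [Coalgebra ℂ W]

/-- The left counital map of `W`. -/
abbrev εL : W →ₗ[ℂ] W := counitL (LinearMap.mul ℂ W) 1 Coalgebra.comul Coalgebra.counit

/-- The right counital map of `W`. -/
abbrev εR : W →ₗ[ℂ] W := counitR (LinearMap.mul ℂ W) 1 Coalgebra.comul Coalgebra.counit

/-- The product of the dual `Ŵ`, transpose to the coproduct of `W`:
`⟨φψ, x⟩ = ⟨φ ⊗ ψ, Δ(x)⟩`. -/
def dualMul : Module.Dual ℂ W →ₗ[ℂ] Module.Dual ℂ W →ₗ[ℂ] Module.Dual ℂ W :=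
  TensorProduct.curry
    ((Coalgebra.comul (R := ℂ) (A := W)).dualMap ∘ₗ TensorProduct.dualDistrib ℂ W W)

/-- `Δ₂(h) = ∑ h⁽¹⁾ ⊗ (h⁽²⁾ ⊗ h⁽³⁾)`. -/
def comul₃ : W →ₗ[ℂ] W ⊗[ℂ] (W ⊗[ℂ] W) :=
  LinearMap.lTensor W Coalgebra.comul ∘ₗ Coalgebra.comul

variable [FiniteDimensional ℂ W]

/-- The coproduct of the dual `Ŵ`, transpose to the product of `W`:
`⟨Δ̂(φ), x ⊗ y⟩ = ⟨φ, xy⟩`. -/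
def dualComul : Module.Dual ℂ W →ₗ[ℂ] Module.Dual ℂ W ⊗[ℂ] Module.Dual ℂ W :=
  (TensorProduct.dualDistribEquiv ℂ W W).symm.toLinearMap ∘ₗ (LinearMap.mul' ℂ W).dualMap

/-- `Δ̂₂(φ) = ∑ φ⁽¹⁾ ⊗ (φ⁽²⁾ ⊗ φ⁽³⁾)`. -/
def dualComul₃ : Module.Dual ℂ W →ₗ[ℂ]
    Module.Dual ℂ W ⊗[ℂ] (Module.Dual ℂ W ⊗[ℂ] Module.Dual ℂ W) :=
  LinearMap.lTensor (Module.Dual ℂ W) (dualComul W) ∘ₗ dualComul W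

variable {W}

/-- `x ⇀ φ = ∑ φ⁽¹⁾ ⟨φ⁽²⁾, x⟩`. -/
def harpoonL (x : W) (φ : Module.Dual ℂ W) : Module.Dual ℂ W :=
  TensorProduct.rid ℂ _
    (LinearMap.lTensor (Module.Dual ℂ W) (Module.Dual.eval ℂ W x) (dualComul W φ))

/-- `φ ↼ x = ∑ ⟨φ⁽¹⁾, x⟩ φ⁽²⁾`. -/
def harpoonR (φ : Module.Dual ℂ W) (x : W) : Module.Dual ℂ W :=
  TensorProduct.lid ℂ _
    (LinearMap.rTensor (Module.Dual ℂ W) (Module.Dual.eval ℂ W x) (dualComul W φ))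

variable (W) in
/-- The linear span of the elements `φ ⊗ xh - φ(x ⇀ ε) ⊗ h` with `x ∈ W_L = ε_L(W)` and
`φ ⊗ yh - φ(ε ↼ y) ⊗ h` with `y ∈ W_R = ε_R(W)`. -/
def doubleIdeal : Submodule ℂ (Module.Dual ℂ W ⊗[ℂ] W) :=
  Submodule.span ℂ
    ({z | ∃ (φ : Module.Dual ℂ W) (h : W), ∃ x ∈ LinearMap.range (εL W),
        z = φ ⊗ₜ[ℂ] (x * h) - dualMul W φ (harpoonL x Coalgebra.counit) ⊗ₜ[ℂ] h} ∪
     {z | ∃ (φ : Module.Dual ℂ W) (h : W), ∃ y ∈ LinearMap.range (εR W),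
        z = φ ⊗ₜ[ℂ] (y * h) - dualMul W φ (harpoonR Coalgebra.counit y) ⊗ₜ[ℂ] h})

variable (W) in
/-- The quotient space underlying the quantum double. -/
abbrev QuantumDouble : Type _ := (Module.Dual ℂ W ⊗[ℂ] W) ⧸ doubleIdeal W

/-- `z ↦ [z]`. -/
abbrev toDouble : Module.Dual ℂ W ⊗[ℂ] W →ₗ[ℂ] QuantumDouble W := (doubleIdeal W).mkQ

end Dual

section Double

variable (W : Type*) [Ring W] [Algebra ℂ W]

/-- `h₁ ⊗ (h₂ ⊗ h₃) ↦ h₃ ⊗ (h₂ ⊗ h₁)`. -/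
def reverse₃ : W ⊗[ℂ] (W ⊗[ℂ] W) →ₗ[ℂ] W ⊗[ℂ] (W ⊗[ℂ] W) :=
  (TensorProduct.assoc ℂ W W W).toLinearMap ∘ₗ
    LinearMap.rTensor W (TensorProduct.comm ℂ W W).toLinearMap ∘ₗ
    (TensorProduct.comm ℂ W (W ⊗[ℂ] W)).toLinearMap

/-- `(ψ₁ ⊗ (ψ₂ ⊗ ψ₃)) ⊗ (h₁ ⊗ (h₂ ⊗ h₃)) ↦ ⟨ψ₁, h₃⟩ ⟨ψ₃, h₁⟩ ψ₂ ⊗ h₂`. -/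
def contractOuter :
    (Module.Dual ℂ W ⊗[ℂ] (Module.Dual ℂ W ⊗[ℂ] Module.Dual ℂ W)) ⊗[ℂ]
      (W ⊗[ℂ] (W ⊗[ℂ] W)) →ₗ[ℂ] Module.Dual ℂ W ⊗[ℂ] W :=
  (TensorProduct.lid ℂ _).toLinearMap ∘ₗ
    TensorProduct.map (contractLeft ℂ W)
      ((TensorProduct.rid ℂ _).toLinearMap ∘ₗ
        LinearMap.lTensor (Module.Dual ℂ W ⊗[ℂ] W) (contractLeft ℂ W) ∘ₗ
        (TensorProduct.tensorTensorTensorComm ℂ _ _ _ _).toLinearMap) ∘ₗ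
    (TensorProduct.tensorTensorTensorComm ℂ _ _ _ _).toLinearMap ∘ₗ
    LinearMap.lTensor _ (reverse₃ W)

theorem contractOuter_tmul (ψ₁ ψ₂ ψ₃ : Module.Dual ℂ W) (h₁ h₂ h₃ : W) :
    contractOuter W ((ψ₁ ⊗ₜ (ψ₂ ⊗ₜ ψ₃)) ⊗ₜ (h₁ ⊗ₜ (h₂ ⊗ₜ h₃))) =
      (ψ₁ h₃ * ψ₃ h₁) • (ψ₂ ⊗ₜ[ℂ] h₂) := by
  simp [contractOuter, reverse₃, smul_smul, mul_comm]

variable {W}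
variable [Coalgebra ℂ W] [FiniteDimensional ℂ W]

/-- The two-sided inverse `T⁻¹` of a bijective linear endomorphism `T` (and `0` if `T` is not
bijective). -/
abbrev inv {V : Type*} [AddCommGroup V] [Module ℂ V] (T : V →ₗ[ℂ] V) : V →ₗ[ℂ] V :=
  Ring.inverse (M₀ := Module.End ℂ V) T

/-- `ψ ⊗ h ↦ ∑ ⟨ψ⁽¹⁾, S⁻¹(h⁽³⁾)⟩ ⟨ψ⁽³⁾, h⁽¹⁾⟩ ψ⁽²⁾ ⊗ h⁽²⁾`. -/
def straighten (S : W →ₗ[ℂ] W) : Module.Dual ℂ W ⊗[ℂ] W →ₗ[ℂ] Module.Dual ℂ W ⊗[ℂ] W :=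
  contractOuter W ∘ₗ
    TensorProduct.map (dualComul₃ W)
      (LinearMap.lTensor W (LinearMap.lTensor W (inv S)) ∘ₗ comul₃ W)

/-- The product of `Ŵᶜᵒᵖ ⊗ W`:
`(φ ⊗ h)(ψ ⊗ g) = ∑ φ ψ⁽²⁾ ⊗ h⁽²⁾ g ⟨ψ⁽¹⁾, S⁻¹(h⁽³⁾)⟩ ⟨ψ⁽³⁾, h⁽¹⁾⟩`. It is the composite
`(φ ⊗ h) ⊗ (ψ ⊗ g) ↦ φ ⊗ ((ψ ⊗ h) ⊗ g) ↦ φ ⊗ (straighten (ψ ⊗ h) ⊗ g)`, followed by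
multiplication of the two functionals and of the two elements of `W`. -/
def preMul (S : W →ₗ[ℂ] W) : Module.Dual ℂ W ⊗[ℂ] W →ₗ[ℂ]
    Module.Dual ℂ W ⊗[ℂ] W →ₗ[ℂ] Module.Dual ℂ W ⊗[ℂ] W :=
  TensorProduct.curry
    (TensorProduct.map (TensorProduct.lift (dualMul W)) (LinearMap.mul' ℂ W) ∘ₗ
      (TensorProduct.assoc ℂ _ _ _).symm.toLinearMap ∘ₗ
      LinearMap.lTensor (Module.Dual ℂ W)
        ((TensorProduct.assoc ℂ _ _ _).toLinearMap ∘ₗ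
          LinearMap.rTensor W
            (straighten S ∘ₗ (TensorProduct.comm ℂ W (Module.Dual ℂ W)).toLinearMap) ∘ₗ
          (TensorProduct.assoc ℂ _ _ _).symm.toLinearMap) ∘ₗ
      (TensorProduct.assoc ℂ _ _ _).toLinearMap)

/-- `φ ⊗ h ↦ ∑ (φ⁽²⁾ ⊗ h⁽¹⁾) ⊗ (φ⁽¹⁾ ⊗ h⁽²⁾)`. -/
def preComul : Module.Dual ℂ W ⊗[ℂ] W →ₗ[ℂ]
    (Module.Dual ℂ W ⊗[ℂ] W) ⊗[ℂ] (Module.Dual ℂ W ⊗[ℂ] W) :=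
  (TensorProduct.tensorTensorTensorComm ℂ _ _ _ _).toLinearMap ∘ₗ
    TensorProduct.map ((TensorProduct.comm ℂ _ _).toLinearMap ∘ₗ dualComul W) Coalgebra.comul

/-- `φ ⊗ h ↦ ⟨φ, ε_R(S⁻¹(h))⟩`. -/
def preCounit (S : W →ₗ[ℂ] W) : Module.Dual ℂ W ⊗[ℂ] W →ₗ[ℂ] ℂ :=
  contractLeft ℂ W ∘ₗ LinearMap.lTensor (Module.Dual ℂ W) (εR W ∘ₗ inv S)

/-- `φ ⊗ h ↦ ∑ Ŝ⁻¹(φ⁽²⁾) ⊗ S(h⁽²⁾) ⟨φ⁽¹⁾, h⁽³⁾⟩ ⟨φ⁽³⁾, S⁻¹(h⁽¹⁾)⟩`, where `Ŝ` is the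
transpose of `S`. -/
def preAntipode (S : W →ₗ[ℂ] W) : Module.Dual ℂ W ⊗[ℂ] W →ₗ[ℂ] Module.Dual ℂ W ⊗[ℂ] W :=
  TensorProduct.map (inv S.dualMap) S ∘ₗ contractOuter W ∘ₗ
    TensorProduct.map (dualComul₃ W) (LinearMap.rTensor (W ⊗[ℂ] W) (inv S) ∘ₗ comul₃ W)

end Double

end WeakHopf

end

/-!
Write `T = S⁻¹`. The proof has two parts: the basic theory of weak Hopf algebras, and the double.

*The weak Hopf algebra.* The counital subalgebras `W_L` and `W_R` commute (`IsWHA.commute`),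
`Δ(1) ∈ W_R ⊗ W_L` (`IsWHA.sw_one_εR_εL`), multiplication by their elements passes through `Δ` in
one leg (`IsWHA.sw_memL_mul` and its relatives), and `S` reverses products and coproducts
(`IsWHA.antipode_antimul`, `IsWHA.sw_antipode`). Bijectivity of `S` (`IsWHA.bijective`) is a Fitting
argument: for large `N`, `W` is the direct sum of the kernel and the range of `S ^ N`. The
projection `P` to the range along the kernel is multiplicative, commutes with `S`, and fixes `W_L`
and `W_R`, which `S` interchanges surjectively. From `h = ∑ h⁽¹⁾ S(h⁽²⁾) h⁽³⁾` one descends from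
`S ^ N ∘ P = S ^ N` to `P = id`.

*The double.* By dualizing, the product of `Ŵᶜᵒᵖ ⊗ W` is
`(φ ⊗ h)(ψ ⊗ g) = ∑ φ ψ(T(h⁽³⁾) · h⁽¹⁾) ⊗ h⁽²⁾ g`, and the relations that span `J` are
`φ ⊗ xh ~ φ(· T(x)) ⊗ h` for `x ∈ W_L` and `φ ⊗ yh ~ φ(y ·) ⊗ h` for `y ∈ W_R`
(`IsWHA.cls_memL`, `IsWHA.cls_memR`). The ideal property holds in a strong form: every product with
a factor in `J` is zero, since in the product the elements of `W_L` and `W_R` can be moved from one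
tensor factor to the other. In particular the product descends to `D(W)`.

In `D(W)` one has `[φ ⊗ 1][ψ ⊗ g] = [φψ ⊗ g]` and `[φ ⊗ h][ε ⊗ g] = [φ ⊗ hg]`
(`IsWHA.dMul_cls_one`, `IsWHA.dMul_cls_counit`), so `φ ↦ [φ ⊗ 1]` and `h ↦ [ε ⊗ h]` are
multiplicative, and `[φ ⊗ h] = [φ ⊗ 1][ε ⊗ h]`. The unit laws follow, and the axioms are reduced to
those of `W`:

* `Δ` is multiplicative by a compatibility of the straightening map `ψ ⊗ h ↦ [ε ⊗ h][ψ ⊗ 1]` with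
  the coproducts (`IsWHA.straighten_comul`), where a factor `h⁽⁴⁾ T(h⁽³⁾)` is contracted.
* The two formulas for `Δ₂(1)` are the images of those in `W`, since `h ↦ [ε ⊗ h]` is compatible
  with `Δ` (`IsWHA.dComul_cls_counit`).
* In `ε(uvw)` one may replace `w` by some `[ε ⊗ k]` and `u` by some `[χ ⊗ 1]`
  (`IsWHA.exists_dCounit_dMul_right`, `IsWHA.exists_dCounit_dMul_left`); the weak multiplicativity
  of the counit then becomes an identity for `ε_L`.
* The antipode is `[φ ⊗ h] ↦ [ε ⊗ S(h)][φ ∘ T ⊗ 1]` (`IsWHA.dAntipode_cls`). Each of its axioms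
  amounts to contracting the two components of `h` and then those of `φ`.

*Encoding.* Sweedler sums are written as `ten t f`, which is `∑ f a b` over a decomposition
`t = ∑ a ⊗ b`; this is meaningful for bilinear `f`, and the bilinearity conditions are left to
`fun_prop`.
-/

namespace WeakHopf

local notation "Δ" => Coalgebra.comul (R := ℂ)
local notation "ϵ" => Coalgebra.counit (R := ℂ)

/-! ### Sums over tensors -/

section

section Lin

variable {V U X : Type*} [AddCommMonoid V] [Module ℂ V] [AddCommMonoid U] [Module ℂ U]
  [AddCommMonoid X] [Module ℂ X]

/-- Linearity of an unbundled function, in a form that the tactic `fun_prop` can check. -/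
@[fun_prop]
structure Lin (f : V → U) : Prop where
  map_add : ∀ x y, f (x + y) = f x + f y
  map_smul : ∀ (c : ℂ) x, f (c • x) = c • f x

/-- The bundled version of a linear function. -/
@[simps]
def Lin.toMap {f : V → U} (hf : Lin f) : V →ₗ[ℂ] U where
  toFun := f
  map_add' := hf.map_add
  map_smul' := hf.map_smul

@[fun_prop]
theorem Lin.id : Lin (fun x : V => x) := ⟨fun _ _ => rfl, fun _ _ => rfl⟩

@[fun_prop]
theorem Lin.comp {f : U → X} {g : V → U} (hf : Lin f) (hg : Lin g) : Lin (fun x => f (g x)) :=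
  ⟨fun x y => by simp only [hg.map_add, hf.map_add],
    fun c x => by simp only [hg.map_smul, hf.map_smul]⟩

@[fun_prop]
theorem Lin.coe (T : U →ₗ[ℂ] X) {g : V → U} (hg : Lin g) : Lin (fun x => T (g x)) :=
  ⟨fun x y => by rw [hg.map_add, _root_.map_add],
    fun c x => by rw [hg.map_smul, _root_.map_smul]⟩

@[fun_prop]
theorem Lin.coe_equiv (T : U ≃ₗ[ℂ] X) {g : V → U} (hg : Lin g) : Lin (fun x => T (g x)) :=
  Lin.coe T.toLinearMap hg

@[fun_prop]
theorem Lin.apply {g : V → U →ₗ[ℂ] X} (hg : Lin g) (u : U) : Lin (fun x => g x u) :=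
  ⟨fun x y => by rw [hg.map_add]; rfl, fun c x => by rw [hg.map_smul]; rfl⟩

@[fun_prop]
theorem Lin.tmul_right {g : V → U} (hg : Lin g) (u : X) : Lin (fun x => g x ⊗ₜ[ℂ] u) :=
  ⟨fun x y => by rw [hg.map_add, TensorProduct.add_tmul],
    fun c x => by rw [hg.map_smul, TensorProduct.smul_tmul']⟩

@[fun_prop]
theorem Lin.tmul_left {g : V → U} (hg : Lin g) (u : X) : Lin (fun x => u ⊗ₜ[ℂ] g x) :=
  ⟨fun x y => by rw [hg.map_add, TensorProduct.tmul_add],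
    fun c x => by rw [hg.map_smul, TensorProduct.tmul_smul]⟩

@[fun_prop]
theorem Lin.smul_right {g : V → ℂ} (hg : Lin g) (u : X) : Lin (fun x => g x • u) :=
  ⟨fun x y => by rw [hg.map_add, add_smul],
    fun c x => by rw [hg.map_smul, smul_assoc]⟩

@[fun_prop]
theorem Lin.smul_left {g : V → U} (hg : Lin g) (c : ℂ) : Lin (fun x => c • g x) :=
  ⟨fun x y => by rw [hg.map_add, smul_add],
    fun d x => by rw [hg.map_smul, smul_comm]⟩

@[fun_prop]
theorem Lin.linearMap_comp {Y : Type*} [AddCommMonoid Y] [Module ℂ Y] {g : V → U →ₗ[ℂ] X}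
    (hg : Lin g) (T : Y →ₗ[ℂ] U) : Lin (fun x => g x ∘ₗ T) :=
  ⟨fun x y => by rw [hg.map_add, LinearMap.add_comp], fun c x => by
    rw [hg.map_smul, LinearMap.smul_comp]⟩

variable {R : Type*} [Ring R] [Algebra ℂ R]

@[fun_prop]
theorem Lin.mul_right {g : V → R} (hg : Lin g) (u : R) : Lin (fun x => g x * u) :=
  ⟨fun x y => by rw [hg.map_add, add_mul],
    fun c x => by rw [hg.map_smul, smul_mul_assoc]⟩

@[fun_prop]
theorem Lin.mul_left {g : V → R} (hg : Lin g) (u : R) : Lin (fun x => u * g x) :=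
  ⟨fun x y => by rw [hg.map_add, mul_add],
    fun c x => by rw [hg.map_smul, mul_smul_comm]⟩

end Lin

section Sum

variable {V U X : Type*} [AddCommMonoid V] [Module ℂ V] [AddCommMonoid U] [Module ℂ U]
  [AddCommMonoid X]

/-- `ten t f` is `∑ f a b` when `t = ∑ a ⊗ b`. The sum is taken over an arbitrarily chosen
expression of `t` as a sum of pure tensors, so it has a meaning independent of this choice only
for bilinear `f`. -/
noncomputable def ten (t : V ⊗[ℂ] U) (f : V → U → X) : X :=
  ((TensorProduct.exists_multiset t).choose.map fun p => f p.1 p.2).sum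

theorem ten_congr {t : V ⊗[ℂ] U} {f g : V → U → X} (h : ∀ a b, f a b = g a b) :
    ten t f = ten t g := by
  congr; funext a b; exact h a b

theorem ten_comm {V' U' : Type*} [AddCommMonoid V'] [Module ℂ V'] [AddCommMonoid U'] [Module ℂ U']
    (t : V ⊗[ℂ] U) (s : V' ⊗[ℂ] U') (f : V → U → V' → U' → X) :
    (ten t fun a b => ten s fun c d => f a b c d) =
      ten s fun c d => ten t fun a b => f a b c d := by
  simp only [ten]
  exact Multiset.sum_map_sum_map _ _

/-- Interchange of a sum with an iterated sum. -/
theorem ten_comm₂ {V₁ U₁ V₂ U₂ : Type*} [AddCommMonoid V₁] [Module ℂ V₁] [AddCommMonoid U₁]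
    [Module ℂ U₁] [AddCommMonoid V₂] [Module ℂ V₂] [AddCommMonoid U₂] [Module ℂ U₂]
    (t : V ⊗[ℂ] U) (s : V₁ ⊗[ℂ] U₁) (r : V₁ → U₁ → V₂ ⊗[ℂ] U₂)
    (f : V → U → V₁ → U₁ → V₂ → U₂ → X) :
    (ten t fun a b => ten s fun c d => ten (r c d) fun e g => f a b c d e g) =
      ten s fun c d => ten (r c d) fun e g => ten t fun a b => f a b c d e g := by
  rw [ten_comm]
  exact ten_congr fun c d => ten_comm _ _ _

end Sum

section Sweedler

variable {V U X Y Z : Type*} [AddCommMonoid V] [Module ℂ V] [AddCommMonoid U] [Module ℂ U]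
  [AddCommMonoid X] [Module ℂ X] [AddCommMonoid Y] [Module ℂ Y] [AddCommMonoid Z] [Module ℂ Z]

theorem map_ten (T : X →ₗ[ℂ] Y) (t : V ⊗[ℂ] U) (f : V → U → X) :
    T (ten t f) = ten t fun a b => T (f a b) := by
  rw [ten, map_multiset_sum, Multiset.map_map]; rfl

theorem Lin.map_ten {g : X → Y} (hg : Lin g) (t : V ⊗[ℂ] U) (f : V → U → X) :
    g (ten t f) = ten t fun a b => g (f a b) :=
  WeakHopf.map_ten hg.toMap t f

theorem ten_tmul_self (t : V ⊗[ℂ] U) : ten t (fun a b => a ⊗ₜ[ℂ] b) = t :=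
  (TensorProduct.exists_multiset t).choose_spec.symm

/-- A linear map on `V ⊗ U` that restricts to `f` on pure tensors computes `ten t f`. -/
theorem ten_eq (T : V ⊗[ℂ] U →ₗ[ℂ] X) {f : V → U → X} (h : ∀ a b, T (a ⊗ₜ b) = f a b)
    (t : V ⊗[ℂ] U) : ten t f = T t := by
  conv_rhs => rw [← ten_tmul_self t, map_ten]
  simp only [h]

theorem exists_map {f : V → U → X} (h₁ : ∀ b, Lin fun a => f a b) (h₂ : ∀ a, Lin fun b => f a b) :
    ∃ T : V ⊗[ℂ] U →ₗ[ℂ] X, ∀ a b, T (a ⊗ₜ b) = f a b :=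
  ⟨TensorProduct.lift (LinearMap.mk₂ ℂ f (fun a a' b => (h₁ b).map_add a a')
    (fun c a b => (h₁ b).map_smul c a) (fun a => (h₂ a).map_add) (fun c a => (h₂ a).map_smul c)),
    fun a b => by simp⟩

theorem exists_map₃ {f : V → U → X → Y} (h₁ : ∀ b c, Lin fun a => f a b c)
    (h₂ : ∀ a c, Lin fun b => f a b c) (h₃ : ∀ a b, Lin fun c => f a b c) :
    ∃ T : V ⊗[ℂ] (U ⊗[ℂ] X) →ₗ[ℂ] Y, ∀ a b c, T (a ⊗ₜ (b ⊗ₜ c)) = f a b c := by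
  choose G hG using fun a => exists_map (h₂ a) (h₃ a)
  have : Lin G := ⟨fun x y => by ext; simp [hG, (h₁ _ _).map_add],
    fun c x => by ext; simp [hG, (h₁ _ _).map_smul]⟩
  obtain ⟨T, hT⟩ := exists_map (f := fun a t => G a t) (by fun_prop) (by fun_prop)
  exact ⟨T, fun a b c => by rw [hT, hG]⟩

@[fun_prop]
theorem lin_ten {f : V → U → X} (h₁ : ∀ b, Lin fun a => f a b) (h₂ : ∀ a, Lin fun b => f a b)
    {g : Z → V ⊗[ℂ] U} (hg : Lin g) : Lin fun z => ten (g z) f := by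
  obtain ⟨T, hT⟩ := exists_map h₁ h₂
  simp only [ten_eq T hT]
  fun_prop

@[fun_prop]
theorem lin_ten' {f : Z → V → U → X} (t : V ⊗[ℂ] U) (h : ∀ a b, Lin fun z => f z a b) :
    Lin fun z => ten t (f z) :=
  ⟨fun x y => by simp only [ten, (h _ _).map_add, Multiset.sum_map_add],
    fun c x => by simp only [ten, (h _ _).map_smul, Multiset.smul_sum, Multiset.map_map]; rfl⟩

theorem ten_tmul {f : V → U → X} (a : V) (b : U) (h₁ : ∀ b, Lin fun a => f a b := by fun_prop)
    (h₂ : ∀ a, Lin fun b => f a b := by fun_prop) : ten (a ⊗ₜ b) f = f a b := by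
  obtain ⟨T, hT⟩ := exists_map h₁ h₂
  rw [ten_eq T hT, hT]

/-- Summation over a tensor that is itself a sum. -/
theorem ten_ten {V' U' : Type*} [AddCommMonoid V'] [Module ℂ V'] [AddCommMonoid U'] [Module ℂ U']
    (t : V' ⊗[ℂ] U') (g : V' → U' → V ⊗[ℂ] U) (f : V → U → X)
    (h₁ : ∀ b, Lin fun a => f a b := by fun_prop) (h₂ : ∀ a, Lin fun b => f a b := by fun_prop) :
    ten (ten t g) f = ten t fun a b => ten (g a b) f :=
  (lin_ten h₁ h₂ Lin.id).map_ten t g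

end Sweedler

end

/-! ### The axioms in Sweedler notation -/

section

variable {W : Type*} [Ring W] [Algebra ℂ W] [Coalgebra ℂ W]
  {X : Type*} [AddCommMonoid X] [Module ℂ X]

/-- The algebra and coalgebra `W`, with the map `S`, is a weak Hopf algebra. -/
abbrev IsWHA (S : W →ₗ[ℂ] W) : Prop :=
  IsWeakHopfAlgebra (LinearMap.mul ℂ W) 1 Coalgebra.comul Coalgebra.counit S

/-- Coassociativity: `∑ f h⁽¹⁾⁽¹⁾ h⁽¹⁾⁽²⁾ h⁽²⁾ = ∑ f h⁽¹⁾ h⁽²⁾⁽¹⁾ h⁽²⁾⁽²⁾`. -/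
theorem sw_coassoc (h : W) (f : W → W → W → X) (h₁ : ∀ b c, Lin fun a => f a b c := by fun_prop)
    (h₂ : ∀ a c, Lin fun b => f a b c := by fun_prop)
    (h₃ : ∀ a b, Lin fun c => f a b c := by fun_prop) :
    (ten (Δ h) fun x c => ten (Δ x) fun a b => f a b c) =
      ten (Δ h) fun a x => ten (Δ x) fun b c => f a b c := by
  obtain ⟨T, hT⟩ := exists_map₃ h₁ h₂ h₃
  have e₁ : (ten (Δ h) fun x c => ten (Δ x) fun a b => f a b c) =
      T (TensorProduct.assoc ℂ W W W (LinearMap.rTensor W Coalgebra.comul (Δ h))) := by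
    conv_rhs => rw [← ten_tmul_self (Δ h), Lin.map_ten
      (g := fun y => T (TensorProduct.assoc ℂ W W W (LinearMap.rTensor W Coalgebra.comul y)))
      (by fun_prop)]
    refine ten_congr fun x c => ?_
    conv_rhs => rw [LinearMap.rTensor_tmul, ← ten_tmul_self (Δ x),
      Lin.map_ten (g := fun y => T (TensorProduct.assoc ℂ W W W (y ⊗ₜ c))) (by fun_prop)]
    simp [hT]
  have e₂ : (ten (Δ h) fun a x => ten (Δ x) fun b c => f a b c) =
      T (LinearMap.lTensor W Coalgebra.comul (Δ h)) := by
    conv_rhs => rw [← ten_tmul_self (Δ h), Lin.map_ten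
      (g := fun y => T (LinearMap.lTensor W Coalgebra.comul y)) (by fun_prop)]
    refine ten_congr fun a x => ?_
    conv_rhs => rw [LinearMap.lTensor_tmul, ← ten_tmul_self (Δ x),
      Lin.map_ten (g := fun y => T (a ⊗ₜ y)) (by fun_prop)]
    simp [hT]
  rw [e₁, e₂, Coalgebra.coassoc_apply]

theorem sw_counit_left (h : W) (f : W → X) (hf : Lin f := by fun_prop) :
    (ten (Δ h) fun a b => ϵ a • f b) = f h := by
  rw [ten_eq (hf.toMap ∘ₗ (TensorProduct.lid ℂ W).toLinearMap ∘ₗ LinearMap.rTensor W ϵ)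
    (by simp)]
  simp

theorem sw_counit_right (h : W) (f : W → X) (hf : Lin f := by fun_prop) :
    (ten (Δ h) fun a b => ϵ b • f a) = f h := by
  rw [ten_eq (hf.toMap ∘ₗ (TensorProduct.rid ℂ W).toLinearMap ∘ₗ LinearMap.lTensor W ϵ)
    (by simp)]
  simp

namespace IsWHA

variable {S : W →ₗ[ℂ] W}

/-- `Δ(hk) = Δ(h) Δ(k)`. -/
theorem sw_mul (hW : IsWHA S) (h k : W) (f : W → W → X)
    (h₁ : ∀ b, Lin fun a => f a b := by fun_prop)
    (h₂ : ∀ a, Lin fun b => f a b := by fun_prop) :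
    ten (Δ (h * k)) f = ten (Δ h) fun a b => ten (Δ k) fun c d => f (a * c) (b * d) := by
  have : Δ (h * k) = ten (Δ h) fun a b => ten (Δ k) fun c d => (a * c) ⊗ₜ[ℂ] (b * d) := by
    refine (hW.comul_mul h k).trans ?_
    conv_lhs => rw [← ten_tmul_self (Δ h), ← ten_tmul_self (Δ k)]
    rw [Lin.map_ten (g := fun y => (TensorProduct.map (TensorProduct.lift (LinearMap.mul ℂ W))
      (TensorProduct.lift (LinearMap.mul ℂ W))
      (TensorProduct.tensorTensorTensorComm ℂ W W W W (y ⊗ₜ _)))) (by fun_prop)]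
    refine ten_congr fun a b => ?_
    rw [Lin.map_ten (g := fun y => (TensorProduct.map (TensorProduct.lift (LinearMap.mul ℂ W))
      (TensorProduct.lift (LinearMap.mul ℂ W))
      (TensorProduct.tensorTensorTensorComm ℂ W W W W (_ ⊗ₜ y)))) (by fun_prop)]
    simp
  rw [this, ten_ten _ _ _ h₁ h₂]
  refine ten_congr fun a b => ?_
  rw [ten_ten _ _ _ h₁ h₂]
  refine ten_congr fun c d => ?_
  rw [ten_tmul _ _ h₁ h₂]

/-- The common part of the two formulas for `Δ₂(1)`: here `m` is the product or its opposite. -/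
theorem sw_one₃_aux (m : W →ₗ[ℂ] W →ₗ[ℂ] W)
    (hm : LinearMap.lTensor W Coalgebra.comul (Δ (1 : W)) = mulMiddle m (Δ 1 ⊗ₜ[ℂ] Δ 1))
    (f : W → W → W → X) (h₁ : ∀ b c, Lin fun a => f a b c)
    (h₂ : ∀ a c, Lin fun b => f a b c)
    (h₃ : ∀ a b, Lin fun c => f a b c) :
    (ten (Δ 1) fun a x => ten (Δ x) fun b c => f a b c) =
      ten (Δ 1) fun a b => ten (Δ 1) fun c d => f a (m b c) d := by
  obtain ⟨T, hT⟩ := exists_map₃ h₁ h₂ h₃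
  have e : (ten (Δ 1) fun a x => ten (Δ x) fun b c => f a b c) =
      T (LinearMap.lTensor W Coalgebra.comul (Δ 1)) := by
    conv_rhs => rw [← ten_tmul_self (Δ (1 : W)), Lin.map_ten
      (g := fun y => T (LinearMap.lTensor W Coalgebra.comul y)) (by fun_prop)]
    refine ten_congr fun a x => ?_
    conv_rhs => rw [LinearMap.lTensor_tmul, ← ten_tmul_self (Δ x),
      Lin.map_ten (g := fun y => T (a ⊗ₜ y)) (by fun_prop)]
    simp [hT]
  rw [e, hm]
  conv_lhs => rw [← ten_tmul_self (Δ (1 : W))]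
  rw [Lin.map_ten (g := fun y => T (mulMiddle m (y ⊗ₜ _)))
      (by fun_prop)]
  refine ten_congr fun a b => ?_
  rw [Lin.map_ten (g := fun y => T (mulMiddle m (_ ⊗ₜ y)))
      (by fun_prop)]
  refine ten_congr fun c d => ?_
  simp [mulMiddle, hT]

/-- `Δ₂(1) = ∑ 1⁽¹⁾ ⊗ 1⁽²⁾ 1′⁽¹⁾ ⊗ 1′⁽²⁾`. -/
theorem sw_one₃ (hW : IsWHA S) (f : W → W → W → X)
    (h₁ : ∀ b c, Lin fun a => f a b c := by fun_prop)
    (h₂ : ∀ a c, Lin fun b => f a b c := by fun_prop)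
    (h₃ : ∀ a b, Lin fun c => f a b c := by fun_prop) :
    (ten (Δ 1) fun a x => ten (Δ x) fun b c => f a b c) =
      ten (Δ 1) fun a b => ten (Δ 1) fun c d => f a (b * c) d :=
  sw_one₃_aux _ hW.comul_one f h₁ h₂ h₃

/-- `Δ₂(1) = ∑ 1⁽¹⁾ ⊗ 1′⁽¹⁾ 1⁽²⁾ ⊗ 1′⁽²⁾`. -/
theorem sw_one₃' (hW : IsWHA S) (f : W → W → W → X)
    (h₁ : ∀ b c, Lin fun a => f a b c := by fun_prop)
    (h₂ : ∀ a c, Lin fun b => f a b c := by fun_prop)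
    (h₃ : ∀ a b, Lin fun c => f a b c := by fun_prop) :
    (ten (Δ 1) fun a x => ten (Δ x) fun b c => f a b c) =
      ten (Δ 1) fun a b => ten (Δ 1) fun c d => f a (c * b) d :=
  sw_one₃_aux _ hW.comul_one' f h₁ h₂ h₃

theorem counit_mul₃ (hW : IsWHA S) (u v w : W) :
    ϵ (u * v * w) = ten (Δ v) fun a b => ϵ (u * a) * ϵ (b * w) := by
  rw [ten_eq (counitPair (LinearMap.mul ℂ W) ϵ u w) (by simp [counitPair]), ← hW.counit_mul]
  simp

theorem counit_mul₃' (hW : IsWHA S) (u v w : W) :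
    ϵ (u * v * w) = ten (Δ v) fun a b => ϵ (u * b) * ϵ (a * w) := by
  rw [ten_eq (counitPair (LinearMap.mul ℂ W) ϵ u w ∘ₗ (TensorProduct.comm ℂ W W).toLinearMap)
    (by simp [counitPair]), LinearMap.comp_apply, LinearEquiv.coe_toLinearMap, ← hW.counit_mul']
  simp

end IsWHA

theorem εL_eq (h : W) : εL W h = ten (Δ 1) fun a b => ϵ (a * h) • b := by
  rw [ten_eq ((TensorProduct.lid ℂ W).toLinearMap ∘ₗ
    (LinearMap.rTensor W (ϵ ∘ₗ (LinearMap.mul ℂ W).flip h))) (by simp)]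
  simp [counitL]

theorem εR_eq (h : W) : εR W h = ten (Δ 1) fun a b => ϵ (h * b) • a := by
  rw [ten_eq ((TensorProduct.rid ℂ W).toLinearMap ∘ₗ
    (LinearMap.lTensor W (ϵ ∘ₗ (LinearMap.mul ℂ W) h))) (by simp)]
  simp [counitR]

namespace IsWHA
variable {S : W →ₗ[ℂ] W}

theorem sw_mul_antipode (hW : IsWHA S) (h : W) : (ten (Δ h) fun a b => a * S b) = εL W h := by
  rw [εL, ← hW.antipode_left]
  exact ten_eq (TensorProduct.lift (LinearMap.mul ℂ W) ∘ₗ LinearMap.lTensor W S) (by simp) _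

theorem sw_antipode_mul (hW : IsWHA S) (h : W) : (ten (Δ h) fun a b => S a * b) = εR W h := by
  rw [εR, ← hW.antipode_right]
  exact ten_eq (TensorProduct.lift (LinearMap.mul ℂ W) ∘ₗ LinearMap.rTensor W S) (by simp) _

theorem sw_εR_mul (hW : IsWHA S) (h : W) : (ten (Δ h) fun a b => εR W a * S b) = S h := by
  conv_rhs => rw [← hW.antipode_mul]
  simp only [εR, ← hW.antipode_right]
  exact ten_eq (TensorProduct.lift (LinearMap.mul ℂ W) ∘ₗ
      TensorProduct.map (TensorProduct.lift (LinearMap.mul ℂ W) ∘ₗ LinearMap.rTensor W S) S ∘ₗ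
      LinearMap.rTensor W Coalgebra.comul) (by simp) _

end IsWHA

end

/-! ### The counital maps -/

section

variable {W : Type*} [Ring W] [Algebra ℂ W] [Coalgebra ℂ W]
  {X : Type*} [AddCommMonoid X] [Module ℂ X]

namespace IsWHA

variable {S : W →ₗ[ℂ] W}

theorem counit_mul_εL (hW : IsWHA S) (u w : W) : ϵ (u * εL W w) = ϵ (u * w) := by
  have h := hW.counit_mul₃' u 1 w
  rw [mul_one] at h
  rw [h, εL_eq, Lin.map_ten (g := fun y => ϵ (u * y)) (by fun_prop)]
  refine ten_congr fun a b => ?_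
  simp [mul_comm]

theorem counit_εR_mul (hW : IsWHA S) (u w : W) : ϵ (εR W u * w) = ϵ (u * w) := by
  have h := hW.counit_mul₃' u 1 w
  rw [mul_one] at h
  rw [h, εR_eq, Lin.map_ten (g := fun y => ϵ (y * w)) (by fun_prop)]
  refine ten_congr fun a b => ?_
  simp

theorem sw_one_mul (hW : IsWHA S) (h : W) (f : W → W → X)
    (h₁ : ∀ b, Lin fun a => f a b := by fun_prop)
    (h₂ : ∀ a, Lin fun b => f a b := by fun_prop) :
    (ten (Δ 1) fun a b => ten (Δ h) fun c d => f (a * c) (b * d)) = ten (Δ h) f := by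
  rw [← hW.sw_mul 1 h f h₁ h₂, one_mul]

theorem sw_mul_one (hW : IsWHA S) (h : W) (f : W → W → X)
    (h₁ : ∀ b, Lin fun a => f a b := by fun_prop)
    (h₂ : ∀ a, Lin fun b => f a b := by fun_prop) :
    (ten (Δ h) fun a b => ten (Δ 1) fun c d => f (a * c) (b * d)) = ten (Δ h) f := by
  rw [← hW.sw_mul h 1 f h₁ h₂, mul_one]

/-- `∑ h⁽¹⁾ ⊗ ε_L(h⁽²⁾) = ∑ 1⁽¹⁾ h ⊗ 1⁽²⁾`. -/
theorem sw_εL_right (hW : IsWHA S) (h : W) (f : W → W → X)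
    (h₁ : ∀ b, Lin fun a => f a b := by fun_prop)
    (h₂ : ∀ a, Lin fun b => f a b := by fun_prop) :
    (ten (Δ h) fun a b => f a (εL W b)) = ten (Δ 1) fun a b => f (a * h) b := by
  calc (ten (Δ h) fun a b => f a (εL W b))
      = ten (Δ h) fun a b => ten (Δ 1) fun p q => ϵ (p * b) • f a q := by
        refine ten_congr fun a b => ?_
        rw [εL_eq, (h₂ a).map_ten]; simp only [(h₂ a).map_smul]
    _ = ten (Δ 1) fun r s => ten (Δ h) fun a b => ten (Δ 1) fun p q =>
          ϵ (p * (s * b)) • f (r * a) q :=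
        (hW.sw_one_mul h (fun a b => ten (Δ 1) fun p q => ϵ (p * b) • f a q)).symm
    _ = ten (Δ h) fun a b => ten (Δ 1) fun r s => ten (Δ 1) fun p q =>
          ϵ (p * s * b) • f (r * a) q := by
        rw [ten_comm]; simp only [mul_assoc]
    _ = ten (Δ h) fun a b => ten (Δ 1) fun r x => ten (Δ x) fun k q => ϵ (k * b) • f (r * a) q :=
        ten_congr fun a b => (hW.sw_one₃' (fun r k q => ϵ (k * b) • f (r * a) q)).symm
    _ = ten (Δ h) fun a b => ten (Δ 1) fun y q => ten (Δ y) fun r k => ϵ (k * b) • f (r * a) q :=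
        ten_congr fun a b => (sw_coassoc 1 (fun r k q => ϵ (k * b) • f (r * a) q)).symm
    _ = ten (Δ 1) fun y q => ten (Δ y) fun r k => ten (Δ h) fun a b => ϵ (k * b) • f (r * a) q := by
        rw [ten_comm]; refine ten_congr fun y q => ?_; rw [ten_comm]
    _ = ten (Δ 1) fun y q => ten (Δ (y * h)) fun u v => ϵ v • f u q :=
        ten_congr fun y q => (hW.sw_mul y h (fun u v => ϵ v • f u q)).symm
    _ = ten (Δ 1) fun a b => f (a * h) b :=
        ten_congr fun y q => sw_counit_right (y * h) (fun u => f u q)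

/-- `∑ ε_R(h⁽¹⁾) ⊗ h⁽²⁾ = ∑ 1⁽¹⁾ ⊗ h 1⁽²⁾`. -/
theorem sw_εR_left (hW : IsWHA S) (h : W) (f : W → W → X)
    (h₁ : ∀ b, Lin fun a => f a b := by fun_prop)
    (h₂ : ∀ a, Lin fun b => f a b := by fun_prop) :
    (ten (Δ h) fun a b => f (εR W a) b) = ten (Δ 1) fun a b => f a (h * b) := by
  calc (ten (Δ h) fun a b => f (εR W a) b)
      = ten (Δ h) fun a b => ten (Δ 1) fun p q => ϵ (a * q) • f p b := by
        refine ten_congr fun a b => ?_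
        rw [εR_eq, (h₁ b).map_ten]; simp only [(h₁ b).map_smul]
    _ = ten (Δ h) fun a b => ten (Δ 1) fun r s => ten (Δ 1) fun p q =>
          ϵ (a * r * q) • f p (b * s) :=
        (hW.sw_mul_one h (fun a b => ten (Δ 1) fun p q => ϵ (a * q) • f p b)).symm
    _ = ten (Δ h) fun a b => ten (Δ 1) fun p q => ten (Δ 1) fun r s =>
          ϵ (a * (r * q)) • f p (b * s) := by
        refine ten_congr fun a b => ?_
        rw [ten_comm]; simp only [mul_assoc]
    _ = ten (Δ h) fun a b => ten (Δ 1) fun p x => ten (Δ x) fun k s => ϵ (a * k) • f p (b * s) :=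
        ten_congr fun a b => (hW.sw_one₃' (fun p k s => ϵ (a * k) • f p (b * s))).symm
    _ = ten (Δ 1) fun p x => ten (Δ h) fun a b => ten (Δ x) fun k s =>
          ϵ (a * k) • f p (b * s) := by
        rw [ten_comm]
    _ = ten (Δ 1) fun p x => ten (Δ (h * x)) fun u v => ϵ u • f p v :=
        ten_congr fun p x => (hW.sw_mul h x (fun u v => ϵ u • f p v)).symm
    _ = ten (Δ 1) fun a b => f a (h * b) :=
        ten_congr fun p x => sw_counit_left (h * x) (fun u => f p u)

/-- `Δ(x) = ∑ 1⁽¹⁾ x ⊗ 1⁽²⁾` for `x = ε_L(h)`. -/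
theorem comul_εL (hW : IsWHA S) (h : W) (f : W → W → X)
    (h₁ : ∀ b, Lin fun a => f a b := by fun_prop)
    (h₂ : ∀ a, Lin fun b => f a b := by fun_prop) :
    ten (Δ (εL W h)) f = ten (Δ 1) fun a b => f (a * εL W h) b := by
  calc ten (Δ (εL W h)) f
      = ten (Δ 1) fun p x => ten (Δ x) fun b c => ϵ (p * h) • f b c := by
        rw [εL_eq, Lin.map_ten (g := fun y => ten (Δ y) f) (by fun_prop)]
        refine ten_congr fun a b => ?_
        simp only [Lin.map_smul (f := fun y => ten (Δ y) f) (by fun_prop)]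
        rw [Lin.map_ten (g := fun y => ϵ (a * h) • y) (by fun_prop)]
    _ = ten (Δ 1) fun a b => ten (Δ 1) fun c d => ϵ (a * h) • f (c * b) d :=
        hW.sw_one₃' (fun p b c => ϵ (p * h) • f b c)
    _ = ten (Δ 1) fun c d => f (c * εL W h) d := by
        rw [ten_comm]
        refine ten_congr fun c d => ?_
        rw [εL_eq, Lin.map_ten (g := fun y => f (c * y) d) (by fun_prop)]
        refine ten_congr fun a b => ?_
        rw [Lin.map_smul (f := fun y => f (c * y) d) (by fun_prop)]

/-- `Δ(x) = ∑ x 1⁽¹⁾ ⊗ 1⁽²⁾` for `x = ε_L(h)`. -/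
theorem comul_εL' (hW : IsWHA S) (h : W) (f : W → W → X)
    (h₁ : ∀ b, Lin fun a => f a b := by fun_prop)
    (h₂ : ∀ a, Lin fun b => f a b := by fun_prop) :
    ten (Δ (εL W h)) f = ten (Δ 1) fun a b => f (εL W h * a) b := by
  calc ten (Δ (εL W h)) f
      = ten (Δ 1) fun p x => ten (Δ x) fun b c => ϵ (p * h) • f b c := by
        rw [εL_eq, Lin.map_ten (g := fun y => ten (Δ y) f) (by fun_prop)]
        refine ten_congr fun a b => ?_
        simp only [Lin.map_smul (f := fun y => ten (Δ y) f) (by fun_prop)]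
        rw [Lin.map_ten (g := fun y => ϵ (a * h) • y) (by fun_prop)]
    _ = ten (Δ 1) fun a b => ten (Δ 1) fun c d => ϵ (a * h) • f (b * c) d :=
        hW.sw_one₃ (fun p b c => ϵ (p * h) • f b c)
    _ = ten (Δ 1) fun c d => f (εL W h * c) d := by
        rw [ten_comm]
        refine ten_congr fun c d => ?_
        rw [εL_eq, Lin.map_ten (g := fun y => f (y * c) d) (by fun_prop)]
        refine ten_congr fun a b => ?_
        rw [Lin.map_smul (f := fun y => f (y * c) d) (by fun_prop)]

/-- `Δ(y) = ∑ 1⁽¹⁾ ⊗ 1⁽²⁾ y` for `y = ε_R(h)`. -/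
theorem comul_εR (hW : IsWHA S) (h : W) (f : W → W → X)
    (h₁ : ∀ b, Lin fun a => f a b := by fun_prop)
    (h₂ : ∀ a, Lin fun b => f a b := by fun_prop) :
    ten (Δ (εR W h)) f = ten (Δ 1) fun a b => f a (b * εR W h) := by
  calc ten (Δ (εR W h)) f
      = ten (Δ 1) fun x p => ten (Δ x) fun b c => ϵ (h * p) • f b c := by
        rw [εR_eq, Lin.map_ten (g := fun y => ten (Δ y) f) (by fun_prop)]
        refine ten_congr fun a b => ?_
        simp only [Lin.map_smul (f := fun y => ten (Δ y) f) (by fun_prop)]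
        rw [Lin.map_ten (g := fun y => ϵ (h * b) • y) (by fun_prop)]
    _ = ten (Δ 1) fun a b => ten (Δ 1) fun c d => ϵ (h * d) • f a (b * c) := by
        rw [sw_coassoc 1 (fun b c p => ϵ (h * p) • f b c)]
        exact hW.sw_one₃ (fun b c p => ϵ (h * p) • f b c)
    _ = ten (Δ 1) fun a b => f a (b * εR W h) := by
        refine ten_congr fun a b => ?_
        rw [εR_eq, Lin.map_ten (g := fun y => f a (b * y)) (by fun_prop)]
        refine ten_congr fun c d => ?_
        rw [Lin.map_smul (f := fun y => f a (b * y)) (by fun_prop)]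

/-- `Δ(y) = ∑ 1⁽¹⁾ ⊗ y 1⁽²⁾` for `y = ε_R(h)`. -/
theorem comul_εR' (hW : IsWHA S) (h : W) (f : W → W → X)
    (h₁ : ∀ b, Lin fun a => f a b := by fun_prop)
    (h₂ : ∀ a, Lin fun b => f a b := by fun_prop) :
    ten (Δ (εR W h)) f = ten (Δ 1) fun a b => f a (εR W h * b) := by
  calc ten (Δ (εR W h)) f
      = ten (Δ 1) fun x p => ten (Δ x) fun b c => ϵ (h * p) • f b c := by
        rw [εR_eq, Lin.map_ten (g := fun y => ten (Δ y) f) (by fun_prop)]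
        refine ten_congr fun a b => ?_
        simp only [Lin.map_smul (f := fun y => ten (Δ y) f) (by fun_prop)]
        rw [Lin.map_ten (g := fun y => ϵ (h * b) • y) (by fun_prop)]
    _ = ten (Δ 1) fun a b => ten (Δ 1) fun c d => ϵ (h * d) • f a (c * b) := by
        rw [sw_coassoc 1 (fun b c p => ϵ (h * p) • f b c)]
        exact hW.sw_one₃' (fun b c p => ϵ (h * p) • f b c)
    _ = ten (Δ 1) fun a b => f a (εR W h * b) := by
        refine ten_congr fun a b => ?_
        rw [εR_eq, Lin.map_ten (g := fun y => f a (y * b)) (by fun_prop)]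
        refine ten_congr fun c d => ?_
        rw [Lin.map_smul (f := fun y => f a (y * b)) (by fun_prop)]

end IsWHA

end

/-! ### The counital subalgebras and the antipode -/

section

variable {W : Type*} [Ring W] [Algebra ℂ W] [Coalgebra ℂ W]
  {X : Type*} [AddCommMonoid X] [Module ℂ X]

variable (W) in
/-- The left counital subalgebra `W_L`. -/
abbrev WL : Submodule ℂ W := LinearMap.range (εL W)

variable (W) in
/-- The right counital subalgebra `W_R`. -/
abbrev WR : Submodule ℂ W := LinearMap.range (εR W)

theorem εL_mem (h : W) : εL W h ∈ WL W := ⟨h, rfl⟩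

theorem εR_mem (h : W) : εR W h ∈ WR W := ⟨h, rfl⟩

theorem εL_one : εL W 1 = 1 := by
  rw [εL_eq]; simp only [mul_one]
  exact sw_counit_left (1 : W) (fun b => b)

theorem εR_one : εR W 1 = 1 := by
  rw [εR_eq]; simp only [one_mul]
  exact sw_counit_right (1 : W) (fun b => b)

namespace IsWHA

variable {S : W →ₗ[ℂ] W} {x y : W}

/-- `Δ(xh) = ∑ x h⁽¹⁾ ⊗ h⁽²⁾` for `x ∈ W_L`. -/
theorem sw_memL_mul (hW : IsWHA S) (hx : x ∈ WL W) (h : W) (f : W → W → X)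
    (h₁ : ∀ b, Lin fun a => f a b := by fun_prop)
    (h₂ : ∀ a, Lin fun b => f a b := by fun_prop) :
    ten (Δ (x * h)) f = ten (Δ h) fun a b => f (x * a) b := by
  obtain ⟨k, rfl⟩ := hx
  rw [hW.sw_mul _ _ f h₁ h₂, hW.comul_εL' k (fun p q => ten (Δ h) fun c d => f (p * c) (q * d))]
  simp only [mul_assoc]
  exact hW.sw_one_mul h (fun c d => f (_ * c) d)

/-- `Δ(hx) = ∑ h⁽¹⁾ x ⊗ h⁽²⁾` for `x ∈ W_L`. -/
theorem sw_mul_memL (hW : IsWHA S) (hx : x ∈ WL W) (h : W) (f : W → W → X)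
    (h₁ : ∀ b, Lin fun a => f a b := by fun_prop)
    (h₂ : ∀ a, Lin fun b => f a b := by fun_prop) :
    ten (Δ (h * x)) f = ten (Δ h) fun a b => f (a * x) b := by
  obtain ⟨k, rfl⟩ := hx
  rw [hW.sw_mul _ _ f h₁ h₂, ← hW.sw_mul_one h (fun a b => f (a * εL W k) b)]
  refine ten_congr fun a b => ?_
  rw [hW.comul_εL k (fun p q => f (a * p) (b * q))]
  simp only [mul_assoc]

/-- `Δ(yh) = ∑ h⁽¹⁾ ⊗ y h⁽²⁾` for `y ∈ W_R`. -/
theorem sw_memR_mul (hW : IsWHA S) (hy : y ∈ WR W) (h : W) (f : W → W → X)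
    (h₁ : ∀ b, Lin fun a => f a b := by fun_prop)
    (h₂ : ∀ a, Lin fun b => f a b := by fun_prop) :
    ten (Δ (y * h)) f = ten (Δ h) fun a b => f a (y * b) := by
  obtain ⟨k, rfl⟩ := hy
  rw [hW.sw_mul _ _ f h₁ h₂, hW.comul_εR' k (fun p q => ten (Δ h) fun c d => f (p * c) (q * d))]
  simp only [mul_assoc]
  exact hW.sw_one_mul h (fun c d => f c (_ * d))

/-- `Δ(hy) = ∑ h⁽¹⁾ ⊗ h⁽²⁾ y` for `y ∈ W_R`. -/
theorem sw_mul_memR (hW : IsWHA S) (hy : y ∈ WR W) (h : W) (f : W → W → X)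
    (h₁ : ∀ b, Lin fun a => f a b := by fun_prop)
    (h₂ : ∀ a, Lin fun b => f a b := by fun_prop) :
    ten (Δ (h * y)) f = ten (Δ h) fun a b => f a (b * y) := by
  obtain ⟨k, rfl⟩ := hy
  rw [hW.sw_mul _ _ f h₁ h₂, ← hW.sw_mul_one h (fun a b => f a (b * εR W k))]
  refine ten_congr fun a b => ?_
  rw [hW.comul_εR k (fun p q => f (a * p) (b * q))]
  simp only [mul_assoc]

theorem εL_mul_εL (hW : IsWHA S) (h k : W) : εL W (h * εL W k) = εL W (h * k) := by
  rw [εL_eq, εL_eq (h * k)]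
  refine ten_congr fun a b => ?_
  rw [← mul_assoc, hW.counit_mul_εL, mul_assoc]

theorem εR_εR_mul (hW : IsWHA S) (h k : W) : εR W (εR W h * k) = εR W (h * k) := by
  rw [εR_eq, εR_eq (h * k)]
  refine ten_congr fun a b => ?_
  rw [mul_assoc, hW.counit_εR_mul, mul_assoc]

theorem εL_memL_mul (hW : IsWHA S) (hx : x ∈ WL W) (k : W) : εL W (x * k) = x * εL W k := by
  rw [← hW.sw_mul_antipode, hW.sw_memL_mul hx k (fun a b => a * S b), ← hW.sw_mul_antipode,
    Lin.map_ten (g := fun z => x * z) (by fun_prop)]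
  simp only [mul_assoc]

theorem εR_mul_memR (hW : IsWHA S) (hy : y ∈ WR W) (k : W) : εR W (k * y) = εR W k * y := by
  rw [← hW.sw_antipode_mul, hW.sw_mul_memR hy k (fun a b => S a * b), ← hW.sw_antipode_mul,
    Lin.map_ten (g := fun z => z * y) (by fun_prop)]
  simp only [mul_assoc]

/-- `ε_L(kx) = ∑ k⁽¹⁾ x S(k⁽²⁾)` for `x ∈ W_L`. -/
theorem εL_mul_memL (hW : IsWHA S) (hx : x ∈ WL W) (k : W) :
    εL W (k * x) = ten (Δ k) fun a b => a * x * S b := by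
  rw [← hW.sw_mul_antipode, hW.sw_mul_memL hx k (fun a b => a * S b)]

/-- `ε_R(yk) = ∑ S(k⁽¹⁾) y k⁽²⁾` for `y ∈ W_R`. -/
theorem εR_memR_mul (hW : IsWHA S) (hy : y ∈ WR W) (k : W) :
    εR W (y * k) = ten (Δ k) fun a b => S a * (y * b) := by
  rw [← hW.sw_antipode_mul, hW.sw_memR_mul hy k (fun a b => S a * b)]

/-- The subalgebras `W_L` and `W_R` commute: the two formulas for `Δ₂(1)` differ in the order of the
factors in the middle leg. -/
theorem commute (hW : IsWHA S) (hx : x ∈ WL W) (hy : y ∈ WR W) : x * y = y * x := by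
  obtain ⟨h, rfl⟩ := hx
  obtain ⟨k, rfl⟩ := hy
  have e₁ : εL W h * εR W k =
      ten (Δ 1) fun a b => ten (Δ 1) fun c d => (ϵ (a * h) * ϵ (k * d)) • (b * c) := by
    rw [εL_eq, Lin.map_ten (g := fun z => z * εR W k) (by fun_prop)]
    refine ten_congr fun a b => ?_
    rw [εR_eq, Lin.map_ten (g := fun z => (ϵ (a * h) • b) * z) (by fun_prop)]
    refine ten_congr fun c d => ?_
    rw [smul_mul_smul_comm]
  have e₂ : εR W k * εL W h =
      ten (Δ 1) fun a b => ten (Δ 1) fun c d => (ϵ (a * h) * ϵ (k * d)) • (c * b) := by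
    rw [εL_eq, Lin.map_ten (g := fun z => εR W k * z) (by fun_prop)]
    refine ten_congr fun a b => ?_
    rw [εR_eq, Lin.map_ten (g := fun z => z * (ϵ (a * h) • b)) (by fun_prop)]
    refine ten_congr fun c d => ?_
    rw [smul_mul_smul_comm, mul_comm (ϵ (k * d))]
  simp only [mul_smul] at e₁ e₂
  rw [e₁, e₂, ← hW.sw_one₃ (fun a b c => ϵ (a * h) • ϵ (k * c) • b),
    hW.sw_one₃' (fun a b c => ϵ (a * h) • ϵ (k * c) • b)]

/-- `Δ(1) ∈ W ⊗ W_L`. -/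
theorem sw_one_εL (hW : IsWHA S) (f : W → W → X)
    (h₁ : ∀ b, Lin fun a => f a b := by fun_prop)
    (h₂ : ∀ a, Lin fun b => f a b := by fun_prop) :
    (ten (Δ 1) fun a b => f a (εL W b)) = ten (Δ 1) f := by
  rw [hW.sw_εL_right 1 f]
  simp only [mul_one]

/-- `Δ(1) ∈ W_R ⊗ W`. -/
theorem sw_one_εR (hW : IsWHA S) (f : W → W → X)
    (h₁ : ∀ b, Lin fun a => f a b := by fun_prop)
    (h₂ : ∀ a, Lin fun b => f a b := by fun_prop) :
    (ten (Δ 1) fun a b => f (εR W a) b) = ten (Δ 1) f := by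
  rw [hW.sw_εR_left 1 f]
  simp only [one_mul]

/-- `Δ(1) ∈ W_R ⊗ W_L`. -/
theorem sw_one_εR_εL (hW : IsWHA S) (f : W → W → X)
    (h₁ : ∀ b, Lin fun a => f a b := by fun_prop)
    (h₂ : ∀ a, Lin fun b => f a b := by fun_prop) :
    (ten (Δ 1) fun a b => f (εR W a) (εL W b)) = ten (Δ 1) f := by
  rw [hW.sw_one_εR (fun a b => f a (εL W b)), hW.sw_one_εL f]

theorem sw_antipode_εL (hW : IsWHA S) (h : W) : (ten (Δ h) fun a b => S a * εL W b) = S h := by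
  conv_rhs => rw [← hW.sw_εR_mul]
  calc (ten (Δ h) fun a b => S a * εL W b)
      = ten (Δ h) fun a x => ten (Δ x) fun b c => S a * (b * S c) := by
        refine ten_congr fun a b => ?_
        rw [← hW.sw_mul_antipode, Lin.map_ten (g := fun z => S a * z) (by fun_prop)]
    _ = ten (Δ h) fun x c => ten (Δ x) fun a b => S a * (b * S c) :=
        (sw_coassoc h (fun a b c => S a * (b * S c))).symm
    _ = _ := by
        refine ten_congr fun a b => ?_
        rw [← hW.sw_antipode_mul, Lin.map_ten (g := fun z => z * S b) (by fun_prop)]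
        simp only [mul_assoc]

/-- The antipode is antimultiplicative. The element `∑ ε_R(h⁽¹⁾ k⁽¹⁾) S(h⁽²⁾ k⁽²⁾)` is expanded by
`ε_R(ab) = ∑ S(b⁽¹⁾) ε_R(a) b⁽²⁾`, and then contracted by `ε_L(ab) = ∑ a⁽¹⁾ ε_L(b) S(a⁽²⁾)`. -/
theorem antipode_antimul (hW : IsWHA S) (h k : W) : S (h * k) = S k * S h := by
  have e₁ : ∀ h k : W, εR W (h * k) = ten (Δ k) fun a b => S a * (εR W h * b) := fun h k => by
    rw [← hW.εR_εR_mul, hW.εR_memR_mul (εR_mem h)]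
  have e₂ : ∀ h k : W, εL W (h * k) = ten (Δ h) fun a b => a * εL W k * S b := fun h k => by
    rw [← hW.εL_mul_εL, hW.εL_mul_memL (εL_mem k)]
  calc S (h * k) = ten (Δ h) fun a a' => ten (Δ k) fun b b' => εR W (a * b) * S (a' * b') := by
        rw [← hW.sw_εR_mul, hW.sw_mul h k (fun a b => εR W a * S b)]
    _ = ten (Δ h) fun x c => ten (Δ x) fun a b => ten (Δ k) fun x' c' => ten (Δ x') fun a' b' =>
          S a' * (S a * b * b') * S (c * c') := by
        refine ten_congr fun x c => ?_
        rw [ten_comm]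
        refine ten_congr fun x' c' => ?_
        rw [ten_comm, e₁, Lin.map_ten (g := fun z => z * S (c * c')) (by fun_prop)]
        refine ten_congr fun a' b' => ?_
        rw [← hW.sw_antipode_mul,
          Lin.map_ten (g := fun z => S a' * (z * b') * S (c * c')) (by fun_prop)]
    _ = ten (Δ h) fun a x => ten (Δ k) fun a' x' => ten (Δ x) fun b c => ten (Δ x') fun b' c' =>
          S a' * S a * ((b * b') * S (c * c')) := by
        rw [sw_coassoc h (fun a b c => ten (Δ k) fun x' c' => ten (Δ x') fun a' b' =>
          S a' * (S a * b * b') * S (c * c'))]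
        refine ten_congr fun a x => ?_
        rw [ten_comm]
        calc _ = ten (Δ k) fun x' c' => ten (Δ x') fun a' b' => ten (Δ x) fun b c =>
              S a' * S a * ((b * b') * S (c * c')) := by
              refine ten_congr fun x' c' => ?_
              rw [ten_comm]
              simp only [mul_assoc]
          _ = _ := by
              rw [sw_coassoc k (fun a' b' c' => ten (Δ x) fun b c =>
                S a' * S a * ((b * b') * S (c * c')))]
              refine ten_congr fun a' x' => ?_
              rw [ten_comm]
    _ = ten (Δ h) fun a x => ten (Δ k) fun a' x' => S a' * S a * εL W (x * x') := by
        refine ten_congr fun a x => ten_congr fun a' x' => ?_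
        rw [← hW.sw_mul_antipode, hW.sw_mul x x' (fun p q => p * S q),
          Lin.map_ten (g := fun z => S a' * S a * z) (by fun_prop)]
        refine ten_congr fun b c => ?_
        rw [Lin.map_ten (g := fun z => S a' * S a * z) (by fun_prop)]
    _ = ten (Δ k) fun a' x' => ten (Δ h) fun a x => ten (Δ x) fun b c =>
          S a' * (S a * b) * (εL W x' * S c) := by
        rw [ten_comm]
        refine ten_congr fun a' x' => ten_congr fun a x => ?_
        rw [e₂, Lin.map_ten (g := fun z => S a' * S a * z) (by fun_prop)]
        simp only [mul_assoc]
    _ = ten (Δ k) fun a' x' => ten (Δ h) fun y c => S a' * εR W y * (εL W x' * S c) := by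
        refine ten_congr fun a' x' => ?_
        rw [← sw_coassoc h (fun a b c => S a' * (S a * b) * (εL W x' * S c))]
        refine ten_congr fun y c => ?_
        rw [← hW.sw_antipode_mul,
          Lin.map_ten (g := fun z => S a' * z * (εL W x' * S c)) (by fun_prop)]
    _ = ten (Δ k) fun a' x' => ten (Δ h) fun y c => (S a' * εL W x') * (εR W y * S c) := by
        refine ten_congr fun a' x' => ten_congr fun y c => ?_
        have := hW.commute (εL_mem x') (εR_mem y)
        rw [mul_assoc, ← mul_assoc (εR W y), ← this]
        simp only [mul_assoc]
    _ = S k * S h := by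
        rw [← hW.sw_antipode_εL k, Lin.map_ten (g := fun z => z * S h) (by fun_prop)]
        refine ten_congr fun a' x' => ?_
        conv_rhs => rw [← hW.sw_εR_mul h,
          Lin.map_ten (g := fun z => S a' * εL W x' * z) (by fun_prop)]

theorem antipode_one (hW : IsWHA S) : S 1 = 1 := by
  rw [← hW.sw_antipode_εL, hW.sw_εL_right 1 (fun a b => S a * b)]
  simp only [mul_one]
  rw [hW.sw_antipode_mul, εR_one]

theorem εR_of_memL (hW : IsWHA S) (hx : x ∈ WL W) : εR W x = S x := by
  have := hW.sw_mul_memL hx 1 (fun a b => S a * b)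
  rw [one_mul, hW.sw_antipode_mul] at this
  simp only [this, hW.antipode_antimul, mul_assoc]
  rw [← Lin.map_ten (g := fun z => S x * z) (by fun_prop), hW.sw_antipode_mul, εR_one, mul_one]

theorem εL_of_memR (hW : IsWHA S) (hy : y ∈ WR W) : εL W y = S y := by
  have := hW.sw_memR_mul hy 1 (fun a b => a * S b)
  rw [mul_one, hW.sw_mul_antipode] at this
  simp only [this, hW.antipode_antimul, ← mul_assoc]
  rw [← Lin.map_ten (g := fun z => z * S y) (by fun_prop), hW.sw_mul_antipode, εL_one, one_mul]

theorem antipode_memR (hW : IsWHA S) (hx : x ∈ WL W) : S x ∈ WR W :=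
  hW.εR_of_memL hx ▸ εR_mem x

theorem antipode_memL (hW : IsWHA S) (hy : y ∈ WR W) : S y ∈ WL W :=
  hW.εL_of_memR hy ▸ εL_mem y

/-- `∑ S(1⁽²⁾) ⊗ S(1⁽¹⁾) = ∑ 1⁽¹⁾ ⊗ 1⁽²⁾`. -/
theorem sw_one_antipode (hW : IsWHA S) (f : W → W → X)
    (h₁ : ∀ b, Lin fun a => f a b := by fun_prop)
    (h₂ : ∀ a, Lin fun b => f a b := by fun_prop) :
    (ten (Δ 1) fun a b => f (S b) (S a)) = ten (Δ 1) f := by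
  -- the sum `∑ 1⁽¹⁾ ε(1⁽²⁾ k)` is a preimage of `ε_L(k)` under `ε_L`
  have e : ∀ k : W, (ten (Δ 1) fun a b => ϵ (b * k) • εL W a) = εL W k := fun k => by
    calc (ten (Δ 1) fun a b => ϵ (b * k) • εL W a)
        = ten (Δ 1) fun c d => ten (Δ 1) fun a b => (ϵ (c * a) * ϵ (b * k)) • d := by
          rw [ten_comm]
          refine ten_congr fun a b => ?_
          rw [εL_eq, Lin.map_ten (g := fun z => ϵ (b * k) • z) (by fun_prop)]
          simp only [smul_smul, mul_comm]
      _ = ten (Δ 1) fun c d => ϵ (c * k) • d := by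
          refine ten_congr fun c d => ?_
          have := hW.counit_mul₃ c 1 k
          rw [mul_one] at this
          rw [this, Lin.map_ten (g := fun z : ℂ => z • d) (by fun_prop)]
      _ = εL W k := (εL_eq k).symm
  calc (ten (Δ 1) fun a b => f (S b) (S a))
      = ten (Δ 1) fun a b => f (εR W b) (εL W a) := by
        rw [← hW.sw_one_εR_εL (fun a b => f (S b) (S a)),
          ← hW.sw_one_εR_εL (fun a b => f (εR W b) (εL W a))]
        refine ten_congr fun a b => ?_
        rw [hW.εR_of_memL (εL_mem b), hW.εL_of_memR (εR_mem a)]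
    _ = ten (Δ 1) fun c d => ten (Δ 1) fun a b => ϵ (b * d) • f c (εL W a) := by
        rw [ten_comm]
        refine ten_congr fun a b => ?_
        rw [εR_eq, Lin.map_ten (g := fun z => f z (εL W a)) (by fun_prop)]
        simp only [(h₁ _).map_smul]
    _ = ten (Δ 1) fun c d => f c (εL W d) := by
        refine ten_congr fun c d => ?_
        rw [← e d, (h₂ c).map_ten]
        simp only [(h₂ c).map_smul]
    _ = ten (Δ 1) f := by
        rw [hW.sw_εL_right 1 f]; simp only [mul_one]

/-- The antipode is anticomultiplicative. In the expansion
`Δ(S(h)) = ∑ S(h⁽²⁾) h⁽³⁾ S(h⁽⁵⁾)⁽¹⁾ ⊗ S(h⁽¹⁾) h⁽⁴⁾ S(h⁽⁵⁾)⁽²⁾` the last factors combine to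
`Δ(h⁽³⁾ S(h⁽⁴⁾)) = Δ(ε_L(h⁽³⁾))`, which is absorbed on the left. -/
theorem sw_antipode (hW : IsWHA S) (h : W) (f : W → W → X)
    (h₁ : ∀ b, Lin fun a => f a b := by fun_prop)
    (h₂ : ∀ a, Lin fun b => f a b := by fun_prop) :
    ten (Δ (S h)) f = ten (Δ h) fun a b => f (S b) (S a) := by
  calc ten (Δ (S h)) f
      = ten (Δ h) fun a b => ten (Δ (S b)) fun r s => ten (Δ 1) fun p q =>
          f (p * r) (εR W a * q * s) := by
        conv_lhs => rw [← hW.sw_εR_mul]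
        rw [Lin.map_ten (g := fun z => ten (Δ z) f) (by fun_prop)]
        refine ten_congr fun a b => ?_
        rw [hW.sw_mul _ _ f h₁ h₂,
          hW.comul_εR' a (fun p q => ten (Δ (S b)) fun r s => f (p * r) (q * s)), ten_comm]
    _ = ten (Δ h) fun x e => ten (Δ x) fun a d => ten (Δ (S e)) fun r s => ten (Δ 1) fun p q =>
          f (p * r) (S a * (d * q) * s) := by
        refine ten_congr fun x e => ?_
        rw [← hW.sw_antipode_mul x, Lin.map_ten (g := fun z =>
          ten (Δ (S e)) fun r s => ten (Δ 1) fun p q => f (p * r) (z * q * s)) (by fun_prop)]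
        simp only [mul_assoc]
    _ = ten (Δ h) fun x e => ten (Δ x) fun a d => ten (Δ (S e)) fun r s => ten (Δ d) fun b c =>
          f (εR W b * r) (S a * c * s) := by
        refine ten_congr fun x e => ten_congr fun a d => ten_congr fun r s => ?_
        rw [hW.sw_εR_left d (fun p q => f (p * r) (S a * q * s))]
    _ = ten (Δ h) fun x e => ten (Δ x) fun y d => ten (Δ y) fun a b => ten (Δ (S e)) fun r s =>
          ten (Δ d) fun c c' => f (S b * c * r) (S a * c' * s) := by
        refine ten_congr fun x e => ?_
        calc _ = ten (Δ x) fun a d => ten (Δ d) fun b c => ten (Δ (S e)) fun r s =>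
              f (εR W b * r) (S a * c * s) := by
              refine ten_congr fun a d => ?_
              rw [ten_comm]
          _ = ten (Δ x) fun a d => ten (Δ d) fun b c => ten (Δ b) fun b b' =>
              ten (Δ (S e)) fun r s => f (S b * b' * r) (S a * c * s) := by
              refine ten_congr fun a d => ten_congr fun b c => ?_
              rw [← hW.sw_antipode_mul b, Lin.map_ten (g := fun z =>
                ten (Δ (S e)) fun r s => f (z * r) (S a * c * s)) (by fun_prop)]
          _ = ten (Δ x) fun a d => ten (Δ d) fun b c => ten (Δ c) fun b' c =>
              ten (Δ (S e)) fun r s => f (S b * b' * r) (S a * c * s) := by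
              refine ten_congr fun a d => ?_
              rw [sw_coassoc d (fun b b' c => ten (Δ (S e)) fun r s =>
                f (S b * b' * r) (S a * c * s))]
          _ = _ := by
              rw [← sw_coassoc x (fun a b c => ten (Δ c) fun b' c =>
                ten (Δ (S e)) fun r s => f (S b * b' * r) (S a * c * s))]
              refine ten_congr fun a d => ten_congr fun b c => ?_
              rw [ten_comm]
    _ = ten (Δ h) fun x e => ten (Δ x) fun y d => ten (Δ (d * S e)) fun c c' =>
          ten (Δ y) fun a b => f (S b * c) (S a * c') := by
        refine ten_congr fun x e => ten_congr fun y d => ?_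
        rw [hW.sw_mul d (S e) (fun c c' => ten (Δ y) fun a b => f (S b * c) (S a * c')),
          ten_comm (Δ y), ten_comm (Δ d)]
        refine ten_congr fun r s => ?_
        rw [ten_comm]
        simp only [mul_assoc]
    _ = ten (Δ h) fun y k => ten (Δ (εL W k)) fun c c' => ten (Δ y) fun a b =>
          f (S b * c) (S a * c') := by
        rw [sw_coassoc h (fun y d e => ten (Δ (d * S e)) fun c c' =>
          ten (Δ y) fun a b => f (S b * c) (S a * c'))]
        refine ten_congr fun y k => ?_
        rw [← hW.sw_mul_antipode k, Lin.map_ten (g := fun z => ten (Δ z) fun c c' =>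
          ten (Δ y) fun a b => f (S b * c) (S a * c')) (by fun_prop)]
    _ = ten (Δ h) fun y k => ten (Δ y) fun a b => ten (Δ 1) fun c c' =>
          f (S b * (εL W k * c)) (S a * c') := by
        refine ten_congr fun y k => ?_
        rw [hW.comul_εL' k (fun c c' => ten (Δ y) fun a b => f (S b * c) (S a * c')), ten_comm]
    _ = ten (Δ h) fun a b => ten (Δ 1) fun c c' => f (S b * c) (S a * c') := by
        rw [sw_coassoc h (fun a b k => ten (Δ 1) fun c c' => f (S b * (εL W k * c)) (S a * c'))]
        refine ten_congr fun a x => ?_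
        rw [← hW.sw_antipode_εL x,
          Lin.map_ten (g := fun z => ten (Δ 1) fun c c' => f (z * c) (S a * c')) (by fun_prop)]
        simp only [mul_assoc]
    _ = ten (Δ h) fun a b => f (S b) (S a) := by
        calc _ = ten (Δ 1) fun c c' => ten (Δ h) fun a b => f (S (c' * b)) (S (c * a)) := by
              rw [ten_comm,
                ← hW.sw_one_antipode (fun c c' => ten (Δ h) fun a b => f (S b * c) (S a * c'))]
              simp only [hW.antipode_antimul]
          _ = _ := hW.sw_one_mul h (fun a b => f (S b) (S a))

theorem εL_antipode (hW : IsWHA S) (h : W) : εL W (S h) = S (εR W h) := by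
  rw [← hW.sw_mul_antipode, hW.sw_antipode h (fun a b => a * S b), ← hW.sw_antipode_mul, map_ten]
  simp only [hW.antipode_antimul]

/-- `∑ ε_L(h⁽¹⁾) h⁽²⁾ = h`. -/
theorem εL_mul (hW : IsWHA S) (h : W) : (ten (Δ h) fun a b => εL W a * b) = h := by
  calc _ = ten (Δ 1) fun p q => ten (Δ h) fun a b => ϵ (p * a) • (q * b) := by
        rw [ten_comm]
        refine ten_congr fun a b => ?_
        rw [εL_eq, Lin.map_ten (g := fun z => z * b) (by fun_prop)]
        simp only [smul_mul_assoc]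
    _ = _ := by
        rw [hW.sw_one_mul h (fun a b => ϵ a • b)]
        exact sw_counit_left h (fun b => b)

/-- `∑ h⁽¹⁾ ε_R(h⁽²⁾) = h`. -/
theorem mul_εR (hW : IsWHA S) (h : W) : (ten (Δ h) fun a b => a * εR W b) = h := by
  calc _ = ten (Δ h) fun a b => ten (Δ 1) fun p q => ϵ (b * q) • (a * p) := by
        refine ten_congr fun a b => ?_
        rw [εR_eq, Lin.map_ten (g := fun z => a * z) (by fun_prop)]
        simp only [mul_smul_comm]
    _ = _ := by
        rw [hW.sw_mul_one h (fun a b => ϵ b • a)]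
        exact sw_counit_right h (fun b => b)

theorem εL_εL_mul (hW : IsWHA S) (h k : W) :
    εL W (εL W h * k) = εL W h * εL W k := hW.εL_memL_mul (εL_mem h) k

/-- `ε_R(kx) = S(x) ε_R(k)` for `x ∈ W_L`. -/
theorem εR_mul_memL (hW : IsWHA S) (hx : x ∈ WL W) (k : W) :
    εR W (k * x) = S x * εR W k := by
  rw [← hW.εR_εR_mul, ← hW.commute hx (εR_mem k), hW.εR_mul_memR (εR_mem k), hW.εR_of_memL hx]

/-- `∑ ε_R(y h⁽¹⁾) S(h⁽²⁾) = S(h) y` for `y ∈ W_R`. -/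
theorem sw_εR_memR_mul (hW : IsWHA S) (hy : y ∈ WR W) (h : W) :
    (ten (Δ h) fun a b => εR W (y * a) * S b) = S h * y := by
  calc _ = ten (Δ h) fun x c => ten (Δ x) fun a b => S a * (y * (b * S c)) := by
        refine ten_congr fun x c => ?_
        rw [← hW.sw_antipode_mul, hW.sw_memR_mul hy x (fun a b => S a * b),
          Lin.map_ten (g := fun z => z * S c) (by fun_prop)]
        simp only [mul_assoc]
    _ = ten (Δ h) fun a x => S a * εL W x * y := by
        rw [sw_coassoc h (fun a b c => S a * (y * (b * S c)))]
        refine ten_congr fun a x => ?_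
        rw [← Lin.map_ten (g := fun z => S a * (y * z)) (by fun_prop) (Δ x)
          (fun b c => b * S c), hW.sw_mul_antipode, ← hW.commute (εL_mem x) hy, mul_assoc]
    _ = _ := by
        rw [← Lin.map_ten (g := fun z => z * y) (by fun_prop) (Δ h)
          (fun a x => S a * εL W x), hW.sw_antipode_εL]

end IsWHA

end

/-! ### Bijectivity of the antipode -/

section

variable {W : Type*} [Ring W] [Algebra ℂ W] [Coalgebra ℂ W]
  {X : Type*} [AddCommMonoid X] [Module ℂ X]

namespace IsWHA

variable {S : W →ₗ[ℂ] W} {x y : W}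

/-- `W_L ⊆ S(W_R)`: a preimage of `ε_L(h)` is `∑ ε(S(1⁽²⁾) h) 1⁽¹⁾`, by `(S ⊗ S)Δ(1) = Δᵒᵖ(1)`. -/
theorem WL_le_map (hW : IsWHA S) : WL W ≤ (WR W).map S := by
  rintro _ ⟨h, rfl⟩
  refine ⟨εR W (ten (Δ 1) fun a b => ϵ (S b * h) • a), εR_mem _, ?_⟩
  rw [map_ten, map_ten, εL_eq, ← hW.sw_one_antipode (fun a b => ϵ (a * h) • b)]
  simp only [map_smul]
  rw [hW.sw_εR_left 1 (fun a b => ϵ (S b * h) • S a)]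
  simp only [one_mul]

theorem WR_le_map (hW : IsWHA S) : WR W ≤ (WL W).map S := by
  rintro _ ⟨h, rfl⟩
  refine ⟨εL W (ten (Δ 1) fun a b => ϵ (h * S a) • b), εL_mem _, ?_⟩
  rw [map_ten, map_ten, εR_eq, ← hW.sw_one_antipode (fun a b => ϵ (h * b) • a)]
  simp only [map_smul]
  rw [hW.sw_εL_right 1 (fun a b => ϵ (h * S a) • S b)]
  simp only [mul_one]

theorem le_range_pow (hW : IsWHA S) (n : ℕ) :
    WL W ≤ LinearMap.range ((S : Module.End ℂ W) ^ n) ∧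
      WR W ≤ LinearMap.range ((S : Module.End ℂ W) ^ n) := by
  induction n with
  | zero => simp [Module.End.one_eq_id]
  | succ n ih =>
    have key : ∀ A B : Submodule ℂ W, A ≤ B.map S →
        B ≤ LinearMap.range ((S : Module.End ℂ W) ^ n) →
        A ≤ LinearMap.range ((S : Module.End ℂ W) ^ (n + 1)) := fun A B hA hB a ha => by
      obtain ⟨b, hb, rfl⟩ := hA ha
      obtain ⟨c, rfl⟩ := hB hb
      exact ⟨c, by rw [pow_succ']; rfl⟩
    exact ⟨key _ _ hW.WL_le_map ih.2, key _ _ hW.WR_le_map ih.1⟩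

/-- The kernel of a power of the antipode is a two-sided ideal. -/
theorem pow_antipode_mul_eq_zero (hW : IsWHA S) (n : ℕ) (u v w : W)
    (hv : ((S : Module.End ℂ W) ^ n) v = 0) : ((S : Module.End ℂ W) ^ n) (u * v * w) = 0 := by
  induction n generalizing u v w with
  | zero => simp_all
  | succ n ih =>
    rw [pow_succ, Module.End.mul_apply] at hv ⊢
    rw [hW.antipode_antimul, hW.antipode_antimul, ← mul_assoc]
    exact ih _ _ _ hv

/-- The range of a power of the antipode is closed under products. -/
theorem range_pow_mul (hW : IsWHA S) (n : ℕ) (u v : W)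
    (hu : u ∈ LinearMap.range ((S : Module.End ℂ W) ^ n))
    (hv : v ∈ LinearMap.range ((S : Module.End ℂ W) ^ n)) :
    u * v ∈ LinearMap.range ((S : Module.End ℂ W) ^ n) := by
  induction n generalizing u v with
  | zero => simp [Module.End.one_eq_id]
  | succ n ih =>
    obtain ⟨a, rfl⟩ := hu
    obtain ⟨b, rfl⟩ := hv
    obtain ⟨c, hc⟩ := ih _ _ ⟨b, rfl⟩ ⟨a, rfl⟩
    refine ⟨c, ?_⟩
    simp only [pow_succ', Module.End.mul_apply]
    rw [hc, hW.antipode_antimul]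

/-- A multiplicative map that commutes with the antipode and fixes both counital subalgebras can
be cancelled from `S ^ n ∘ P = S ^ n`: if `P` and `id` agree after `S ^ (n + 1)`, then they agree
after `S ^ n`, by `P(h) = ∑ h⁽¹⁾ S(h⁽²⁾) P(h⁽³⁾)` and `h = ∑ h⁽¹⁾ S(P(h⁽²⁾)) P(h⁽³⁾)`. -/
theorem pow_antipode_comp_of_succ (hW : IsWHA S) (P : W →ₗ[ℂ] W)
    (hmul : ∀ a b, P (a * b) = P a * P b) (hS : ∀ a, P (S a) = S (P a))
    (hL : ∀ x ∈ WL W, P x = x) (hR : ∀ y ∈ WR W, P y = y) (n : ℕ)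
    (h : ∀ a, ((S : Module.End ℂ W) ^ (n + 1)) (P a) = ((S : Module.End ℂ W) ^ (n + 1)) a) (a : W) :
    ((S : Module.End ℂ W) ^ n) (P a) = ((S : Module.End ℂ W) ^ n) a := by
  have e₁ : P a = ten (Δ a) fun x r => ten (Δ x) fun p q => p * S q * P r := by
    calc P a = ten (Δ a) fun x r => εL W x * P r := by
          conv_lhs => rw [← hW.εL_mul a, map_ten]
          simp only [hmul, hL _ (εL_mem _)]
      _ = _ := by
          refine ten_congr fun x r => ?_
          rw [← hW.sw_mul_antipode, Lin.map_ten (g := fun z => z * P r) (by fun_prop)]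
  have e₂ : a = ten (Δ a) fun x r => ten (Δ x) fun p q => p * S (P q) * P r := by
    rw [sw_coassoc a (fun p q r => p * S (P q) * P r)]
    calc a = ten (Δ a) fun x r => x * εR W r := (hW.mul_εR a).symm
      _ = _ := by
          refine ten_congr fun p x => ?_
          rw [← hR _ (εR_mem x), ← hW.sw_antipode_mul, map_ten,
            Lin.map_ten (g := fun z => p * z) (by fun_prop)]
          simp only [hmul, hS, mul_assoc]
  conv_lhs => rw [e₁]
  conv_rhs => rw [e₂]
  rw [map_ten, map_ten]
  refine ten_congr fun x r => ?_
  rw [map_ten, map_ten]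
  refine ten_congr fun p q => ?_
  rw [← sub_eq_zero, ← map_sub, ← sub_mul, ← mul_sub]
  apply hW.pow_antipode_mul_eq_zero
  rw [map_sub, sub_eq_zero]
  have := h q
  rw [pow_succ, Module.End.mul_apply, Module.End.mul_apply] at this
  exact this.symm

variable [FiniteDimensional ℂ W]

/-- The antipode of a finite-dimensional weak Hopf algebra is bijective. -/
theorem bijective (hW : IsWHA S) : Function.Bijective S := by
  -- the Fitting decomposition of `W`; the exponent is positive, so that `ker S ≤ ker A`
  obtain ⟨M, hM⟩ := Filter.eventually_atTop.mp
    (LinearMap.eventually_isCompl_ker_pow_range_pow (S : Module.End ℂ W))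
  obtain ⟨N, hNM⟩ : ∃ N, N = M + 1 := ⟨_, rfl⟩
  have hc := hM N (by omega)
  set A : Module.End ℂ W := (S : Module.End ℂ W) ^ N with hA
  obtain ⟨P, hP₁, hP₂, hP₃⟩ : ∃ P : W →ₗ[ℂ] W, (∀ a, P a ∈ LinearMap.range A) ∧
      (∀ a, A (P a) = A a) ∧ ∀ a ∈ LinearMap.range A, P a = a := by
    refine ⟨Submodule.projection _ _ hc.symm, fun a => Submodule.projection_apply_mem hc.symm a,
      fun a => ?_, fun a ha => Submodule.projection_apply_left hc.symm ⟨a, ha⟩⟩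
    have e := Submodule.projection_add_projection_eq_self hc.symm a
    conv_rhs => rw [← e]
    rw [map_add, LinearMap.mem_ker.mp (Submodule.projection_apply_mem hc a), add_zero]
  -- `P a` is the only element of the range with the same image under `A`
  have huniq : ∀ a b, b ∈ LinearMap.range A → A a = A b → P a = b := fun a b hb hab => by
    have h₁ : P a - b ∈ LinearMap.range A := sub_mem (hP₁ a) hb
    have h₂ : P a - b ∈ LinearMap.ker A := by
      rw [LinearMap.mem_ker, map_sub, hP₂, hab, sub_self]
    exact sub_eq_zero.mp (Submodule.disjoint_def.mp hc.disjoint _ h₂ h₁)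
  have hmul : ∀ a b, P (a * b) = P a * P b := fun a b => by
    refine huniq _ _ (hW.range_pow_mul N _ _ (hP₁ a) (hP₁ b)) ?_
    have h₁ := hW.pow_antipode_mul_eq_zero N 1 (a - P a) b (by rw [map_sub, hP₂, sub_self])
    have h₂ := hW.pow_antipode_mul_eq_zero N (P a) (b - P b) 1 (by rw [map_sub, hP₂, sub_self])
    rw [one_mul, sub_mul, map_sub, sub_eq_zero] at h₁
    rw [mul_one, mul_sub, map_sub, sub_eq_zero] at h₂
    rw [h₁, h₂]
  have hS : ∀ a, P (S a) = S (P a) := fun a => by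
    have hcomm : ∀ b, A (S b) = S (A b) := fun b => by
      change (A * S) b = (S * A) b
      rw [hA, ← pow_succ, ← pow_succ']
    obtain ⟨b, hb⟩ := hP₁ a
    refine huniq _ _ ⟨S b, by rw [hcomm, hb]⟩ ?_
    rw [hcomm, hcomm, hP₂]
  have hL : ∀ x ∈ WL W, P x = x := fun x hx => hP₃ x ((hW.le_range_pow N).1 hx)
  have hR : ∀ y ∈ WR W, P y = y := fun y hy => hP₃ y ((hW.le_range_pow N).2 hy)
  have key : ∀ k ≤ N, ∀ a, ((S : Module.End ℂ W) ^ (N - k)) (P a) =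
      ((S : Module.End ℂ W) ^ (N - k)) a := fun k => by
    induction k with
    | zero => exact fun _ => hP₂
    | succ k ih =>
      intro hk
      refine hW.pow_antipode_comp_of_succ P hmul hS hL hR _ ?_
      have e : N - (k + 1) + 1 = N - k := by omega
      rw [e]
      exact ih (by omega)
  have hid : ∀ a, P a = a := fun a => by simpa using key N le_rfl a
  have hinj : Function.Injective S := by
    rw [← LinearMap.ker_eq_bot, LinearMap.ker_eq_bot']
    intro a ha
    rw [← hid a]
    refine huniq a 0 (zero_mem _) ?_
    rw [hA, hNM, pow_succ, Module.End.mul_apply, ha, map_zero, map_zero]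
  exact ⟨hinj, (LinearMap.injective_iff_surjective).mp hinj⟩

end IsWHA

end

/-! ### The inverse of the antipode -/

section

variable {W : Type*} [Ring W] [Algebra ℂ W] [Coalgebra ℂ W]
  {X : Type*} [AddCommMonoid X] [Module ℂ X]

namespace IsWHA

variable {S : W →ₗ[ℂ] W} {x y : W}

/-- `∑ h⁽¹⁾ y ⊗ h⁽²⁾ = ∑ h⁽¹⁾ ⊗ h⁽²⁾ S(y)` for `y ∈ W_R`. -/
theorem sw_mul_antipode_right (hW : IsWHA S) (hy : y ∈ WR W) (h : W) (f : W → W → X)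
    (h₁ : ∀ b, Lin fun a => f a b := by fun_prop)
    (h₂ : ∀ a, Lin fun b => f a b := by fun_prop) :
    (ten (Δ h) fun a b => f a (b * S y)) = ten (Δ h) fun a b => f (a * y) b := by
  calc (ten (Δ h) fun a b => f a (b * S y))
      = ten (Δ h) fun a x => ten (Δ x) fun b c => ϵ (b * S y) • f a c := by
        refine ten_congr fun a x => ?_
        rw [← hW.sw_mul_memL (hW.antipode_memL hy) x (fun b c => ϵ b • f a c),
          sw_counit_left _ (fun c => f a c)]
    _ = ten (Δ h) fun x c => ten (Δ x) fun a b => ϵ (b * y) • f a c := by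
        rw [← sw_coassoc h (fun a b c => ϵ (b * S y) • f a c)]
        simp only [← hW.εL_of_memR hy, hW.counit_mul_εL]
    _ = ten (Δ h) fun a b => f (a * y) b := by
        refine ten_congr fun x c => ?_
        rw [← hW.sw_mul_memR hy x (fun a b => ϵ b • f a c), sw_counit_right _ (fun a => f a c)]

/-- `∑ S(x) h⁽¹⁾ ⊗ h⁽²⁾ = ∑ h⁽¹⁾ ⊗ x h⁽²⁾` for `x ∈ W_L`. -/
theorem sw_antipode_mul_left (hW : IsWHA S) (hx : x ∈ WL W) (h : W) (f : W → W → X)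
    (h₁ : ∀ b, Lin fun a => f a b := by fun_prop)
    (h₂ : ∀ a, Lin fun b => f a b := by fun_prop) :
    (ten (Δ h) fun a b => f (S x * a) b) = ten (Δ h) fun a b => f a (x * b) := by
  calc (ten (Δ h) fun a b => f (S x * a) b)
      = ten (Δ h) fun y c => ten (Δ y) fun a b => ϵ (S x * b) • f a c := by
        refine ten_congr fun y c => ?_
        rw [← hW.sw_memR_mul (hW.antipode_memR hx) y (fun a b => ϵ b • f a c),
          sw_counit_right _ (fun a => f a c)]
    _ = ten (Δ h) fun a y => ten (Δ y) fun b c => ϵ (x * b) • f a c := by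
        rw [sw_coassoc h (fun a b c => ϵ (S x * b) • f a c)]
        simp only [← hW.εR_of_memL hx, hW.counit_εR_mul]
    _ = ten (Δ h) fun a b => f a (x * b) := by
        refine ten_congr fun a y => ?_
        rw [← hW.sw_memL_mul hx y (fun b c => ϵ b • f a c), sw_counit_left _ (fun c => f a c)]

/-- `∑ ε_L(h⁽¹⁾) ⊗ h⁽²⁾ = ∑ S(1⁽¹⁾) ⊗ 1⁽²⁾ h`. -/
theorem sw_εL_left (hW : IsWHA S) (h : W) (f : W → W → X)
    (h₁ : ∀ b, Lin fun a => f a b := by fun_prop)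
    (h₂ : ∀ a, Lin fun b => f a b := by fun_prop) :
    (ten (Δ h) fun a b => f (εL W a) b) = ten (Δ 1) fun a b => f (S a) (b * h) := by
  calc (ten (Δ h) fun a b => f (εL W a) b)
      = ten (Δ 1) fun p q => ten (Δ h) fun a b => ϵ (p * a) • f q b := by
        rw [ten_comm]
        refine ten_congr fun a b => ?_
        rw [εL_eq, Lin.map_ten (g := fun z => f z b) (by fun_prop)]
        simp only [(h₁ b).map_smul]
    _ = ten (Δ 1) fun p q => ten (Δ h) fun a b => ϵ (S (εL W q) * a) • f (S p) b := by
        rw [← hW.sw_one_antipode (fun p q => ten (Δ h) fun a b => ϵ (p * a) • f q b)]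
        rw [hW.sw_εL_right 1 (fun p q => ten (Δ h) fun a b => ϵ (S q * a) • f (S p) b)]
        simp only [mul_one]
    _ = ten (Δ 1) fun p q => f (S p) (εL W q * h) := by
        refine ten_congr fun p q => ?_
        simp only [← hW.εR_of_memL (εL_mem q), hW.counit_εR_mul]
        rw [← hW.sw_memL_mul (εL_mem q) h (fun a b => ϵ a • f (S p) b),
          sw_counit_left _ (fun b => f (S p) b)]
    _ = ten (Δ 1) fun a b => f (S a) (b * h) := by
        rw [hW.sw_εL_right 1 (fun p q => f (S p) (q * h))]
        simp only [mul_one]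

theorem counit_mul_antipode (hW : IsWHA S) (hy : y ∈ WR W) (u : W) : ϵ (u * S y) = ϵ (u * y) := by
  rw [← hW.εL_of_memR hy, hW.counit_mul_εL]

variable [FiniteDimensional ℂ W]

theorem isUnit (hW : IsWHA S) : IsUnit (S : Module.End ℂ W) :=
  (Module.End.isUnit_iff _).mpr hW.bijective

@[simp]
theorem antipode_inv (hW : IsWHA S) (h : W) : S (inv S h) = h :=
  congrArg (fun A : Module.End ℂ W => A h) (Ring.mul_inverse_cancel _ hW.isUnit)

@[simp]
theorem inv_antipode (hW : IsWHA S) (h : W) : inv S (S h) = h :=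
  congrArg (fun A : Module.End ℂ W => A h) (Ring.inverse_mul_cancel _ hW.isUnit)

theorem inv_antimul (hW : IsWHA S) (h k : W) : inv S (h * k) = inv S k * inv S h := by
  rw [← hW.inv_antipode (inv S k * inv S h), hW.antipode_antimul, hW.antipode_inv, hW.antipode_inv]

theorem inv_one (hW : IsWHA S) : inv S (1 : W) = 1 := by
  simpa only [hW.antipode_one] using hW.inv_antipode 1

/-- The inverse of the antipode is anticomultiplicative. -/
theorem sw_inv (hW : IsWHA S) (h : W) (f : W → W → X)
    (h₁ : ∀ b, Lin fun a => f a b := by fun_prop)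
    (h₂ : ∀ a, Lin fun b => f a b := by fun_prop) :
    ten (Δ (inv S h)) f = ten (Δ h) fun a b => f (inv S b) (inv S a) := by
  conv_rhs => rw [← hW.antipode_inv h, hW.sw_antipode _ (fun a b => f (inv S b) (inv S a))]
  simp only [hW.inv_antipode]

theorem inv_memR (hW : IsWHA S) (hx : x ∈ WL W) : inv S x ∈ WR W := by
  obtain ⟨y, hy, rfl⟩ := hW.WL_le_map hx
  rwa [hW.inv_antipode]

theorem inv_memL (hW : IsWHA S) (hy : y ∈ WR W) : inv S y ∈ WL W := by
  obtain ⟨x, hx, rfl⟩ := hW.WR_le_map hy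
  rwa [hW.inv_antipode]

theorem εR_inv (hW : IsWHA S) (h : W) : εR W (inv S h) = inv S (εL W h) := by
  rw [← hW.inv_antipode (εR W _), ← hW.εL_antipode, hW.antipode_inv]

/-- `∑ S⁻¹(h⁽²⁾) h⁽¹⁾ = S⁻¹(ε_R(h))`. -/
theorem sw_inv_mul (hW : IsWHA S) (h : W) :
    (ten (Δ h) fun a b => inv S b * a) = inv S (εR W h) := by
  rw [← hW.sw_antipode_mul, map_ten]
  simp only [hW.inv_antimul, hW.inv_antipode]

/-- `∑ h⁽²⁾ S⁻¹(h⁽¹⁾) = S⁻¹(ε_L(h))`. -/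
theorem sw_mul_inv (hW : IsWHA S) (h : W) :
    (ten (Δ h) fun a b => b * inv S a) = inv S (εL W h) := by
  rw [← hW.sw_mul_antipode, map_ten]
  simp only [hW.inv_antimul, hW.inv_antipode]

theorem sw_one_inv_mul (hW : IsWHA S) : (ten (Δ (1 : W)) fun a b => inv S b * a) = 1 := by
  rw [hW.sw_inv_mul, εR_one, hW.inv_one]

theorem counit_mul_inv (hW : IsWHA S) (hx : x ∈ WL W) (u : W) :
    ϵ (u * inv S x) = ϵ (u * x) := by
  rw [← hW.counit_mul_antipode (hW.inv_memR hx), hW.antipode_inv]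

end IsWHA

end

/-! ### The dual algebra and coalgebra -/

section

variable {W : Type*} [Ring W] [Algebra ℂ W]
  {X : Type*} [AddCommMonoid X] [Module ℂ X] {V : Type*} [AddCommMonoid V] [Module ℂ V]

/-- The functional `y ↦ φ (a y b)`. -/
def translate (φ : Module.Dual ℂ W) (a b : W) : Module.Dual ℂ W :=
  φ ∘ₗ LinearMap.mulLeft ℂ a ∘ₗ LinearMap.mulRight ℂ b

@[simp]
theorem translate_apply (φ : Module.Dual ℂ W) (a b y : W) :
    translate φ a b y = φ (a * y * b) := by
  simp [translate, mul_assoc]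

@[fun_prop]
theorem Lin.translate₁ {g : V → Module.Dual ℂ W} (hg : Lin g) (a b : W) :
    Lin fun x => translate (g x) a b :=
  ⟨fun x y => by ext; simp [hg.map_add], fun c x => by ext; simp [hg.map_smul]⟩

@[fun_prop]
theorem Lin.translate₂ (φ : Module.Dual ℂ W) {g : V → W} (hg : Lin g) (b : W) :
    Lin fun x => translate φ (g x) b :=
  ⟨fun x y => by ext; simp [hg.map_add, add_mul], fun c x => by ext; simp [hg.map_smul]⟩

@[fun_prop]
theorem Lin.translate₃ (φ : Module.Dual ℂ W) (a : W) {g : V → W} (hg : Lin g) :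
    Lin fun x => translate φ a (g x) :=
  ⟨fun x y => by ext; simp [hg.map_add, mul_add], fun c x => by ext; simp [hg.map_smul]⟩

@[simp]
theorem translate_translate (φ : Module.Dual ℂ W) (a b c d : W) :
    translate (translate φ a b) c d = translate φ (a * c) (d * b) := by
  ext y; simp [mul_assoc]

@[simp]
theorem translate_one (φ : Module.Dual ℂ W) : translate φ 1 1 = φ := by
  ext y; simp

theorem dualDistrib_ten (t : Module.Dual ℂ W ⊗[ℂ] Module.Dual ℂ W)
    (f g : Module.Dual ℂ W → Module.Dual ℂ W) (a b : W) :
    TensorProduct.dualDistrib ℂ W W (ten t fun p q => f p ⊗ₜ g q) (a ⊗ₜ b) =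
      ten t fun p q => f p a * g q b := by
  rw [Lin.map_ten (g := fun z => TensorProduct.dualDistrib ℂ W W z (a ⊗ₜ b)) (by fun_prop)]
  simp

section DualCoproduct

variable [FiniteDimensional ℂ W]

theorem sum_coord_smul (a : W) (g : W → X) (hg : Lin g) :
    ∑ i, (Module.finBasis ℂ W).coord i a • g (Module.finBasis ℂ W i) = g a := by
  conv_rhs => rw [← (Module.finBasis ℂ W).sum_repr a]
  exact (((map_sum hg.toMap _ _).trans
    (Finset.sum_congr rfl fun i _ => hg.map_smul _ _))).symm

theorem dual_tmul_dual_ext {t s : Module.Dual ℂ W ⊗[ℂ] Module.Dual ℂ W}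
    (h : ∀ a b, TensorProduct.dualDistrib ℂ W W t (a ⊗ₜ b) =
      TensorProduct.dualDistrib ℂ W W s (a ⊗ₜ b)) : t = s :=
  (TensorProduct.dualDistribEquiv ℂ W W).injective (TensorProduct.ext' h)

theorem dualDistrib_dualComul (φ : Module.Dual ℂ W) (a b : W) :
    TensorProduct.dualDistrib ℂ W W (dualComul W φ) (a ⊗ₜ b) = φ (a * b) := by
  have : TensorProduct.dualDistrib ℂ W W (dualComul W φ) = (LinearMap.mul' ℂ W).dualMap φ :=
    (TensorProduct.dualDistribEquiv ℂ W W).apply_symm_apply _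
  simp [this]

/-- The coproduct of `Ŵ` in terms of a basis `(vᵢ)` of `W` and the dual basis `(vⁱ)`:
`Δ̂(φ) = ∑ᵢ vⁱ ⊗ φ(vᵢ ·)`. -/
theorem dualComul_eq (φ : Module.Dual ℂ W) : dualComul W φ =
    ∑ i, (Module.finBasis ℂ W).coord i ⊗ₜ[ℂ] translate φ (Module.finBasis ℂ W i) 1 := by
  refine dual_tmul_dual_ext fun a b => ?_
  rw [dualDistrib_dualComul]
  simpa using (sum_coord_smul a (fun z => φ (z * b)) (by fun_prop)).symm

/-- `Δ̂(φ) = ∑ᵢ φ(· vᵢ) ⊗ vⁱ`. -/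
theorem dualComul_eq' (φ : Module.Dual ℂ W) : dualComul W φ =
    ∑ i, translate φ 1 (Module.finBasis ℂ W i) ⊗ₜ[ℂ] (Module.finBasis ℂ W).coord i := by
  refine dual_tmul_dual_ext fun a b => ?_
  rw [dualDistrib_dualComul]
  simpa [mul_comm] using (sum_coord_smul b (fun z => φ (a * z)) (by fun_prop)).symm

theorem ten_sum {ι : Type*} (s : Finset ι) {U : Type*} [AddCommMonoid U] [Module ℂ U]
    (a : ι → V) (b : ι → U) (f : V → U → X) (h₁ : ∀ b, Lin fun a => f a b := by fun_prop)
    (h₂ : ∀ a, Lin fun b => f a b := by fun_prop) :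
    ten (∑ i ∈ s, a i ⊗ₜ[ℂ] b i) f = ∑ i ∈ s, f (a i) (b i) := by
  have h : Lin fun t => ten t f := by fun_prop
  refine (map_sum h.toMap _ s).trans (Finset.sum_congr rfl fun i _ => ?_)
  exact ten_tmul _ _ h₁ h₂

theorem ten_dualComul (φ : Module.Dual ℂ W) (f : Module.Dual ℂ W → Module.Dual ℂ W → X)
    (h₁ : ∀ b, Lin fun a => f a b := by fun_prop) (h₂ : ∀ a, Lin fun b => f a b := by fun_prop) :
    ten (dualComul W φ) f =
      ∑ i, f ((Module.finBasis ℂ W).coord i) (translate φ (Module.finBasis ℂ W i) 1) := by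
  rw [dualComul_eq, ten_sum _ _ _ _ h₁ h₂]

theorem ten_dualComul' (φ : Module.Dual ℂ W) (f : Module.Dual ℂ W → Module.Dual ℂ W → X)
    (h₁ : ∀ b, Lin fun a => f a b := by fun_prop) (h₂ : ∀ a, Lin fun b => f a b := by fun_prop) :
    ten (dualComul W φ) f =
      ∑ i, f (translate φ 1 (Module.finBasis ℂ W i)) ((Module.finBasis ℂ W).coord i) := by
  rw [dualComul_eq', ten_sum _ _ _ _ h₁ h₂]

/-- `∑ ⟨φ⁽¹⁾, a⟩ g(φ⁽²⁾) = g(φ(a ·))`. -/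
theorem ten_dualComul_smul_left (φ : Module.Dual ℂ W) (a : W) (g : Module.Dual ℂ W → X)
    (hg : Lin g := by fun_prop) :
    (ten (dualComul W φ) fun p q => p a • g q) = g (translate φ a 1) := by
  rw [ten_dualComul φ (fun p q => p a • g q)]
  exact sum_coord_smul a (fun z => g (translate φ z 1)) (by fun_prop)

/-- `∑ ⟨φ⁽²⁾, b⟩ g(φ⁽¹⁾) = g(φ(· b))`. -/
theorem ten_dualComul_smul_right (φ : Module.Dual ℂ W) (b : W) (g : Module.Dual ℂ W → X)
    (hg : Lin g := by fun_prop) :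
    (ten (dualComul W φ) fun p q => q b • g p) = g (translate φ 1 b) := by
  rw [ten_dualComul' φ (fun p q => q b • g p)]
  exact sum_coord_smul b (fun z => g (translate φ 1 z)) (by fun_prop)

theorem ten_dualComul_coassoc (φ : Module.Dual ℂ W)
    (f : Module.Dual ℂ W → Module.Dual ℂ W → Module.Dual ℂ W → X)
    (h₁ : ∀ b c, Lin fun a => f a b c := by fun_prop)
    (h₂ : ∀ a c, Lin fun b => f a b c := by fun_prop)
    (h₃ : ∀ a b, Lin fun c => f a b c := by fun_prop) :
    (ten (dualComul W φ) fun x r => ten (dualComul W x) fun p q => f p q r) =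
      ten (dualComul W φ) fun p x => ten (dualComul W x) fun q r => f p q r := by
  calc _ = ∑ i, ∑ j, f ((Module.finBasis ℂ W).coord j)
          (translate (translate φ 1 (Module.finBasis ℂ W i)) (Module.finBasis ℂ W j) 1)
          ((Module.finBasis ℂ W).coord i) := by
        rw [ten_dualComul' φ (fun x r => ten (dualComul W x) fun p q => f p q r)]
        refine Finset.sum_congr rfl fun i _ => ?_
        rw [ten_dualComul _ (fun p q => f p q ((Module.finBasis ℂ W).coord i))]
    _ = ∑ j, ∑ i, f ((Module.finBasis ℂ W).coord j)
          (translate (translate φ (Module.finBasis ℂ W j) 1) 1 (Module.finBasis ℂ W i))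
          ((Module.finBasis ℂ W).coord i) := by
        rw [Finset.sum_comm]; simp
    _ = _ := by
        rw [ten_dualComul φ (fun p x => ten (dualComul W x) fun q r => f p q r)]
        refine Finset.sum_congr rfl fun j _ => ?_
        rw [ten_dualComul' _ (fun q r => f ((Module.finBasis ℂ W).coord j) q r)]

theorem ten_dualComul_mul (φ : Module.Dual ℂ W) (a b : W) :
    (ten (dualComul W φ) fun p q => p a * q b) = φ (a * b) := by
  rw [← dualDistrib_dualComul]
  exact ten_eq ((TensorProduct.dualDistrib ℂ W W).flip (a ⊗ₜ b)) (by simp) _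

/-- The coproduct of `φ(c · a)`. -/
theorem ten_dualComul_translate (φ : Module.Dual ℂ W) (c a : W)
    (f : Module.Dual ℂ W → Module.Dual ℂ W → X)
    (h₁ : ∀ b, Lin fun a => f a b := by fun_prop) (h₂ : ∀ a, Lin fun b => f a b := by fun_prop) :
    ten (dualComul W (translate φ c a)) f =
      ten (dualComul W φ) fun p q => f (translate p c 1) (translate q 1 a) := by
  have : dualComul W (translate φ c a) =
      ten (dualComul W φ) fun p q => translate p c 1 ⊗ₜ translate q 1 a := by
    refine dual_tmul_dual_ext fun u v => ?_
    rw [dualDistrib_dualComul, dualDistrib_ten]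
    simp only [translate_apply, mul_one, one_mul, ten_dualComul_mul]
    simp only [mul_assoc]
  rw [this, ten_ten _ _ _ h₁ h₂]
  exact ten_congr fun p q => ten_tmul _ _ h₁ h₂

/-- `∑ φ⁽¹⁾(· a) ⊗ φ⁽²⁾(c ·)` depends only on `a c`. -/
theorem ten_dualComul_balance (φ : Module.Dual ℂ W) (a c : W)
    (f : Module.Dual ℂ W → Module.Dual ℂ W → X)
    (h₁ : ∀ b, Lin fun a => f a b := by fun_prop) (h₂ : ∀ a, Lin fun b => f a b := by fun_prop) :
    (ten (dualComul W φ) fun p q => f (translate p 1 a) (translate q c 1)) =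
      ten (dualComul W φ) fun p q => f (translate p 1 (a * c)) q := by
  have : (ten (dualComul W φ) fun p q => translate p 1 a ⊗ₜ[ℂ] translate q c 1) =
      ten (dualComul W φ) fun p q => translate p 1 (a * c) ⊗ₜ[ℂ] q := by
    refine dual_tmul_dual_ext fun u v => ?_
    rw [dualDistrib_ten, dualDistrib_ten _ (fun p => translate p 1 (a * c)) (fun q => q)]
    simp only [translate_apply, mul_one, one_mul, ten_dualComul_mul]
    simp only [mul_assoc]
  have e := congrArg (fun t => ten t f) this
  simp only [ten_ten _ _ f h₁ h₂, ten_tmul _ _ h₁ h₂] at e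
  exact e

theorem harpoonL_apply (x : W) (φ : Module.Dual ℂ W) (y : W) : harpoonL x φ y = φ (y * x) := by
  have := ten_dualComul_smul_right φ x (fun p => p)
  rw [ten_eq ((TensorProduct.rid ℂ _).toLinearMap ∘ₗ
    LinearMap.lTensor (Module.Dual ℂ W) (Module.Dual.eval ℂ W x)) (by simp)] at this
  have e : harpoonL x φ = translate φ 1 x := this
  simp [e]

theorem harpoonR_apply (x : W) (φ : Module.Dual ℂ W) (y : W) : harpoonR φ x y = φ (x * y) := by
  have := ten_dualComul_smul_left φ x (fun p => p)
  rw [ten_eq ((TensorProduct.lid ℂ _).toLinearMap ∘ₗ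
    LinearMap.rTensor (Module.Dual ℂ W) (Module.Dual.eval ℂ W x)) (by simp)] at this
  have e : harpoonR φ x = translate φ x 1 := this
  simp [e]

end DualCoproduct

section DualProduct

variable [Coalgebra ℂ W]

theorem dualMul_apply (φ ψ : Module.Dual ℂ W) (y : W) :
    dualMul W φ ψ y = ten (Δ y) fun a b => φ a * ψ b := by
  rw [ten_eq (TensorProduct.dualDistrib ℂ W W (φ ⊗ₜ ψ)) (by simp)]
  simp [dualMul]

theorem dualMul_assoc (φ ψ χ : Module.Dual ℂ W) :
    dualMul W (dualMul W φ ψ) χ = dualMul W φ (dualMul W ψ χ) := by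
  ext y
  simp only [dualMul_apply]
  calc _ = ten (Δ y) fun x c => ten (Δ x) fun a b => φ a * (ψ b * χ c) := by
        refine ten_congr fun x c => ?_
        rw [Lin.map_ten (g := fun z => z * χ c) (by fun_prop)]
        simp only [mul_assoc]
    _ = ten (Δ y) fun a x => ten (Δ x) fun b c => φ a * (ψ b * χ c) :=
        sw_coassoc y (fun a b c => φ a * (ψ b * χ c))
    _ = _ := by
        refine ten_congr fun a x => ?_
        rw [Lin.map_ten (g := fun z => φ a * z) (by fun_prop)]

theorem counit_dualMul (φ : Module.Dual ℂ W) : dualMul W ϵ φ = φ := by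
  ext y
  rw [dualMul_apply]
  exact sw_counit_left y (fun b => φ b)

theorem dualMul_counit (φ : Module.Dual ℂ W) : dualMul W φ ϵ = φ := by
  ext y
  rw [dualMul_apply]
  simp only [mul_comm (φ _)]
  exact sw_counit_right y (fun b => φ b)

variable {S : W →ₗ[ℂ] W} {x y : W}

/-- Translation is multiplicative: `(φψ)(c · a) = ∑ φ(c⁽¹⁾ · a⁽¹⁾) ψ(c⁽²⁾ · a⁽²⁾)`. -/
theorem IsWHA.translate_dualMul (hW : IsWHA S) (φ ψ : Module.Dual ℂ W) (c a : W) :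
    translate (dualMul W φ ψ) c a = ten (Δ c) fun c₁ c₂ => ten (Δ a) fun a₁ a₂ =>
      dualMul W (translate φ c₁ a₁) (translate ψ c₂ a₂) := by
  ext y
  rw [translate_apply, dualMul_apply, hW.sw_mul _ a (fun a b => φ a * ψ b),
    hW.sw_mul c y (fun p q => ten (Δ a) fun a b => φ (p * a) * ψ (q * b)),
    Lin.map_ten (g := fun θ : Module.Dual ℂ W => θ y) (by fun_prop)]
  refine ten_congr fun c₁ c₂ => ?_
  rw [Lin.map_ten (g := fun θ : Module.Dual ℂ W => θ y) (by fun_prop), ten_comm]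
  simp only [dualMul_apply, translate_apply]

/-- `(φψ)(y ·) = φ · ψ(y ·)` for `y ∈ W_R`. -/
theorem IsWHA.translate_dualMul_memR (hW : IsWHA S) (hy : y ∈ WR W) (φ ψ : Module.Dual ℂ W) :
    translate (dualMul W φ ψ) y 1 = dualMul W φ (translate ψ y 1) := by
  ext z
  simp only [translate_apply, dualMul_apply, mul_one]
  exact hW.sw_memR_mul hy z (fun a b => φ a * ψ b)

/-- `(φψ)(· y) = φ · ψ(· y)` for `y ∈ W_R`. -/
theorem IsWHA.translate_dualMul_memR' (hW : IsWHA S) (hy : y ∈ WR W) (φ ψ : Module.Dual ℂ W) :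
    translate (dualMul W φ ψ) 1 y = dualMul W φ (translate ψ 1 y) := by
  ext z
  simp only [translate_apply, dualMul_apply, one_mul]
  exact hW.sw_mul_memR hy z (fun a b => φ a * ψ b)

variable [FiniteDimensional ℂ W]

/-- `φ(· S⁻¹(x)) ψ = φ ψ(· x)` for `x ∈ W_L`. -/
theorem IsWHA.dualMul_translate_inv (hW : IsWHA S) (hx : x ∈ WL W) (φ ψ : Module.Dual ℂ W) :
    dualMul W (translate φ 1 (inv S x)) ψ = dualMul W φ (translate ψ 1 x) := by
  ext z
  simp only [translate_apply, dualMul_apply, one_mul]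
  have := hW.sw_mul_antipode_right (hW.inv_memR hx) z (fun a b => φ a * ψ b)
  rw [hW.antipode_inv] at this
  exact this.symm

/-- `φ(y ·) ψ = φ ψ(S⁻¹(y) ·)` for `y ∈ W_R`. -/
theorem IsWHA.dualMul_translate_left (hW : IsWHA S) (hy : y ∈ WR W) (φ ψ : Module.Dual ℂ W) :
    dualMul W (translate φ y 1) ψ = dualMul W φ (translate ψ (inv S y) 1) := by
  ext z
  simp only [translate_apply, dualMul_apply, mul_one]
  have := hW.sw_antipode_mul_left (hW.inv_memL hy) z (fun a b => φ a * ψ b)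
  rw [hW.antipode_inv] at this
  exact this

/-- `φ (x ⇀ ε) = φ(· S⁻¹(x))` for `x ∈ W_L`. -/
theorem IsWHA.dualMul_harpoonL (hW : IsWHA S) (hx : x ∈ WL W) (φ : Module.Dual ℂ W) :
    dualMul W φ (harpoonL x ϵ) = translate φ 1 (inv S x) := by
  have : harpoonL x ϵ = translate (ϵ : Module.Dual ℂ W) 1 x := by
    ext z; simp [harpoonL_apply]
  rw [this, ← hW.dualMul_translate_inv hx, dualMul_counit]

/-- `φ (ε ↼ y) = φ(y ·)` for `y ∈ W_R`. -/
theorem IsWHA.dualMul_harpoonR (hW : IsWHA S) (hy : y ∈ WR W) (φ : Module.Dual ℂ W) :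
    dualMul W φ (harpoonR ϵ y) = translate φ y 1 := by
  have : harpoonR ϵ y = translate (ϵ : Module.Dual ℂ W) y 1 := by
    ext z; simp [harpoonR_apply]
  rw [this, ← hW.translate_dualMul_memR hy, dualMul_counit]

end DualProduct

end

/-! ### The product on `Ŵᶜᵒᵖ ⊗ W` -/

section

variable {W : Type*} [Ring W] [Algebra ℂ W] [Coalgebra ℂ W]
  {X : Type*} [AddCommMonoid X] [Module ℂ X]

theorem preCounit_tmul (S : W →ₗ[ℂ] W) (φ : Module.Dual ℂ W) (h : W) :
    preCounit S (φ ⊗ₜ h) = φ (εR W (inv S h)) := by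
  simp [preCounit]

variable [FiniteDimensional ℂ W]

/-- `∑ ⟨ψ⁽¹⁾, C h⁽³⁾⟩ ⟨ψ⁽³⁾, A h⁽¹⁾⟩ ψ⁽²⁾ ⊗ B h⁽²⁾ = ∑ ψ(C h⁽³⁾ · A h⁽¹⁾) ⊗ B h⁽²⁾`. -/
theorem contractOuter_comul₃ (ψ : Module.Dual ℂ W) (A B C : W →ₗ[ℂ] W) (h : W) :
    contractOuter W (dualComul₃ W ψ ⊗ₜ TensorProduct.map A (TensorProduct.map B C) (comul₃ W h)) =
      ten (Δ h) fun a x => ten (Δ x) fun b c => translate ψ (C c) (A a) ⊗ₜ[ℂ] B b := by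
  have e₁ : comul₃ W h = ten (Δ h) fun a x => ten (Δ x) fun b c => a ⊗ₜ[ℂ] (b ⊗ₜ[ℂ] c) := by
    conv_lhs => rw [comul₃, LinearMap.comp_apply, ← ten_tmul_self (Δ h), map_ten]
    refine ten_congr fun a x => ?_
    conv_lhs => rw [LinearMap.lTensor_tmul, ← ten_tmul_self (Δ x),
      Lin.map_ten (g := fun z => a ⊗ₜ[ℂ] z) (by fun_prop)]
  have e₂ : dualComul₃ W ψ = ten (dualComul W ψ) fun p x => ten (dualComul W x) fun q r =>
      p ⊗ₜ[ℂ] (q ⊗ₜ[ℂ] r) := by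
    conv_lhs => rw [dualComul₃, LinearMap.comp_apply, ← ten_tmul_self (dualComul W ψ), map_ten]
    refine ten_congr fun a x => ?_
    conv_lhs => rw [LinearMap.lTensor_tmul, ← ten_tmul_self (dualComul W x),
      Lin.map_ten (g := fun z => a ⊗ₜ[ℂ] z) (by fun_prop)]
  rw [e₁, Lin.map_ten (g := fun z => contractOuter W (dualComul₃ W ψ ⊗ₜ
    TensorProduct.map A (TensorProduct.map B C) z)) (by fun_prop)]
  refine ten_congr fun a x => ?_
  rw [Lin.map_ten (g := fun z => contractOuter W (dualComul₃ W ψ ⊗ₜ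
    TensorProduct.map A (TensorProduct.map B C) z)) (by fun_prop)]
  refine ten_congr fun b c => ?_
  rw [e₂]
  simp only [TensorProduct.map_tmul]
  calc _ = ten (dualComul W ψ) fun p x => ten (dualComul W x) fun q r =>
        p (C c) • r (A a) • q ⊗ₜ[ℂ] B b := by
        rw [Lin.map_ten (g := fun z => contractOuter W (z ⊗ₜ (A a ⊗ₜ (B b ⊗ₜ C c))))
          (by fun_prop)]
        refine ten_congr fun p x => ?_
        rw [Lin.map_ten (g := fun z => contractOuter W (z ⊗ₜ (A a ⊗ₜ (B b ⊗ₜ C c))))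
          (by fun_prop)]
        simp only [contractOuter_tmul, mul_smul]
    _ = ten (dualComul W ψ) fun p x => p (C c) • (translate x 1 (A a) ⊗ₜ[ℂ] B b) := by
        refine ten_congr fun p x => ?_
        rw [← ten_dualComul_smul_right x (A a) (fun q => q ⊗ₜ[ℂ] B b),
          Lin.map_ten (g := fun z => p (C c) • z) (by fun_prop)]
    _ = _ := by
        rw [ten_dualComul_smul_left ψ (C c) (fun x => translate x 1 (A a) ⊗ₜ[ℂ] B b)]
        simp

/-- The straightening map is `ψ ⊗ h ↦ ∑ ψ(S⁻¹(h⁽³⁾) · h⁽¹⁾) ⊗ h⁽²⁾`. -/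
theorem straighten_tmul (S : W →ₗ[ℂ] W) (ψ : Module.Dual ℂ W) (h : W) :
    straighten S (ψ ⊗ₜ h) = ten (Δ h) fun a x => ten (Δ x) fun b c =>
      translate ψ (inv S c) a ⊗ₜ[ℂ] b := by
  have := contractOuter_comul₃ ψ LinearMap.id LinearMap.id (inv S) h
  simp only [LinearMap.id_apply] at this
  exact this

/-- `(φ ⊗ h)(ψ ⊗ g) = ∑ φ ψ(S⁻¹(h⁽³⁾) · h⁽¹⁾) ⊗ h⁽²⁾ g`. -/
theorem preMul_tmul (S : W →ₗ[ℂ] W) (φ ψ : Module.Dual ℂ W) (h g : W) :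
    preMul S (φ ⊗ₜ h) (ψ ⊗ₜ g) = ten (Δ h) fun a x => ten (Δ x) fun b c =>
      dualMul W φ (translate ψ (inv S c) a) ⊗ₜ[ℂ] (b * g) := by
  calc _ = TensorProduct.map (TensorProduct.lift (dualMul W)) (LinearMap.mul' ℂ W)
        ((TensorProduct.assoc ℂ _ _ _).symm (φ ⊗ₜ (TensorProduct.assoc ℂ _ _ _
          (straighten S (ψ ⊗ₜ h) ⊗ₜ g)))) := by simp [preMul]
    _ = _ := by
        rw [straighten_tmul, Lin.map_ten (g := fun z =>
          TensorProduct.map (TensorProduct.lift (dualMul W)) (LinearMap.mul' ℂ W)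
          ((TensorProduct.assoc ℂ _ _ _).symm (φ ⊗ₜ (TensorProduct.assoc ℂ _ _ _
          (z ⊗ₜ g))))) (by fun_prop)]
        refine ten_congr fun a x => ?_
        rw [Lin.map_ten (g := fun z =>
          TensorProduct.map (TensorProduct.lift (dualMul W)) (LinearMap.mul' ℂ W)
          ((TensorProduct.assoc ℂ _ _ _).symm (φ ⊗ₜ (TensorProduct.assoc ℂ _ _ _
          (z ⊗ₜ g))))) (by fun_prop)]
        simp

theorem preComul_tmul (φ : Module.Dual ℂ W) (h : W) :
    preComul (φ ⊗ₜ h) = ten (dualComul W φ) fun p q => ten (Δ h) fun a b =>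
      (q ⊗ₜ[ℂ] a) ⊗ₜ[ℂ] (p ⊗ₜ[ℂ] b) := by
  calc _ = TensorProduct.tensorTensorTensorComm ℂ _ _ _ _
        (TensorProduct.comm ℂ _ _ (dualComul W φ) ⊗ₜ Δ h) := by simp [preComul]
    _ = _ := by
        conv_lhs => rw [← ten_tmul_self (dualComul W φ), ← ten_tmul_self (Δ h)]
        rw [Lin.map_ten (g := fun z => TensorProduct.tensorTensorTensorComm ℂ _ _ _ _
          (TensorProduct.comm ℂ _ _ z ⊗ₜ _)) (by fun_prop)]
        refine ten_congr fun p q => ?_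
        rw [Lin.map_ten (g := fun z => TensorProduct.tensorTensorTensorComm ℂ _ _ _ _
          (TensorProduct.comm ℂ _ _ _ ⊗ₜ z)) (by fun_prop)]
        simp

theorem inv_dualMap {S : W →ₗ[ℂ] W} (hW : IsWHA S) : inv S.dualMap = (inv S).dualMap := by
  have h₁ : (S.dualMap : Module.End ℂ (Module.Dual ℂ W)) * (inv S).dualMap = 1 := by
    ext φ x; simp [hW.inv_antipode]
  have h₂ : ((inv S).dualMap : Module.End ℂ (Module.Dual ℂ W)) * S.dualMap = 1 := by
    ext φ x; simp [hW.antipode_inv]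
  exact Ring.inverse_unit ⟨_, _, h₁, h₂⟩

/-- The antipode of the double is induced by straightening `φ ∘ S⁻¹ ⊗ S(h)`. -/
theorem preAntipode_tmul {S : W →ₗ[ℂ] W} (hW : IsWHA S) (φ : Module.Dual ℂ W) (h : W) :
    preAntipode S (φ ⊗ₜ h) = straighten S ((φ ∘ₗ inv S) ⊗ₜ S h) := by
  have := contractOuter_comul₃ φ (inv S) LinearMap.id LinearMap.id h
  calc _ = TensorProduct.map (inv S.dualMap) S (contractOuter W (dualComul₃ W φ ⊗ₜ
        TensorProduct.map (inv S) (TensorProduct.map LinearMap.id LinearMap.id) (comul₃ W h))) := by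
        simp [preAntipode, LinearMap.rTensor]
    _ = ten (Δ h) fun a x => ten (Δ x) fun b c =>
        (translate φ c (inv S a) ∘ₗ inv S) ⊗ₜ[ℂ] S b := by
        rw [this, map_ten]
        simp only [map_ten, TensorProduct.map_tmul, inv_dualMap hW]
        rfl
    _ = _ := by
        rw [straighten_tmul]
        rw [hW.sw_antipode h (fun a x => ten (Δ x) fun b c =>
          translate (φ ∘ₗ inv S) (inv S c) a ⊗ₜ[ℂ] b)]
        rw [← sw_coassoc h (fun a b c => (translate φ c (inv S a) ∘ₗ inv S) ⊗ₜ[ℂ] S b)]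
        refine ten_congr fun x c => ?_
        rw [hW.sw_antipode x (fun b c' => translate (φ ∘ₗ inv S) (inv S c') (S c) ⊗ₜ[ℂ] b)]
        refine ten_congr fun a b => ?_
        congr 1
        ext y
        simp [hW.inv_antipode, hW.inv_antimul, mul_assoc]

variable {S : W →ₗ[ℂ] W}

theorem preMul_assoc_tmul (hW : IsWHA S) (φ ψ χ : Module.Dual ℂ W) (h g k : W) :
    preMul S (preMul S (φ ⊗ₜ h) (ψ ⊗ₜ g)) (χ ⊗ₜ k) =
      preMul S (φ ⊗ₜ h) (preMul S (ψ ⊗ₜ g) (χ ⊗ₜ k)) := by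
  -- both sides are the sum of these terms over the components of `h` and `g`
  let G : W → W → W → W → W → W → W → W → Module.Dual ℂ W ⊗[ℂ] W :=
    fun a₁ a₂ b c₁ c₂ p q r =>
      dualMul W φ (dualMul W (translate ψ (inv S c₂) a₁)
        (translate χ (inv S r * inv S c₁) (a₂ * p))) ⊗ₜ[ℂ] (b * (q * k))
  calc _ = ten (Δ h) fun a x => ten (Δ x) fun b c => ten (Δ b) fun b₁ b' => ten (Δ b') fun b₂ b₃ =>
        ten (Δ g) fun p y => ten (Δ y) fun q r => G a b₁ b₂ b₃ c p q r := by
        rw [preMul_tmul, Lin.map_ten (g := fun z => preMul S z (χ ⊗ₜ k)) (by fun_prop)]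
        refine ten_congr fun a x => ?_
        rw [Lin.map_ten (g := fun z => preMul S z (χ ⊗ₜ k)) (by fun_prop)]
        refine ten_congr fun b c => ?_
        rw [preMul_tmul, hW.sw_mul b g (fun p y => ten (Δ y) fun q r =>
          dualMul W (dualMul W φ (translate ψ (inv S c) a)) (translate χ (inv S r) p) ⊗ₜ[ℂ]
            (q * k))]
        refine ten_congr fun b₁ b' => ?_
        rw [ten_comm]
        refine ten_congr fun p y => ?_
        rw [hW.sw_mul b' y (fun q r =>
          dualMul W (dualMul W φ (translate ψ (inv S c) a)) (translate χ (inv S r) (b₁ * p)) ⊗ₜ[ℂ]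
            (q * k))]
        simp only [dualMul_assoc, hW.inv_antimul, mul_assoc, G]
    _ = ten (Δ h) fun a₁ x => ten (Δ x) fun a₂ y => ten (Δ y) fun b z => ten (Δ z) fun c₁ c₂ =>
        ten (Δ g) fun p y => ten (Δ y) fun q r => G a₁ a₂ b c₁ c₂ p q r := by
        refine ten_congr fun a x => ?_
        rw [sw_coassoc x (fun b₁ b' c => ten (Δ b') fun b₂ b₃ =>
          ten (Δ g) fun p y => ten (Δ y) fun q r => G a b₁ b₂ b₃ c p q r)]
        refine ten_congr fun a₂ y => ?_
        rw [sw_coassoc y (fun b₂ b₃ c =>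
          ten (Δ g) fun p y => ten (Δ y) fun q r => G a a₂ b₂ b₃ c p q r)]
    _ = ten (Δ g) fun p y => ten (Δ y) fun q r => ten (Δ h) fun a x => ten (Δ a) fun a₁ a₂ =>
          ten (Δ x) fun b c => ten (Δ c) fun c₁ c₂ => G a₁ a₂ b c₁ c₂ p q r := by
        calc _ = ten (Δ g) fun p y => ten (Δ y) fun q r => ten (Δ h) fun a₁ x =>
              ten (Δ x) fun a₂ y => ten (Δ y) fun b z => ten (Δ z) fun c₁ c₂ =>
              G a₁ a₂ b c₁ c₂ p q r :=
              (ten_congr fun a x => (ten_congr fun _ _ => (ten_congr fun _ _ =>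
                ten_comm₂ _ _ _ _).trans (ten_comm₂ _ _ _ _)).trans (ten_comm₂ _ _ _ _)).trans
                (ten_comm₂ _ _ _ _)
          _ = _ := by
              refine ten_congr fun p y => ten_congr fun q r => ?_
              rw [← sw_coassoc h (fun a₁ a₂ x => ten (Δ x) fun b c => ten (Δ c) fun c₁ c₂ =>
                G a₁ a₂ b c₁ c₂ p q r)]
    _ = _ := by
        rw [preMul_tmul, Lin.map_ten (g := fun z => preMul S (φ ⊗ₜ h) z) (by fun_prop)]
        refine ten_congr fun p y => ?_
        rw [Lin.map_ten (g := fun z => preMul S (φ ⊗ₜ h) z) (by fun_prop)]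
        refine ten_congr fun q r => ?_
        rw [preMul_tmul]
        refine ten_congr fun a x => ?_
        rw [ten_comm]
        refine ten_congr fun b c => ?_
        rw [hW.translate_dualMul, hW.sw_inv c (fun u v => ten (Δ a) fun a₁ a₂ =>
          dualMul W (translate ψ u a₁) (translate (translate χ (inv S r) p) v a₂)), ten_comm,
          Lin.map_ten (g := fun z => dualMul W φ z ⊗ₜ[ℂ] (b * (q * k))) (by fun_prop)]
        refine ten_congr fun c₁ c₂ => ?_
        rw [Lin.map_ten (g := fun z => dualMul W φ z ⊗ₜ[ℂ] (b * (q * k))) (by fun_prop)]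
        simp only [translate_translate, G]

/-- The product of `Ŵᶜᵒᵖ ⊗ W` is associative. -/
theorem preMul_assoc (hW : IsWHA S) (s t u : Module.Dual ℂ W ⊗[ℂ] W) :
    preMul S (preMul S s t) u = preMul S s (preMul S t u) := by
  induction s with
  | zero => simp
  | add s s' hs hs' => simp [hs, hs']
  | tmul φ h =>
    induction t with
    | zero => simp
    | add t t' ht ht' => simp [ht, ht']
    | tmul ψ g =>
      induction u with
      | zero => simp
      | add u u' hu hu' => simp [hu, hu']
      | tmul χ k => exact preMul_assoc_tmul hW φ ψ χ h g k

end

/-! ### The algebra `D(W)` -/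

section

variable {W : Type*} [Ring W] [Algebra ℂ W] [Coalgebra ℂ W] [FiniteDimensional ℂ W]
  {X : Type*} [AddCommGroup X] [Module ℂ X] {S : W →ₗ[ℂ] W} {x y : W}

/-- The class `[φ ⊗ h]` in the quantum double. -/
abbrev cls (φ : Module.Dual ℂ W) (h : W) : QuantumDouble W := toDouble (φ ⊗ₜ h)

/-- `[φ ⊗ xh] = [φ(· S⁻¹(x)) ⊗ h]` for `x ∈ W_L`. -/
theorem IsWHA.cls_memL (hW : IsWHA S) (hx : x ∈ WL W) (φ : Module.Dual ℂ W) (h : W) :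
    cls φ (x * h) = cls (translate φ 1 (inv S x)) h := by
  rw [← hW.dualMul_harpoonL hx]
  exact (Submodule.Quotient.eq _).mpr (Submodule.subset_span (Or.inl ⟨φ, h, x, hx, rfl⟩))

/-- `[φ ⊗ yh] = [φ(y ·) ⊗ h]` for `y ∈ W_R`. -/
theorem IsWHA.cls_memR (hW : IsWHA S) (hy : y ∈ WR W) (φ : Module.Dual ℂ W) (h : W) :
    cls φ (y * h) = cls (translate φ y 1) h := by
  rw [← hW.dualMul_harpoonR hy]
  exact (Submodule.Quotient.eq _).mpr (Submodule.subset_span (Or.inr ⟨φ, h, y, hy, rfl⟩))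

/-- The span `J`, in terms of translates of functionals. -/
theorem IsWHA.doubleIdeal_le (hW : IsWHA S) {A : Submodule ℂ (Module.Dual ℂ W ⊗[ℂ] W)}
    (hL : ∀ x ∈ WL W, ∀ (φ : Module.Dual ℂ W) (h : W),
      φ ⊗ₜ (x * h) - translate φ 1 (inv S x) ⊗ₜ h ∈ A)
    (hR : ∀ y ∈ WR W, ∀ (φ : Module.Dual ℂ W) (h : W),
      φ ⊗ₜ (y * h) - translate φ y 1 ⊗ₜ h ∈ A) : doubleIdeal W ≤ A := by
  refine Submodule.span_le.mpr ?_
  rintro _ (⟨φ, h, x, hx, rfl⟩ | ⟨φ, h, y, hy, rfl⟩)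
  · rw [hW.dualMul_harpoonL hx]
    exact hL x hx φ h
  · rw [hW.dualMul_harpoonR hy]
    exact hR y hy φ h

theorem IsWHA.doubleIdeal_le_ker (hW : IsWHA S) {F : Module.Dual ℂ W ⊗[ℂ] W →ₗ[ℂ] X}
    (hL : ∀ x ∈ WL W, ∀ (φ : Module.Dual ℂ W) (h : W),
      F (φ ⊗ₜ (x * h)) = F (translate φ 1 (inv S x) ⊗ₜ h))
    (hR : ∀ y ∈ WR W, ∀ (φ : Module.Dual ℂ W) (h : W),
      F (φ ⊗ₜ (y * h)) = F (translate φ y 1 ⊗ₜ h)) : doubleIdeal W ≤ LinearMap.ker F :=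
  hW.doubleIdeal_le
    (fun x hx φ h => by rw [LinearMap.mem_ker, map_sub, hL x hx, sub_self])
    (fun y hy φ h => by rw [LinearMap.mem_ker, map_sub, hR y hy, sub_self])

/-- A product whose right-hand factor lies in `J` is zero: `x ∈ W_L` moves from `h` to the
functional by `∑ a y ⊗ b = ∑ a ⊗ b S(y)` in the coproduct of the left-hand factor, where
`y = S⁻¹(x)`, and similarly for `W_R`. -/
theorem IsWHA.preMul_right_eq_zero (hW : IsWHA S) (a j : Module.Dual ℂ W ⊗[ℂ] W)
    (hj : j ∈ doubleIdeal W) : preMul S a j = 0 := by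
  suffices h : doubleIdeal W ≤ LinearMap.ker (preMul S a) from h hj
  induction a with
  | zero => simp
  | add a b ha hb =>
    intro z hz
    have h₁ := ha hz
    have h₂ := hb hz
    rw [LinearMap.mem_ker] at *
    rw [map_add, LinearMap.add_apply, h₁, h₂, add_zero]
  | tmul ψ g =>
    refine hW.doubleIdeal_le_ker (fun x hx φ h => ?_) (fun y hy φ h => ?_)
    · rw [preMul_tmul, preMul_tmul]
      rw [← sw_coassoc g (fun a b c => dualMul W ψ (translate φ (inv S c) a) ⊗ₜ[ℂ] (b * (x * h))),
        ← sw_coassoc g (fun a b c =>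
          dualMul W ψ (translate (translate φ 1 (inv S x)) (inv S c) a) ⊗ₜ[ℂ] (b * h))]
      refine ten_congr fun y c => ?_
      have := hW.sw_mul_antipode_right (hW.inv_memR hx) y
        (fun a b => dualMul W ψ (translate φ (inv S c) a) ⊗ₜ[ℂ] (b * h))
      simpa only [translate_translate, one_mul, hW.antipode_inv, mul_assoc] using this
    · rw [preMul_tmul, preMul_tmul]
      refine ten_congr fun a x => ?_
      have := hW.sw_mul_antipode_right hy x
        (fun b c => dualMul W ψ (translate φ (inv S c) a) ⊗ₜ[ℂ] (b * h))
      simpa only [translate_translate, mul_one, hW.inv_antimul, hW.inv_antipode, mul_assoc]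
        using this.symm

/-- A product whose left-hand factor lies in `J` is zero. -/
theorem IsWHA.preMul_left_eq_zero (hW : IsWHA S) (a j : Module.Dual ℂ W ⊗[ℂ] W)
    (hj : j ∈ doubleIdeal W) : preMul S j a = 0 := by
  suffices h : doubleIdeal W ≤ LinearMap.ker ((preMul S).flip a) from h hj
  induction a with
  | zero => simp
  | add a b ha hb =>
    intro z hz
    have h₁ := ha hz
    have h₂ := hb hz
    rw [LinearMap.mem_ker] at *
    rw [map_add, LinearMap.add_apply, h₁, h₂, add_zero]
  | tmul ψ g =>
    refine hW.doubleIdeal_le_ker (fun x hx φ h => ?_) (fun y hy φ h => ?_)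
    · simp only [LinearMap.flip_apply, preMul_tmul]
      rw [hW.sw_memL_mul hx h (fun a x => ten (Δ x) fun b c =>
        dualMul W φ (translate ψ (inv S c) a) ⊗ₜ[ℂ] (b * g))]
      simp only [hW.dualMul_translate_inv hx, translate_translate, mul_one]
    · simp only [LinearMap.flip_apply, preMul_tmul]
      rw [hW.sw_memR_mul hy h (fun a x => ten (Δ x) fun b c =>
        dualMul W φ (translate ψ (inv S c) a) ⊗ₜ[ℂ] (b * g))]
      refine ten_congr fun a x => ?_
      rw [hW.sw_memR_mul hy x (fun b c =>
        dualMul W φ (translate ψ (inv S c) a) ⊗ₜ[ℂ] (b * g))]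
      simp only [hW.dualMul_translate_left hy, translate_translate, one_mul, hW.inv_antimul]

/-- The product of the quantum double. -/
noncomputable def IsWHA.dMul (hW : IsWHA S) :
    QuantumDouble W →ₗ[ℂ] QuantumDouble W →ₗ[ℂ] QuantumDouble W :=
  ((doubleIdeal W).liftQ ((doubleIdeal W).liftQ ((preMul S).compr₂ toDouble)
    (fun j hj => LinearMap.ext fun a => by simp [hW.preMul_left_eq_zero a j hj])).flip
    (fun j hj => LinearMap.ext fun d => by
      obtain ⟨a, rfl⟩ := Submodule.mkQ_surjective _ d
      change toDouble (preMul S a j) = 0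
      rw [hW.preMul_right_eq_zero a j hj, map_zero])).flip

theorem IsWHA.dMul_toDouble (hW : IsWHA S) (a b : Module.Dual ℂ W ⊗[ℂ] W) :
    hW.dMul (toDouble a) (toDouble b) = toDouble (preMul S a b) := rfl

@[elab_as_elim]
theorem double_induction {P : QuantumDouble W → Prop} (d : QuantumDouble W)
    (h₁ : ∀ φ h, P (cls φ h)) (h₂ : ∀ d e, P d → P e → P (d + e)) : P d := by
  obtain ⟨t, rfl⟩ := Submodule.mkQ_surjective _ d
  induction t with
  | zero => simpa using h₁ 0 0
  | tmul φ h => exact h₁ φ h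
  | add s t hs ht => rw [map_add]; exact h₂ _ _ hs ht

theorem IsWHA.dMul_assoc (hW : IsWHA S) (a b c : QuantumDouble W) :
    hW.dMul (hW.dMul a b) c = hW.dMul a (hW.dMul b c) := by
  obtain ⟨a, rfl⟩ := Submodule.mkQ_surjective _ a
  obtain ⟨b, rfl⟩ := Submodule.mkQ_surjective _ b
  obtain ⟨c, rfl⟩ := Submodule.mkQ_surjective _ c
  simp only [hW.dMul_toDouble, preMul_assoc hW]

/-- `[φ ⊗ h][ψ ⊗ g] = ∑ [φ ψ(S⁻¹(h⁽³⁾) · h⁽¹⁾) ⊗ h⁽²⁾ g]`. -/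
theorem IsWHA.dMul_cls (hW : IsWHA S) (φ ψ : Module.Dual ℂ W) (h g : W) :
    hW.dMul (cls φ h) (cls ψ g) = ten (Δ h) fun a x => ten (Δ x) fun b c =>
      cls (dualMul W φ (translate ψ (inv S c) a)) (b * g) := by
  rw [hW.dMul_toDouble, preMul_tmul]
  simp only [map_ten]

/-- `[φ ⊗ 1][ψ ⊗ g] = [φψ ⊗ g]`. The components of `Δ₂(1)` lie in `W_L` and `W_R`, so that they
move to the functional `ψ`, where they contract to `∑ S⁻¹(1⁽²⁾) 1⁽¹⁾ = 1` on both sides. -/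
theorem IsWHA.dMul_cls_one (hW : IsWHA S) (φ ψ : Module.Dual ℂ W) (g : W) :
    hW.dMul (cls φ 1) (cls ψ g) = cls (dualMul W φ ψ) g := by
  calc _ = ten (Δ 1) fun a b => ten (Δ 1) fun c d =>
        cls (dualMul W φ (translate ψ (inv S d) a)) (b * (c * g)) := by
        rw [hW.dMul_cls, hW.sw_one₃ (fun a b c =>
          cls (dualMul W φ (translate ψ (inv S c) a)) (b * g))]
        simp only [mul_assoc]
    _ = ten (Δ 1) fun a b => ten (Δ 1) fun c d =>
        cls (dualMul W φ (translate ψ (inv S d) a)) (εL W b * (εR W c * g)) := by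
        rw [← hW.sw_one_εL (fun a b => ten (Δ 1) fun c d =>
          cls (dualMul W φ (translate ψ (inv S d) a)) (b * (c * g)))]
        refine ten_congr fun a b => ?_
        rw [← hW.sw_one_εR (fun c d =>
          cls (dualMul W φ (translate ψ (inv S d) a)) (εL W b * (c * g)))]
    _ = ten (Δ 1) fun a b => ten (Δ 1) fun c d =>
        cls (dualMul W φ (translate ψ (inv S d * εR W c) (inv S (εL W b) * a))) g := by
        refine ten_congr fun a b => ten_congr fun c d => ?_
        rw [hW.cls_memL (εL_mem b), hW.translate_dualMul_memR' (hW.inv_memR (εL_mem b)),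
          hW.cls_memR (εR_mem c), hW.translate_dualMul_memR (εR_mem c)]
        simp only [translate_translate, mul_one, one_mul]
    _ = ten (Δ 1) fun a b => ten (Δ 1) fun c d =>
        cls (dualMul W φ (translate ψ (inv S d * c) (inv S b * a))) g := by
        rw [hW.sw_one_εL (fun a b => ten (Δ 1) fun c d =>
          cls (dualMul W φ (translate ψ (inv S d * εR W c) (inv S b * a))) g)]
        refine ten_congr fun a b => ?_
        rw [hW.sw_one_εR (fun c d =>
          cls (dualMul W φ (translate ψ (inv S d * c) (inv S b * a))) g)]
    _ = cls (dualMul W φ ψ) g := by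
        calc _ = ten (Δ 1) fun a b => cls (dualMul W φ (translate ψ 1 (inv S b * a))) g := by
              refine ten_congr fun a b => ?_
              rw [← Lin.map_ten (g := fun z =>
                cls (dualMul W φ (translate ψ z (inv S b * a))) g) (by fun_prop)
                (Δ 1) (fun c d => inv S d * c), hW.sw_one_inv_mul]
          _ = _ := by
              rw [← Lin.map_ten (g := fun z => cls (dualMul W φ (translate ψ 1 z)) g) (by fun_prop)
                (Δ 1) (fun a b => inv S b * a), hW.sw_one_inv_mul, translate_one]

/-- `[φ ⊗ h][ε ⊗ g] = [φ ⊗ hg]`. The outer components of `h` enter only through `ε_L`, and are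
thereby replaced by components of `Δ(1)`, which contract as before. -/
theorem IsWHA.dMul_cls_counit (hW : IsWHA S) (φ : Module.Dual ℂ W) (h g : W) :
    hW.dMul (cls φ h) (cls ϵ g) = cls φ (h * g) := by
  calc _ = ten (Δ h) fun a x => ten (Δ x) fun b c =>
        cls (dualMul W φ (translate ϵ (inv S (εL W c)) (εL W a))) (b * g) := by
        rw [hW.dMul_cls]
        refine ten_congr fun a x => ten_congr fun b c => ?_
        have : translate (ϵ : Module.Dual ℂ W) (inv S (εL W c)) (εL W a) =
            translate ϵ (inv S c) a := by
          ext z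
          rw [translate_apply, translate_apply, hW.counit_mul_εL, ← hW.εR_inv, mul_assoc,
            hW.counit_εR_mul, mul_assoc]
        rw [this]
    _ = ten (Δ h) fun a x => ten (Δ 1) fun r s =>
        cls (dualMul W φ (translate ϵ (inv S s) (εL W a))) (r * x * g) := by
        refine ten_congr fun a x => ?_
        rw [hW.sw_εL_right x (fun b c =>
          cls (dualMul W φ (translate ϵ (inv S c) (εL W a))) (b * g))]
    _ = ten (Δ 1) fun p q => ten (Δ 1) fun r s =>
        cls (dualMul W φ (translate ϵ (inv S s) (S p))) (r * (q * (h * g))) := by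
        rw [hW.sw_εL_left h (fun a x => ten (Δ 1) fun r s =>
          cls (dualMul W φ (translate ϵ (inv S s) a)) (r * x * g))]
        simp only [mul_assoc]
    _ = ten (Δ 1) fun p q => ten (Δ 1) fun r s =>
        cls (dualMul W φ (translate ϵ (inv S s) (S (εR W p)))) (εR W r * (εL W q * (h * g))) := by
        rw [← hW.sw_one_εR_εL (fun p q => ten (Δ 1) fun r s =>
          cls (dualMul W φ (translate ϵ (inv S s) (S p))) (r * (q * (h * g))))]
        refine ten_congr fun p q => ?_
        rw [← hW.sw_one_εR (fun r s =>
          cls (dualMul W φ (translate ϵ (inv S s) (S (εR W p)))) (r * (εL W q * (h * g))))]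
    _ = ten (Δ 1) fun p q => ten (Δ 1) fun r s =>
        cls (dualMul W φ (translate ϵ (inv S s * εR W r) (S (εR W p) * εL W q))) (h * g) := by
        refine ten_congr fun p q => ten_congr fun r s => ?_
        rw [hW.cls_memR (εR_mem r), hW.translate_dualMul_memR (εR_mem r),
          hW.cls_memL (εL_mem q), hW.translate_dualMul_memR' (hW.inv_memR (εL_mem q))]
        simp only [translate_translate, mul_one, one_mul]
        rw [← hW.commute (hW.antipode_memL (εR_mem p)) (hW.inv_memR (εL_mem q))]
        have : translate (ϵ : Module.Dual ℂ W) (inv S s * εR W r)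
            (S (εR W p) * inv S (εL W q)) =
              translate ϵ (inv S s * εR W r) (S (εR W p) * εL W q) := by
          ext z
          simp only [translate_apply, ← mul_assoc]
          rw [hW.counit_mul_inv (εL_mem q)]
        rw [this]
    _ = ten (Δ 1) fun p q => ten (Δ 1) fun r s =>
        cls (dualMul W φ (translate ϵ (inv S s * r) (S p * q))) (h * g) := by
        rw [hW.sw_one_εR_εL (fun p q => ten (Δ 1) fun r s =>
          cls (dualMul W φ (translate ϵ (inv S s * εR W r) (S p * q))) (h * g))]
        refine ten_congr fun p q => ?_
        rw [hW.sw_one_εR (fun r s =>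
          cls (dualMul W φ (translate ϵ (inv S s * r) (S p * q))) (h * g))]
    _ = _ := by
        calc _ = ten (Δ 1) fun a b => cls (dualMul W φ (translate ϵ 1 (S a * b))) (h * g) := by
              refine ten_congr fun a b => ?_
              rw [← Lin.map_ten (g := fun z =>
                cls (dualMul W φ (translate ϵ z (S a * b))) (h * g)) (by fun_prop)
                (Δ 1) (fun c d => inv S d * c), hW.sw_one_inv_mul]
          _ = _ := by
              rw [← Lin.map_ten (g := fun z => cls (dualMul W φ (translate ϵ 1 z)) (h * g))
                (by fun_prop) (Δ 1) (fun a b => S a * b), hW.sw_antipode_mul, εR_one,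
                translate_one, dualMul_counit]

end

/-! ### The coproduct of `D(W)` -/

section

variable {W : Type*} [Ring W] [Algebra ℂ W] [Coalgebra ℂ W] [FiniteDimensional ℂ W]
  {X : Type*} [AddCommMonoid X] [Module ℂ X] {S : W →ₗ[ℂ] W} {x y : W}

/-- The coproduct of `Ŵ` is multiplicative. -/
theorem IsWHA.ten_dualComul_dualMul (hW : IsWHA S) (φ ψ : Module.Dual ℂ W)
    (f : Module.Dual ℂ W → Module.Dual ℂ W → X)
    (h₁ : ∀ b, Lin fun a => f a b := by fun_prop) (h₂ : ∀ a, Lin fun b => f a b := by fun_prop) :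
    ten (dualComul W (dualMul W φ ψ)) f = ten (dualComul W φ) fun p p' =>
      ten (dualComul W ψ) fun q q' => f (dualMul W p q) (dualMul W p' q') := by
  have : dualComul W (dualMul W φ ψ) = ten (dualComul W φ) fun p p' =>
      ten (dualComul W ψ) fun q q' => dualMul W p q ⊗ₜ dualMul W p' q' := by
    refine dual_tmul_dual_ext fun u v => ?_
    rw [dualDistrib_dualComul, dualMul_apply, hW.sw_mul u v (fun a b => φ a * ψ b)]
    rw [Lin.map_ten (g := fun z => TensorProduct.dualDistrib ℂ W W z (u ⊗ₜ v)) (by fun_prop)]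
    calc _ = ten (Δ u) fun a b => ten (Δ v) fun c d => ten (dualComul W φ) fun p p' =>
          ten (dualComul W ψ) fun q q' => (p a * q b) * (p' c * q' d) := by
          refine ten_congr fun a b => ten_congr fun c d => ?_
          rw [← ten_dualComul_mul, ← ten_dualComul_mul,
            Lin.map_ten (g := fun z => z * ten (dualComul W ψ) fun p q => p b * q d) (by fun_prop)]
          refine ten_congr fun p p' => ?_
          rw [Lin.map_ten (g := fun z => (p a * p' c) * z) (by fun_prop)]
          simp only [mul_mul_mul_comm]
      _ = ten (dualComul W φ) fun p p' => ten (dualComul W ψ) fun q q' =>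
          ten (Δ u) fun a b => ten (Δ v) fun c d => (p a * q b) * (p' c * q' d) := by
          exact (ten_congr fun a b =>
            ten_comm₂ (Δ v) (dualComul W φ) (fun _ _ => dualComul W ψ) _).trans
            (ten_comm₂ (Δ u) (dualComul W φ) (fun _ _ => dualComul W ψ) _)
      _ = _ := by
          refine ten_congr fun p p' => ?_
          rw [Lin.map_ten (g := fun z => TensorProduct.dualDistrib ℂ W W z (u ⊗ₜ v)) (by fun_prop)]
          refine ten_congr fun q q' => ?_
          rw [TensorProduct.dualDistrib_apply, dualMul_apply, dualMul_apply,
            Lin.map_ten (g := fun z => z * ten (Δ v) fun a b => p' a * q' b) (by fun_prop)]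
          refine ten_congr fun a b => ?_
          rw [Lin.map_ten (g := fun z => (p a * q b) * z) (by fun_prop)]
  rw [this, ten_ten _ _ _ h₁ h₂]
  refine ten_congr fun p p' => ?_
  rw [ten_ten _ _ _ h₁ h₂]
  exact ten_congr fun q q' => ten_tmul _ _ h₁ h₂

/-- The coproduct of the quantum double. -/
noncomputable def IsWHA.dComul (hW : IsWHA S) :
    QuantumDouble W →ₗ[ℂ] QuantumDouble W ⊗[ℂ] QuantumDouble W :=
  (doubleIdeal W).liftQ (TensorProduct.map toDouble toDouble ∘ₗ preComul) <| by
    refine hW.doubleIdeal_le_ker (fun x hx φ h => ?_) (fun y hy φ h => ?_)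
    · simp only [LinearMap.comp_apply, preComul_tmul, map_ten, TensorProduct.map_tmul]
      rw [ten_dualComul_translate φ 1 (inv S x)
        (fun p q => ten (Δ h) fun a b => cls q a ⊗ₜ cls p b)]
      refine ten_congr fun p q => ?_
      rw [hW.sw_memL_mul hx h (fun a b => cls q a ⊗ₜ cls p b)]
      simp only [hW.cls_memL hx, translate_one]
    · simp only [LinearMap.comp_apply, preComul_tmul, map_ten, TensorProduct.map_tmul]
      rw [ten_dualComul_translate φ y 1 (fun p q => ten (Δ h) fun a b => cls q a ⊗ₜ cls p b)]
      refine ten_congr fun p q => ?_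
      rw [hW.sw_memR_mul hy h (fun a b => cls q a ⊗ₜ cls p b)]
      simp only [hW.cls_memR hy, translate_one]

theorem IsWHA.dComul_toDouble (hW : IsWHA S) (a : Module.Dual ℂ W ⊗[ℂ] W) :
    hW.dComul (toDouble a) = TensorProduct.map toDouble toDouble (preComul a) := rfl

theorem IsWHA.dComul_cls (hW : IsWHA S) (φ : Module.Dual ℂ W) (h : W) :
    hW.dComul (cls φ h) = ten (dualComul W φ) fun p q => ten (Δ h) fun a b =>
      cls q a ⊗ₜ cls p b := by
  rw [hW.dComul_toDouble, preComul_tmul]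
  simp only [map_ten, TensorProduct.map_tmul]

/-- The straightening map is compatible with the coproducts, up to the relation
`[φ ⊗ yh] = [φ(y ·) ⊗ h]` for `y ∈ W_R` in the first of the two factors. In the sum on the left,
the factors `h⁽³⁾` and `h⁽⁴⁾` only enter through `h⁽⁴⁾ S⁻¹(h⁽³⁾)`, which sums up to
`S⁻¹(ε_L(h⁽³⁾))`. This replaces `h⁽²⁾ ⊗ h⁽³⁾` by `1⁽¹⁾ h⁽²⁾ ⊗ 1⁽²⁾`; the relation moves
`1⁽¹⁾ ∈ W_R`, and `∑ S⁻¹(1⁽²⁾) 1⁽¹⁾ = 1`. -/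
theorem IsWHA.straighten_comul (hW : IsWHA S) (ψ : Module.Dual ℂ W) (h : W)
    (F : Module.Dual ℂ W → W → Module.Dual ℂ W → W → X)
    (h₁ : ∀ b c d, Lin fun a => F a b c d) (h₂ : ∀ a c d, Lin fun b => F a b c d)
    (h₃ : ∀ a b d, Lin fun c => F a b c d) (h₄ : ∀ a b c, Lin fun d => F a b c d)
    (hF : ∀ y ∈ WR W, ∀ a b c d, F a (y * b) c d = F (translate a y 1) b c d) :
    (ten (Δ h) fun u v => ten (Δ u) fun a x => ten (Δ x) fun b c => ten (Δ v) fun a' x' =>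
      ten (Δ x') fun b' c' => ten (dualComul W ψ) fun q q' =>
        F (translate q' (inv S c) a) b (translate q (inv S c') a') b') =
    ten (Δ h) fun a x => ten (Δ x) fun u c => ten (Δ u) fun b b' =>
      ten (dualComul W ψ) fun q q' => F (translate q' 1 a) b (translate q (inv S c) 1) b' := by
  let H : W → W → W → W → W → X := fun a b k b' c' => ten (dualComul W ψ) fun q q' =>
    F (translate q' 1 a) b (translate q (inv S c') k) b'
  have H₁ : ∀ b k b' c', Lin fun a => H a b k b' c' := by fun_prop
  have H₂ : ∀ a k b' c', Lin fun b => H a b k b' c' := by fun_prop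
  have H₃ : ∀ a b b' c', Lin fun k => H a b k b' c' := by fun_prop
  have H₄ : ∀ a b k c', Lin fun b' => H a b k b' c' := by fun_prop
  have H₅ : ∀ a b k b', Lin fun c' => H a b k b' c' := by fun_prop
  -- the two translations by adjacent arguments combine
  have hbal : ∀ a b k l b' c', (ten (dualComul W ψ) fun q q' =>
      F (translate q' l a) b (translate q (inv S c') k) b') = H a b (k * l) b' c' :=
    fun a b k l b' c' => by
      have := ten_dualComul_balance ψ k l
        (fun r s => F (translate s 1 a) b (translate r (inv S c') 1) b')
      simpa only [translate_translate, one_mul, mul_one] using this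
  calc _ = ten (Δ h) fun u v => ten (Δ u) fun a x => ten (Δ x) fun b c => ten (Δ v) fun a' x' =>
        ten (Δ x') fun b' c' => H a b (a' * inv S c) b' c' := by
        simp only [hbal]
    _ = ten (Δ h) fun a y => ten (Δ y) fun b z => ten (Δ z) fun w x' => ten (Δ w) fun c a' =>
        ten (Δ x') fun b' c' => H a b (a' * inv S c) b' c' := by
        rw [sw_coassoc h (fun a x v => ten (Δ x) fun b c => ten (Δ v) fun a' x' =>
          ten (Δ x') fun b' c' => H a b (a' * inv S c) b' c')]
        refine ten_congr fun a y => ?_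
        rw [sw_coassoc y (fun b c v => ten (Δ v) fun a' x' =>
          ten (Δ x') fun b' c' => H a b (a' * inv S c) b' c')]
        refine ten_congr fun b z => ?_
        rw [sw_coassoc z (fun c a' x' => ten (Δ x') fun b' c' => H a b (a' * inv S c) b' c')]
    _ = ten (Δ h) fun a y => ten (Δ y) fun b z => ten (Δ z) fun w x' =>
        ten (Δ x') fun b' c' => H a b (inv S (εL W w)) b' c' := by
        refine ten_congr fun a y => ten_congr fun b z => ten_congr fun w x' => ?_
        rw [← hW.sw_mul_inv w, Lin.map_ten (g := fun k => ten (Δ x') fun b' c' => H a b k b' c')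
          (by fun_prop)]
    _ = ten (Δ h) fun a y => ten (Δ y) fun b x' => ten (Δ 1) fun s t =>
        ten (Δ x') fun b' c' => H a (s * b) (inv S t) b' c' := by
        refine ten_congr fun a y => ?_
        rw [← sw_coassoc y (fun b w x' => ten (Δ x') fun b' c' => H a b (inv S (εL W w)) b' c')]
        refine ten_congr fun b x' => ?_
        rw [hW.sw_εL_right b (fun b w => ten (Δ x') fun b' c' => H a b (inv S w) b' c')]
    _ = ten (Δ h) fun a y => ten (Δ y) fun b x' => ten (Δ 1) fun s t =>
        ten (Δ x') fun b' c' => H a b (inv S t * s) b' c' := by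
        refine ten_congr fun a y => ten_congr fun b x' => ?_
        rw [← hW.sw_one_εR (fun s t => ten (Δ x') fun b' c' => H a (s * b) (inv S t) b' c'),
          ← hW.sw_one_εR (fun s t => ten (Δ x') fun b' c' => H a b (inv S t * s) b' c')]
        refine ten_congr fun s t => ten_congr fun b' c' => ?_
        rw [← hbal]
        simp only [H, hF _ (εR_mem s), translate_translate, one_mul]
    _ = ten (Δ h) fun a y => ten (Δ y) fun b x' => ten (Δ x') fun b' c' => H a b 1 b' c' := by
        refine ten_congr fun a y => ten_congr fun b x' => ?_
        rw [← Lin.map_ten (g := fun k => ten (Δ x') fun b' c' => H a b k b' c') (by fun_prop)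
          (Δ 1) (fun s t => inv S t * s), hW.sw_one_inv_mul]
    _ = _ := by
        refine ten_congr fun a y => ?_
        rw [← sw_coassoc y (fun b b' c' => H a b 1 b' c')]

theorem ten_tmul_ten {V U V' U' Y : Type*} [AddCommMonoid V] [Module ℂ V]
    [AddCommMonoid U] [Module ℂ U] [AddCommMonoid V'] [Module ℂ V'] [AddCommMonoid U'] [Module ℂ U']
    [AddCommMonoid Y] [Module ℂ Y] (s : V ⊗[ℂ] U) (t : V' ⊗[ℂ] U') (f : V → U → X)
    (g : V' → U' → Y) : ten s f ⊗ₜ[ℂ] ten t g =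
      ten s fun a b => ten t fun c d => f a b ⊗ₜ[ℂ] g c d := by
  rw [Lin.map_ten (g := fun z => z ⊗ₜ[ℂ] ten t g) (by fun_prop)]
  refine ten_congr fun a b => ?_
  rw [Lin.map_ten (g := fun z => f a b ⊗ₜ[ℂ] z) (by fun_prop)]

theorem IsWHA.dMul_tmul_ten (hW : IsWHA S) {V U V' U' : Type*} [AddCommMonoid V] [Module ℂ V]
    [AddCommMonoid U] [Module ℂ U] [AddCommMonoid V'] [Module ℂ V'] [AddCommMonoid U'] [Module ℂ U']
    (s : V ⊗[ℂ] U) (t : V' ⊗[ℂ] U') (f : V → U → QuantumDouble W ⊗[ℂ] QuantumDouble W)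
    (g : V' → U' → QuantumDouble W ⊗[ℂ] QuantumDouble W) :
    TensorProduct.map (TensorProduct.lift hW.dMul) (TensorProduct.lift hW.dMul)
      (TensorProduct.tensorTensorTensorComm ℂ _ _ _ _ (ten s f ⊗ₜ ten t g)) =
    ten s fun a b => ten t fun c d =>
      TensorProduct.map (TensorProduct.lift hW.dMul) (TensorProduct.lift hW.dMul)
        (TensorProduct.tensorTensorTensorComm ℂ _ _ _ _ (f a b ⊗ₜ g c d)) := by
  rw [Lin.map_ten (g := fun z =>
    TensorProduct.map (TensorProduct.lift hW.dMul) (TensorProduct.lift hW.dMul)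
      (TensorProduct.tensorTensorTensorComm ℂ _ _ _ _ (z ⊗ₜ ten t g))) (by fun_prop)]
  refine ten_congr fun a b => ?_
  rw [Lin.map_ten (g := fun z =>
    TensorProduct.map (TensorProduct.lift hW.dMul) (TensorProduct.lift hW.dMul)
      (TensorProduct.tensorTensorTensorComm ℂ _ _ _ _ (f a b ⊗ₜ z))) (by fun_prop)]

/-- The coproduct of the quantum double is multiplicative. -/
theorem IsWHA.dComul_dMul (hW : IsWHA S) (d e : QuantumDouble W) : hW.dComul (hW.dMul d e) =
    TensorProduct.map (TensorProduct.lift hW.dMul) (TensorProduct.lift hW.dMul)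
      (TensorProduct.tensorTensorTensorComm ℂ _ _ _ _ (hW.dComul d ⊗ₜ hW.dComul e)) := by
  induction d using double_induction with
  | h₂ d d' hd hd' => simp only [map_add, LinearMap.add_apply, hd, hd', TensorProduct.add_tmul]
  | h₁ φ h =>
  induction e using double_induction with
  | h₂ e e' he he' => simp only [map_add, he, he', TensorProduct.tmul_add]
  | h₁ ψ g =>
  -- the terms of the sum, where `α ⊗ b` and `β ⊗ b'` come from straightening `ψ ⊗ h`
  let F : Module.Dual ℂ W → Module.Dual ℂ W → W → W → Module.Dual ℂ W → W → Module.Dual ℂ W → W →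
      QuantumDouble W ⊗[ℂ] QuantumDouble W := fun p p' g₁ g₂ α b β b' =>
    cls (dualMul W p' α) (b * g₁) ⊗ₜ cls (dualMul W p β) (b' * g₂)
  calc _ = ten (Δ h) fun a x => ten (Δ x) fun u c => ten (dualComul W φ) fun p p' =>
        ten (dualComul W ψ) fun q q' => ten (Δ u) fun b b' => ten (Δ g) fun g₁ g₂ =>
          F p p' g₁ g₂ (translate q' 1 a) b (translate q (inv S c) 1) b' := by
        rw [hW.dMul_cls, map_ten]
        refine ten_congr fun a x => ?_
        rw [map_ten]
        refine ten_congr fun u c => ?_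
        rw [hW.dComul_cls, hW.ten_dualComul_dualMul _ _
          (fun P Q => ten (Δ (u * g)) fun a b => cls Q a ⊗ₜ cls P b)]
        refine ten_congr fun p p' => ?_
        rw [ten_dualComul_translate _ _ _ (fun q q' => ten (Δ (u * g)) fun a b =>
          cls (dualMul W p' q') a ⊗ₜ cls (dualMul W p q) b)]
        refine ten_congr fun q q' => ?_
        rw [hW.sw_mul u g (fun r s => cls (dualMul W p' (translate q' 1 a)) r ⊗ₜ
          cls (dualMul W p (translate q (inv S c) 1)) s)]
    _ = ten (dualComul W φ) fun p p' => ten (Δ g) fun g₁ g₂ =>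
        ten (Δ h) fun a x => ten (Δ x) fun u c => ten (Δ u) fun b b' =>
        ten (dualComul W ψ) fun q q' =>
          F p p' g₁ g₂ (translate q' 1 a) b (translate q (inv S c) 1) b' := by
        refine (ten_congr fun a x => ten_congr fun u c => ten_congr fun p p' =>
          (ten_congr fun _ _ => ten_comm _ _ _).trans ((ten_comm _ _ _).trans
            (ten_congr fun _ _ => ten_comm _ _ _))).trans ?_
        refine (ten_comm₂ (dualComul W φ) (Δ h) (fun a x => Δ x) _).symm.trans ?_
        exact ten_congr fun p p' => (ten_comm₂ (Δ g) (Δ h) (fun a x => Δ x) _).symm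
    _ = ten (dualComul W φ) fun p p' => ten (Δ g) fun g₁ g₂ =>
        ten (Δ h) fun u v => ten (Δ u) fun a x => ten (Δ x) fun b c => ten (Δ v) fun a' x' =>
        ten (Δ x') fun b' c' => ten (dualComul W ψ) fun q q' =>
          F p p' g₁ g₂ (translate q' (inv S c) a) b (translate q (inv S c') a') b' := by
        refine ten_congr fun p p' => ten_congr fun g₁ g₂ => ?_
        rw [hW.straighten_comul ψ h (F p p' g₁ g₂) (by fun_prop) (by fun_prop) (by fun_prop)
          (by fun_prop)]
        intro y hy a b c d
        simp only [F]
        rw [mul_assoc, hW.cls_memR hy, hW.translate_dualMul_memR hy]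
    _ = _ := by
        rw [hW.dComul_cls, hW.dComul_cls, hW.dMul_tmul_ten]
        refine ten_congr fun p p' => ?_
        simp only [hW.dMul_tmul_ten]
        simp only [TensorProduct.tensorTensorTensorComm_tmul, TensorProduct.map_tmul,
          TensorProduct.lift.tmul]
        simp only [hW.dMul_cls]
        -- the sums are brought into the order of the product of the two coproducts
        have key : ∀ G : W → W → W → W → W → W → W → W → Module.Dual ℂ W → Module.Dual ℂ W →
            QuantumDouble W ⊗[ℂ] QuantumDouble W,
            (ten (Δ g) fun g₁ g₂ => ten (Δ h) fun u v => ten (Δ u) fun a x => ten (Δ x) fun b c =>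
              ten (Δ v) fun a' x' => ten (Δ x') fun b' c' => ten (dualComul W ψ) fun q q' =>
                G g₁ g₂ a b c a' b' c' q q') =
            ten (dualComul W ψ) fun q q' => ten (Δ h) fun u v => ten (Δ g) fun g₁ g₂ =>
              ten (Δ u) fun a x => ten (Δ x) fun b c =>
              ten (Δ v) fun a' x' => ten (Δ x') fun b' c' => G g₁ g₂ a b c a' b' c' q q' := by
          intro G
          refine (ten_comm _ _ _).trans (Eq.trans ?_ (ten_comm _ _ _))
          refine ten_congr fun u v => Eq.trans ?_ (ten_comm _ _ _)
          refine ten_congr fun g₁ g₂ => Eq.trans ?_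
            (ten_comm₂ (dualComul W ψ) (Δ u) (fun _ x => Δ x) _).symm
          refine ten_congr fun a x => ten_congr fun b c => ?_
          exact (ten_comm₂ (dualComul W ψ) (Δ v) (fun _ x' => Δ x') _).symm
        rw [key (fun g₁ g₂ a b c a' b' c' q q' =>
          F p p' g₁ g₂ (translate q' (inv S c) a) b (translate q (inv S c') a') b')]
        refine ten_congr fun q q' => ten_congr fun u v => ten_congr fun g₁ g₂ => ?_
        simp only [ten_tmul_ten]
        refine ten_congr fun a x => ?_
        rw [ten_comm (Δ x) (Δ v)]

end

/-! ### Coassociativity, the counit and `Δ(1)` -/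

section

variable {W : Type*} [Ring W] [Algebra ℂ W] [Coalgebra ℂ W] [FiniteDimensional ℂ W]
  {X : Type*} [AddCommMonoid X] [Module ℂ X] {S : W →ₗ[ℂ] W} {x y : W}

theorem double_ext {V : Type*} [AddCommGroup V] [Module ℂ V] {F G : QuantumDouble W →ₗ[ℂ] V}
    (h : ∀ φ k, F (cls φ k) = G (cls φ k)) : F = G := by
  ext d
  exact h _ _

theorem IsWHA.dComul_coassoc (hW : IsWHA S) :
    (TensorProduct.assoc ℂ _ _ _).toLinearMap ∘ₗ LinearMap.rTensor _ hW.dComul ∘ₗ hW.dComul =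
      LinearMap.lTensor _ hW.dComul ∘ₗ hW.dComul := by
  refine double_ext fun φ h => ?_
  simp only [LinearMap.comp_apply, LinearEquiv.coe_toLinearMap]
  rw [hW.dComul_cls]
  let G : Module.Dual ℂ W → Module.Dual ℂ W → Module.Dual ℂ W → W → W → W →
      QuantumDouble W ⊗[ℂ] (QuantumDouble W ⊗[ℂ] QuantumDouble W) := fun p q r a b c =>
    cls r a ⊗ₜ (cls q b ⊗ₜ cls p c)
  calc _ = ten (dualComul W φ) fun p x => ten (dualComul W x) fun q r =>
        ten (Δ h) fun x c => ten (Δ x) fun a b => G p q r a b c := by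
        rw [Lin.map_ten (g := fun z => TensorProduct.assoc ℂ _ _ _
          (LinearMap.rTensor _ hW.dComul z)) (by fun_prop)]
        refine ten_congr fun p x => ?_
        rw [ten_comm, Lin.map_ten (g := fun z => TensorProduct.assoc ℂ _ _ _
          (LinearMap.rTensor _ hW.dComul z)) (by fun_prop)]
        refine ten_congr fun y c => ?_
        rw [LinearMap.rTensor_tmul, hW.dComul_cls, Lin.map_ten (g := fun z =>
          TensorProduct.assoc ℂ _ _ _ (z ⊗ₜ cls p c)) (by fun_prop)]
        refine ten_congr fun q r => ?_
        rw [Lin.map_ten (g := fun z =>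
          TensorProduct.assoc ℂ _ _ _ (z ⊗ₜ cls p c)) (by fun_prop)]
        rfl
    _ = ten (dualComul W φ) fun x r => ten (dualComul W x) fun p q =>
        ten (Δ h) fun a y => ten (Δ y) fun b c => G p q r a b c := by
        rw [ten_dualComul_coassoc φ (fun p q r => ten (Δ h) fun a y => ten (Δ y) fun b c =>
          G p q r a b c)]
        refine ten_congr fun p x => ten_congr fun q r => ?_
        rw [sw_coassoc h (fun a b c => G p q r a b c)]
    _ = _ := by
        rw [map_ten]
        refine ten_congr fun x r => ?_
        rw [map_ten, ten_comm]
        refine ten_congr fun a y => ?_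
        rw [LinearMap.lTensor_tmul, hW.dComul_cls, Lin.map_ten (g := fun z =>
          cls r a ⊗ₜ[ℂ] z) (by fun_prop)]
        refine ten_congr fun p q => ?_
        rw [Lin.map_ten (g := fun z => cls r a ⊗ₜ[ℂ] z) (by fun_prop)]

/-- The counit of the quantum double. -/
noncomputable def IsWHA.dCounit (hW : IsWHA S) : QuantumDouble W →ₗ[ℂ] ℂ :=
  (doubleIdeal W).liftQ (preCounit S) <| by
    refine hW.doubleIdeal_le_ker (fun x hx φ h => ?_) (fun y hy φ h => ?_)
    · rw [preCounit_tmul, preCounit_tmul, hW.inv_antimul, hW.εR_mul_memR (hW.inv_memR hx),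
        translate_apply, one_mul]
    · rw [preCounit_tmul, preCounit_tmul, hW.inv_antimul, hW.εR_mul_memL (hW.inv_memL hy),
        hW.antipode_inv, translate_apply, mul_one]

theorem IsWHA.dCounit_cls (hW : IsWHA S) (φ : Module.Dual ℂ W) (h : W) :
    hW.dCounit (cls φ h) = φ (inv S (εL W h)) := by
  rw [← hW.εR_inv, ← preCounit_tmul]; rfl

theorem IsWHA.dComul_counit_left (hW : IsWHA S) :
    (TensorProduct.lid ℂ _).toLinearMap ∘ₗ LinearMap.rTensor _ hW.dCounit ∘ₗ hW.dComul =
      LinearMap.id := by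
  refine double_ext fun φ h => ?_
  calc _ = ten (dualComul W φ) fun p q => ten (Δ h) fun a b =>
        q (inv S (εL W a)) • cls p b := by
        simp only [LinearMap.comp_apply, hW.dComul_cls, map_ten, LinearMap.rTensor_tmul,
          hW.dCounit_cls, LinearEquiv.coe_toLinearMap, TensorProduct.lid_tmul]
    _ = ten (Δ h) fun a b => cls (translate φ 1 (inv S (εL W a))) b := by
        rw [ten_comm]
        refine ten_congr fun a b => ?_
        rw [ten_dualComul_smul_right φ (inv S (εL W a)) (fun p => cls p b)]
    _ = ten (Δ 1) fun a b => cls (translate φ 1 (inv S b * a)) h := by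
        rw [hW.sw_εL_left h (fun a b => cls (translate φ 1 (inv S a)) b),
          ← hW.sw_one_εL (fun a b => cls (translate φ 1 (inv S (S a))) (b * h)),
          ← hW.sw_one_εL (fun a b => cls (translate φ 1 (inv S b * a)) h)]
        refine ten_congr fun a b => ?_
        rw [hW.cls_memL (εL_mem b), translate_translate, hW.inv_antipode, one_mul]
    _ = _ := by
        rw [← Lin.map_ten (g := fun z => cls (translate φ 1 z) h) (by fun_prop) (Δ 1)
          (fun a b => inv S b * a), hW.sw_one_inv_mul, translate_one]
        rfl

theorem IsWHA.dComul_counit_right (hW : IsWHA S) :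
    (TensorProduct.rid ℂ _).toLinearMap ∘ₗ LinearMap.lTensor _ hW.dCounit ∘ₗ hW.dComul =
      LinearMap.id := by
  refine double_ext fun φ h => ?_
  calc _ = ten (dualComul W φ) fun p q => ten (Δ h) fun a b =>
        p (inv S (εL W b)) • cls q a := by
        simp only [LinearMap.comp_apply, hW.dComul_cls, map_ten, LinearMap.lTensor_tmul,
          hW.dCounit_cls, LinearEquiv.coe_toLinearMap, TensorProduct.rid_tmul]
    _ = ten (Δ h) fun a b => cls (translate φ (inv S (εL W b)) 1) a := by
        rw [ten_comm]
        refine ten_congr fun a b => ?_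
        rw [ten_dualComul_smul_left φ (inv S (εL W b)) (fun q => cls q a)]
    _ = ten (Δ 1) fun a b => cls (translate φ (inv S b * a) 1) h := by
        rw [hW.sw_εL_right h (fun a b => cls (translate φ (inv S b) 1) a),
          ← hW.sw_one_εR (fun a b => cls (translate φ (inv S b) 1) (a * h)),
          ← hW.sw_one_εR (fun a b => cls (translate φ (inv S b * a) 1) h)]
        refine ten_congr fun a b => ?_
        rw [hW.cls_memR (εR_mem a), translate_translate, one_mul]
    _ = _ := by
        rw [← Lin.map_ten (g := fun z => cls (translate φ z 1) h) (by fun_prop) (Δ 1)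
          (fun a b => inv S b * a), hW.sw_one_inv_mul, translate_one]
        rfl

theorem IsWHA.cls_counit_memR (hW : IsWHA S) (hy : y ∈ WR W) :
    cls ϵ y = cls (translate ϵ y 1) 1 := by
  rw [← hW.cls_memR hy, mul_one]

theorem IsWHA.translate_counit_inv (hW : IsWHA S) (hx : x ∈ WL W) :
    translate (ϵ : Module.Dual ℂ W) 1 (inv S x) = translate ϵ 1 x := by
  ext z
  simp only [translate_apply, one_mul, hW.counit_mul_inv hx]

theorem IsWHA.cls_counit_memL (hW : IsWHA S) (hx : x ∈ WL W) :
    cls ϵ x = cls (translate ϵ 1 x) 1 := by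
  rw [← hW.translate_counit_inv hx, ← hW.cls_memL hx, mul_one]

/-- `Δ̂(ε) = ∑ ε(· 1⁽²⁾) ⊗ ε(1⁽¹⁾ ·)`. -/
theorem IsWHA.ten_dualComul_counit (hW : IsWHA S)
    (f : Module.Dual ℂ W → Module.Dual ℂ W → X)
    (h₁ : ∀ b, Lin fun a => f a b := by fun_prop) (h₂ : ∀ a, Lin fun b => f a b := by fun_prop) :
    ten (dualComul W ϵ) f = ten (Δ 1) fun a b => f (translate ϵ 1 b) (translate ϵ a 1) := by
  have : dualComul W (ϵ : Module.Dual ℂ W) =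
      ten (Δ 1) fun a b => translate ϵ 1 b ⊗ₜ translate ϵ a 1 := by
    refine dual_tmul_dual_ext fun u v => ?_
    rw [dualDistrib_dualComul, Lin.map_ten
      (g := fun z => TensorProduct.dualDistrib ℂ W W z (u ⊗ₜ v)) (by fun_prop)]
    simpa using hW.counit_mul₃' u 1 v
  rw [this, ten_ten _ _ _ h₁ h₂]
  exact ten_congr fun a b => ten_tmul _ _ h₁ h₂

/-- The map `h ↦ [ε ⊗ h]` is compatible with the coproducts. -/
theorem IsWHA.dComul_cls_counit (hW : IsWHA S) (h : W) :
    hW.dComul (cls ϵ h) = ten (Δ h) fun a b => cls ϵ a ⊗ₜ cls ϵ b := by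
  rw [hW.dComul_cls, hW.ten_dualComul_counit
    (fun p q => ten (Δ h) fun a b => cls q a ⊗ₜ cls p b),
    ← hW.sw_one_mul h (fun a b => cls ϵ a ⊗ₜ cls ϵ b),
    ← hW.sw_one_εR_εL (fun p q => ten (Δ h) fun a b =>
      cls (translate ϵ p 1) a ⊗ₜ cls (translate ϵ 1 q) b),
    ← hW.sw_one_εR_εL (fun p q => ten (Δ h) fun a b => cls ϵ (p * a) ⊗ₜ cls ϵ (q * b))]
  refine ten_congr fun p q => ten_congr fun a b => ?_
  rw [hW.cls_memR (εR_mem p), hW.cls_memL (εL_mem q), hW.translate_counit_inv (εL_mem q)]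

theorem IsWHA.lTensor_dComul_one (hW : IsWHA S) :
    LinearMap.lTensor _ hW.dComul (hW.dComul (cls ϵ 1)) =
      ten (Δ 1) fun a x => ten (Δ x) fun b c => cls ϵ a ⊗ₜ (cls ϵ b ⊗ₜ cls ϵ c) := by
  rw [hW.dComul_cls_counit, map_ten]
  refine ten_congr fun a x => ?_
  rw [LinearMap.lTensor_tmul, hW.dComul_cls_counit,
    Lin.map_ten (g := fun z => cls ϵ a ⊗ₜ[ℂ] z) (by fun_prop)]

theorem IsWHA.mulMiddle_dComul_one (hW : IsWHA S)
    (m : QuantumDouble W →ₗ[ℂ] QuantumDouble W →ₗ[ℂ] QuantumDouble W) :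
    mulMiddle m (hW.dComul (cls ϵ 1) ⊗ₜ hW.dComul (cls ϵ 1)) =
      ten (Δ 1) fun a b => ten (Δ 1) fun c d => cls ϵ a ⊗ₜ (m (cls ϵ b) (cls ϵ c) ⊗ₜ cls ϵ d) := by
  simp only [hW.dComul_cls_counit, ten_tmul_ten, map_ten]
  simp [mulMiddle]

theorem IsWHA.dComul_one (hW : IsWHA S) :
    LinearMap.lTensor _ hW.dComul (hW.dComul (cls ϵ 1)) =
      mulMiddle hW.dMul (hW.dComul (cls ϵ 1) ⊗ₜ hW.dComul (cls ϵ 1)) := by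
  rw [hW.lTensor_dComul_one, hW.mulMiddle_dComul_one]
  simp only [hW.dMul_cls_counit]
  rw [hW.sw_one₃ (fun a b c => cls ϵ a ⊗ₜ (cls ϵ b ⊗ₜ cls ϵ c))]

theorem IsWHA.dComul_one' (hW : IsWHA S) :
    LinearMap.lTensor _ hW.dComul (hW.dComul (cls ϵ 1)) =
      mulMiddle hW.dMul.flip (hW.dComul (cls ϵ 1) ⊗ₜ hW.dComul (cls ϵ 1)) := by
  rw [hW.lTensor_dComul_one, hW.mulMiddle_dComul_one]
  simp only [LinearMap.flip_apply, hW.dMul_cls_counit]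
  rw [hW.sw_one₃' (fun a b c => cls ϵ a ⊗ₜ (cls ϵ b ⊗ₜ cls ϵ c))]

end

/-! ### Weak multiplicativity of the counit -/

section

variable {W : Type*} [Ring W] [Algebra ℂ W] [Coalgebra ℂ W] [FiniteDimensional ℂ W]
  {X : Type*} [AddCommMonoid X] [Module ℂ X] {S : W →ₗ[ℂ] W} {x y : W}

/-- The counit of the double only sees `[ψ ⊗ h]` as a right-hand factor through
`[ψ ⊗ ε_L(h)] = [ψ(· S⁻¹(ε_L(h))) ⊗ 1]`. -/
theorem IsWHA.dCounit_dMul_cls (hW : IsWHA S) (v : QuantumDouble W) (ψ : Module.Dual ℂ W) (h : W) :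
    hW.dCounit (hW.dMul v (cls ψ h)) =
      hW.dCounit (hW.dMul v (cls (translate ψ 1 (inv S (εL W h))) 1)) := by
  have key : ∀ u : QuantumDouble W, hW.dCounit (hW.dMul u (cls ϵ h)) =
      hW.dCounit (hW.dMul u (cls ϵ (εL W h))) := fun u => by
    induction u using double_induction with
    | h₁ φ g => simp only [hW.dMul_cls_counit, hW.dCounit_cls, hW.εL_mul_εL]
    | h₂ u u' hu hu' => simp only [map_add, LinearMap.add_apply, hu, hu']
  have e : ∀ k, cls ψ k = hW.dMul (cls ψ 1) (cls ϵ k) := fun k => by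
    rw [hW.dMul_cls_counit, one_mul]
  rw [e, ← hW.dMul_assoc, key, hW.dMul_assoc, ← e, ← hW.cls_memL (εL_mem h), mul_one]

/-- `ε([φ ⊗ S(k)] [ψ ⊗ 1]) = ∑ φ(1⁽¹⁾) ψ(ε_L(k 1⁽²⁾))`. -/
theorem IsWHA.dCounit_dMul_cls_one (hW : IsWHA S) (φ ψ : Module.Dual ℂ W) (k : W) :
    hW.dCounit (hW.dMul (cls φ (S k)) (cls ψ 1)) =
      ten (Δ 1) fun p q => φ p * ψ (εL W (k * q)) := by
  calc _ = ten (Δ k) fun x a => ten (Δ x) fun c b =>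
        dualMul W φ (translate ψ c (S a)) (εR W b) := by
        rw [hW.dMul_cls, map_ten, hW.sw_antipode k (fun a x => hW.dCounit (ten (Δ x) fun b c =>
          cls (dualMul W φ (translate ψ (inv S c) a)) (b * 1)))]
        refine ten_congr fun x a => ?_
        rw [map_ten, hW.sw_antipode x (fun b c => hW.dCounit (
          cls (dualMul W φ (translate ψ (inv S c) (S a))) (b * 1)))]
        refine ten_congr fun c b => ?_
        rw [mul_one, hW.dCounit_cls, hW.εL_antipode, hW.inv_antipode, hW.inv_antipode]
    _ = ten (Δ k) fun x a => ten (Δ x) fun c b => ten (Δ 1) fun p q =>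
        φ p * ψ (c * εR W b * q * S a) := by
        refine ten_congr fun x a => ten_congr fun c b => ?_
        rw [dualMul_apply, hW.comul_εR' b (fun p q => φ p * translate ψ c (S a) q)]
        simp only [translate_apply, mul_assoc]
    _ = ten (Δ 1) fun p q => ten (Δ k) fun x a => φ p * ψ (x * q * S a) := by
        rw [ten_comm]
        refine ten_congr fun x a => ?_
        rw [ten_comm]
        refine ten_congr fun p q => ?_
        rw [← Lin.map_ten (g := fun z => φ p * ψ (z * q * S a)) (by fun_prop) (Δ x)
          (fun c b => c * εR W b), hW.mul_εR]
    _ = _ := by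
        rw [← hW.sw_one_εL (fun p q => ten (Δ k) fun x a => φ p * ψ (x * q * S a)),
          ← hW.sw_one_εL (fun p q => φ p * ψ (εL W (k * q)))]
        refine ten_congr fun p q => ?_
        rw [hW.εL_mul_memL (εL_mem q),
          Lin.map_ten (g := fun z => φ p * ψ z) (by fun_prop)]

/-- The counit of the double only sees the right-hand factor through an element of `W`. -/
theorem IsWHA.exists_dCounit_dMul_right (hW : IsWHA S) (w : QuantumDouble W) :
    ∃ k : W, ∀ v, hW.dCounit (hW.dMul v w) = hW.dCounit (hW.dMul v (cls ϵ k)) := by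
  induction w using double_induction with
  | h₂ w w' hw hw' =>
    obtain ⟨k, hk⟩ := hw
    obtain ⟨k', hk'⟩ := hw'
    exact ⟨k + k', fun v => by
      rw [(show Lin fun z => cls ϵ z by fun_prop).map_add]
      simp only [map_add, hk, hk']⟩
  | h₁ ψ h =>
    simp only [hW.dCounit_dMul_cls _ ψ h]
    generalize translate ψ 1 (inv S (εL W h)) = ψ
    -- the sum is chosen such that `∑ φ(ε_R(k⁽¹⁾)) ψ(ε_L(k⁽²⁾)) = φ(ε_R((∑ ψ(1⁽²⁾) 1⁽¹⁾) k))`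
    refine ⟨S (ten (Δ 1) fun a b => ψ b • a), fun v => ?_⟩
    induction v using double_induction with
    | h₂ v v' hv hv' => simp only [map_add, LinearMap.add_apply, hv, hv']
    | h₁ φ g =>
    rw [← hW.antipode_inv g]
    generalize inv S g = k
    calc _ = ten (Δ 1) fun p q => φ p * ψ (εL W (k * q)) := hW.dCounit_dMul_cls_one φ ψ k
      _ = ten (Δ k) fun a b => φ (εR W a) * ψ (εL W b) := by
          rw [hW.sw_εR_left k (fun p b => φ p * ψ (εL W b))]
      _ = ten (Δ 1) fun a b => φ (εR W (a * k)) * ψ b := by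
          rw [hW.sw_εL_right k (fun a b => φ (εR W a) * ψ b)]
      _ = φ (εR W ((ten (Δ 1) fun a b => ψ b • a) * k)) := by
          rw [Lin.map_ten (g := fun z => φ (εR W (z * k))) (by fun_prop)]
          simp [mul_comm]
      _ = _ := by
          rw [hW.dMul_cls_counit, hW.dCounit_cls, ← hW.antipode_antimul, hW.εL_antipode,
            hW.inv_antipode]

/-- The counit of the double only sees the left-hand factor through an element of `Ŵ`. -/
theorem IsWHA.exists_dCounit_dMul_left (hW : IsWHA S) (v : QuantumDouble W) :
    ∃ χ : Module.Dual ℂ W, ∀ w,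
      hW.dCounit (hW.dMul v w) = hW.dCounit (hW.dMul (cls χ 1) w) := by
  induction v using double_induction with
  | h₂ v v' hv hv' =>
    obtain ⟨χ, hχ⟩ := hv
    obtain ⟨χ', hχ'⟩ := hv'
    exact ⟨χ + χ', fun w => by
      rw [(show Lin fun θ => cls θ (1 : W) by fun_prop).map_add]
      simp only [map_add, LinearMap.add_apply, hχ, hχ']⟩
  | h₁ φ g =>
    rw [← hW.antipode_inv g]
    generalize inv S g = k
    -- this functional times `ψ`, evaluated at `1`, is `ψ(ε_L(t))` with `t = ∑ φ(1⁽¹⁾) k 1⁽²⁾`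
    refine ⟨translate ϵ 1 (k * ten (Δ 1) fun p q => φ p • q), fun w => ?_⟩
    induction w using double_induction with
    | h₂ w w' hw hw' => simp only [map_add, hw, hw']
    | h₁ ψ h =>
    rw [hW.dCounit_dMul_cls, hW.dCounit_dMul_cls (cls _ 1)]
    generalize translate ψ 1 (inv S (εL W h)) = ψ
    calc _ = ten (Δ 1) fun p q => φ p * ψ (εL W (k * q)) := hW.dCounit_dMul_cls_one φ ψ k
      _ = ψ (εL W (k * ten (Δ 1) fun p q => φ p • q)) := by
          rw [Lin.map_ten (g := fun z => ψ (εL W (k * z))) (by fun_prop)]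
          simp
      _ = _ := by
          rw [hW.dMul_cls_one, hW.dCounit_cls, εL_one, hW.inv_one, dualMul_apply, εL_eq, map_ten]
          simp

/-- The counit of the double is weakly multiplicative. Both outer factors can be replaced by simpler
ones, and the inner sum is evaluated by `∑ ε_L(h⁽¹⁾) ε_L(h⁽²⁾ k) = ε_L(hk)`. -/
theorem IsWHA.dCounit_dMul (hW : IsWHA S) (u v w : QuantumDouble W) :
    hW.dCounit (hW.dMul (hW.dMul u v) w) =
      counitPair hW.dMul hW.dCounit u w (hW.dComul v) := by
  obtain ⟨χ, hχ⟩ := hW.exists_dCounit_dMul_left u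
  obtain ⟨k, hk⟩ := hW.exists_dCounit_dMul_right w
  induction v using double_induction with
  | h₂ v v' hv hv' => simp only [map_add, LinearMap.add_apply, hv, hv']
  | h₁ φ h =>
  calc _ = dualMul W χ φ (inv S (εL W (h * k))) := by
        rw [hk, hW.dMul_assoc, hχ, ← hW.dMul_assoc, hW.dMul_cls_one, hW.dMul_cls_counit,
          hW.dCounit_cls]
    _ = ten (Δ h) fun a b => dualMul W χ φ (inv S (εL W (b * k)) * inv S (εL W a)) := by
        conv_lhs => rw [← hW.εL_mul h,
          Lin.map_ten (g := fun z => dualMul W χ φ (inv S (εL W (z * k)))) (by fun_prop)]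
        simp only [mul_assoc, hW.εL_εL_mul, hW.inv_antimul]
    _ = ten (Δ h) fun a b => ten (dualComul W φ) fun p q =>
        dualMul W χ q (inv S (εL W a)) * p (inv S (εL W (b * k))) := by
        refine ten_congr fun a b => ?_
        have := ten_dualComul_smul_left φ (inv S (εL W (b * k)))
          (fun q => dualMul W χ q (inv S (εL W a)))
        simp only [smul_eq_mul] at this
        simp only [mul_comm (dualMul W χ _ _), this]
        rw [← hW.translate_dualMul_memR (hW.inv_memR (εL_mem _)), translate_apply, mul_one]
    _ = _ := by
        rw [hW.dComul_cls, ten_comm]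
        simp only [map_ten, counitPair, LinearMap.comp_apply, TensorProduct.map_tmul,
          LinearMap.flip_apply, hχ, hk, hW.dMul_cls_one, hW.dMul_cls_counit, hW.dCounit_cls]
        simp

/-- The other form of weak multiplicativity, evaluated by
`∑ ε_L(h⁽¹⁾ k) ε_L(h⁽²⁾) = ε_L(hk)`. -/
theorem IsWHA.dCounit_dMul' (hW : IsWHA S) (u v w : QuantumDouble W) :
    hW.dCounit (hW.dMul (hW.dMul u v) w) =
      counitPair hW.dMul hW.dCounit u w (TensorProduct.comm ℂ _ _ (hW.dComul v)) := by
  obtain ⟨χ, hχ⟩ := hW.exists_dCounit_dMul_left u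
  obtain ⟨k, hk⟩ := hW.exists_dCounit_dMul_right w
  induction v using double_induction with
  | h₂ v v' hv hv' => simp only [map_add, LinearMap.add_apply, hv, hv']
  | h₁ φ h =>
  have hsum : (ten (Δ h) fun a b => εL W (a * k) * εL W b) = εL W (h * k) := by
    calc _ = ten (Δ (h * k)) fun a b => εL W a * εL W b := by
          rw [hW.sw_εL_right h (fun a b => εL W (a * k) * b),
            hW.sw_εL_right (h * k) (fun a b => εL W a * b)]
          simp only [mul_assoc]
      _ = _ := by
          conv_rhs => rw [← hW.εL_mul (h * k), map_ten]
          simp only [hW.εL_εL_mul]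
  calc _ = dualMul W χ φ (inv S (εL W (h * k))) := by
        rw [hk, hW.dMul_assoc, hχ, ← hW.dMul_assoc, hW.dMul_cls_one, hW.dMul_cls_counit,
          hW.dCounit_cls]
    _ = ten (Δ h) fun a b => dualMul W χ φ (inv S (εL W b) * inv S (εL W (a * k))) := by
        rw [← hsum, Lin.map_ten (g := fun z => dualMul W χ φ (inv S z)) (by fun_prop)]
        simp only [hW.inv_antimul]
    _ = ten (Δ h) fun a b => ten (dualComul W φ) fun p q =>
        dualMul W χ p (inv S (εL W b)) * q (inv S (εL W (a * k))) := by
        refine ten_congr fun a b => ?_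
        have := ten_dualComul_smul_right φ (inv S (εL W (a * k)))
          (fun q => dualMul W χ q (inv S (εL W b)))
        simp only [smul_eq_mul] at this
        simp only [mul_comm (dualMul W χ _ _), this]
        rw [← hW.translate_dualMul_memR' (hW.inv_memR (εL_mem _)), translate_apply, one_mul]
    _ = _ := by
        rw [hW.dComul_cls, ten_comm, ← LinearEquiv.coe_toLinearMap]
        simp only [map_ten, counitPair, LinearMap.comp_apply, LinearEquiv.coe_toLinearMap,
          TensorProduct.map_tmul, LinearMap.flip_apply, TensorProduct.comm_tmul,
          hχ, hk, hW.dMul_cls_one, hW.dMul_cls_counit, hW.dCounit_cls]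
        simp

end

/-! ### The antipode of `D(W)` -/

section

variable {W : Type*} [Ring W] [Algebra ℂ W] [Coalgebra ℂ W] {S : W →ₗ[ℂ] W} {x y : W}

/-- The element `∑ ⟨φ, S⁻¹(1⁽²⁾)⟩ 1⁽¹⁾` of `W_R`, which represents the functional
`φ ∘ S⁻¹ ∘ ε_L`. -/
noncomputable def counitRep (S : W →ₗ[ℂ] W) (φ : Module.Dual ℂ W) : W :=
  ten (Δ 1) fun a b => φ (inv S b) • a

@[fun_prop]
theorem Lin.counitRep {V : Type*} [AddCommMonoid V] [Module ℂ V] {g : V → Module.Dual ℂ W}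
    (hg : Lin g) : Lin fun z => counitRep S (g z) := by
  unfold WeakHopf.counitRep
  exact lin_ten' _ fun a b => Lin.smul_right (Lin.coe (Module.Dual.eval ℂ W (inv S b)) hg) a

theorem IsWHA.counitRep_mem (hW : IsWHA S) (φ : Module.Dual ℂ W) : counitRep S φ ∈ WR W := by
  rw [counitRep, ← hW.sw_one_εR (fun a b => φ (inv S b) • a)]
  exact ⟨ten (Δ 1) fun a b => φ (inv S b) • a, by simp only [map_ten, map_smul]⟩

theorem counit_counitRep_mul (S : W →ₗ[ℂ] W) (φ : Module.Dual ℂ W) (k : W) :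
    ϵ (counitRep S φ * k) = φ (inv S (εL W k)) := by
  rw [counitRep, Lin.map_ten (g := fun z => ϵ (z * k)) (by fun_prop), εL_eq,
    Lin.map_ten (g := fun z => φ (inv S z)) (by fun_prop)]
  simp [mul_comm]

variable [FiniteDimensional ℂ W]

/-- `[ε ⊗ x][ψ ⊗ h] = [ψ(· x) ⊗ h]` for `x ∈ W_L`. -/
theorem IsWHA.dMul_counit_memL (hW : IsWHA S) (hx : x ∈ WL W) (ψ : Module.Dual ℂ W) (h : W) :
    hW.dMul (cls ϵ x) (cls ψ h) = cls (translate ψ 1 x) h := by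
  rw [hW.cls_counit_memL hx, ← hW.translate_counit_inv hx, hW.dMul_cls_one,
    hW.dualMul_translate_inv hx, counit_dualMul]

/-- `[ε ⊗ y][ψ ⊗ h] = [ψ(S⁻¹(y) ·) ⊗ h]` for `y ∈ W_R`. -/
theorem IsWHA.dMul_counit_memR (hW : IsWHA S) (hy : y ∈ WR W) (ψ : Module.Dual ℂ W) (h : W) :
    hW.dMul (cls ϵ y) (cls ψ h) = cls (translate ψ (inv S y) 1) h := by
  rw [hW.cls_counit_memR hy, hW.dMul_cls_one, hW.dualMul_translate_left hy, counit_dualMul]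

/-- The antipode of the double maps `[φ ⊗ h]` to the product of `[ε ⊗ S(h)]` and
`[φ ∘ S⁻¹ ⊗ 1]`, in this order. -/
theorem IsWHA.toDouble_preAntipode (hW : IsWHA S) (φ : Module.Dual ℂ W) (h : W) :
    toDouble (preAntipode S (φ ⊗ₜ h)) = hW.dMul (cls ϵ (S h)) (cls (φ ∘ₗ inv S) 1) := by
  rw [preAntipode_tmul hW, straighten_tmul, hW.dMul_cls]
  simp only [map_ten, counit_dualMul, mul_one]

/-- The antipode of the quantum double. -/
noncomputable def IsWHA.dAntipode (hW : IsWHA S) : QuantumDouble W →ₗ[ℂ] QuantumDouble W :=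
  (doubleIdeal W).liftQ (toDouble ∘ₗ preAntipode S) <| by
    refine hW.doubleIdeal_le_ker (fun x hx φ h => ?_) (fun y hy φ h => ?_)
    · simp only [LinearMap.comp_apply, hW.toDouble_preAntipode]
      rw [hW.antipode_antimul, ← hW.dMul_cls_counit, hW.dMul_assoc,
        hW.dMul_counit_memR (hW.antipode_memR hx)]
      congr 2
      ext z
      simp [hW.inv_antipode, hW.inv_antimul]
    · simp only [LinearMap.comp_apply, hW.toDouble_preAntipode]
      rw [hW.antipode_antimul, ← hW.dMul_cls_counit, hW.dMul_assoc,
        hW.dMul_counit_memL (hW.antipode_memL hy)]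
      congr 2
      ext z
      simp [hW.inv_antipode, hW.inv_antimul]

theorem IsWHA.dAntipode_toDouble (hW : IsWHA S) (a : Module.Dual ℂ W ⊗[ℂ] W) :
    hW.dAntipode (toDouble a) = toDouble (preAntipode S a) := rfl

theorem IsWHA.dAntipode_cls (hW : IsWHA S) (φ : Module.Dual ℂ W) (h : W) :
    hW.dAntipode (cls φ h) = hW.dMul (cls ϵ (S h)) (cls (φ ∘ₗ inv S) 1) :=
  hW.toDouble_preAntipode φ h

theorem IsWHA.dMul_sw_antipode (hW : IsWHA S) (h : W) :
    (ten (Δ h) fun a b => hW.dMul (cls ϵ a) (cls ϵ (S b))) = cls ϵ (εL W h) := by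
  simp only [hW.dMul_cls_counit]
  rw [← Lin.map_ten (g := fun z => cls ϵ z) (by fun_prop), hW.sw_mul_antipode]

/-- `∑ φ⁽²⁾ ((φ⁽¹⁾ ∘ S⁻¹)(· x)) = ⟨φ, S⁻¹(x) S⁻¹(ε_R(·))⟩`. -/
theorem IsWHA.dualMul_comp_inv (hW : IsWHA S) (φ : Module.Dual ℂ W) (x : W) :
    (ten (dualComul W φ) fun p q => dualMul W q (translate (p ∘ₗ inv S) 1 x)) =
      translate φ (inv S x) 1 ∘ₗ inv S ∘ₗ εR W := by
  ext y
  rw [Lin.map_ten (g := fun θ : Module.Dual ℂ W => θ y) (by fun_prop)]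
  calc _ = ten (Δ y) fun a b => ten (dualComul W φ) fun p q => p (inv S (b * x)) * q a := by
        rw [ten_comm]
        refine ten_congr fun p q => ?_
        rw [dualMul_apply]
        simp [mul_comm]
    _ = φ (inv S x * ten (Δ y) fun a b => inv S b * a) := by
        rw [Lin.map_ten (g := fun z => φ (inv S x * z)) (by fun_prop)]
        refine ten_congr fun a b => ?_
        rw [ten_dualComul_mul, hW.inv_antimul, mul_assoc]
    _ = _ := by
        rw [hW.sw_inv_mul]; simp

theorem IsWHA.counitL_dMul (hW : IsWHA S) (d : QuantumDouble W) :
    counitL hW.dMul (cls ϵ 1) hW.dComul hW.dCounit d =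
      ten (Δ 1) fun a b => hW.dCounit (hW.dMul (cls ϵ a) d) • cls ϵ b := by
  change (TensorProduct.lid ℂ _).toLinearMap (LinearMap.rTensor _ _ (hW.dComul (cls ϵ 1))) = _
  rw [hW.dComul_cls_counit]
  simp only [map_ten, LinearMap.rTensor_tmul, LinearMap.comp_apply, LinearMap.flip_apply,
    LinearEquiv.coe_toLinearMap, TensorProduct.lid_tmul]

theorem IsWHA.counitR_dMul (hW : IsWHA S) (d : QuantumDouble W) :
    counitR hW.dMul (cls ϵ 1) hW.dComul hW.dCounit d =
      ten (Δ 1) fun a b => hW.dCounit (hW.dMul d (cls ϵ b)) • cls ϵ a := by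
  change (TensorProduct.rid ℂ _).toLinearMap (LinearMap.lTensor _ _ (hW.dComul (cls ϵ 1))) = _
  rw [hW.dComul_cls_counit]
  simp only [map_ten, LinearMap.lTensor_tmul, LinearMap.comp_apply,
    LinearEquiv.coe_toLinearMap, TensorProduct.rid_tmul]

/-- `∑ d⁽¹⁾ S(d⁽²⁾) = [⟨φ, S⁻¹(ε_L(h)) S⁻¹(ε_R(·))⟩ ⊗ 1]` for `d = [φ ⊗ h]`. -/
theorem IsWHA.dMul_dAntipode (hW : IsWHA S) (φ : Module.Dual ℂ W) (h : W) :
    (ten (dualComul W φ) fun p q => ten (Δ h) fun a b =>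
      hW.dMul (cls q a) (hW.dAntipode (cls p b))) =
    cls (translate φ (inv S (εL W h)) 1 ∘ₗ inv S ∘ₗ εR W) 1 := by
  rw [← hW.dualMul_comp_inv, Lin.map_ten (g := fun θ => cls θ 1) (by fun_prop)]
  refine ten_congr fun p q => ?_
  calc _ = hW.dMul (cls q 1) (hW.dMul (ten (Δ h) fun a b =>
        hW.dMul (cls ϵ a) (cls ϵ (S b))) (cls (p ∘ₗ inv S) 1)) := by
        rw [Lin.map_ten (g := fun z => hW.dMul (cls q 1) (hW.dMul z (cls (p ∘ₗ inv S) 1)))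
          (by fun_prop)]
        refine ten_congr fun a b => ?_
        rw [hW.dMul_assoc, ← hW.dMul_assoc (cls q 1), hW.dMul_cls_counit, one_mul,
          hW.dAntipode_cls]
    _ = _ := by
        rw [hW.dMul_sw_antipode, hW.dMul_counit_memL (εL_mem h), hW.dMul_cls_one]

theorem IsWHA.dAntipode_left (hW : IsWHA S) :
    TensorProduct.lift hW.dMul ∘ₗ LinearMap.lTensor _ hW.dAntipode ∘ₗ hW.dComul =
      counitL hW.dMul (cls ϵ 1) hW.dComul hW.dCounit := by
  refine double_ext fun φ h => ?_
  rw [hW.counitL_dMul]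
  simp only [LinearMap.comp_apply, hW.dComul_cls, map_ten, LinearMap.lTensor_tmul,
    TensorProduct.lift.tmul]
  rw [hW.dMul_dAntipode]
  have : translate φ (inv S (εL W h)) 1 ∘ₗ inv S ∘ₗ εR W =
      ten (Δ 1) fun a b => φ (inv S (εL W h) * inv S a) • translate (ϵ : Module.Dual ℂ W) 1 b := by
    ext y
    rw [Lin.map_ten (g := fun θ : Module.Dual ℂ W => θ y) (by fun_prop)]
    simp only [LinearMap.comp_apply, translate_apply, mul_one, εR_eq]
    rw [Lin.map_ten (g := fun z => φ (inv S (εL W h) * inv S z)) (by fun_prop)]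
    simp [mul_comm]
  rw [this, Lin.map_ten (g := fun θ => cls θ 1) (by fun_prop),
    ← hW.sw_one_εR_εL (fun a b => cls (φ (inv S (εL W h) * inv S a) • translate ϵ 1 b) 1),
    ← hW.sw_one_εR_εL (fun a b => hW.dCounit (hW.dMul (cls ϵ a) (cls φ h)) • cls ϵ b)]
  refine ten_congr fun a b => ?_
  rw [hW.dMul_counit_memR (εR_mem a), hW.dCounit_cls, translate_apply, mul_one,
    hW.cls_counit_memL (εL_mem b), ← hW.inv_antimul, ← hW.inv_antimul,
    hW.commute (εL_mem h) (εR_mem a)]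
  exact Lin.map_smul (f := fun θ => cls θ 1) (by fun_prop) _ _

theorem IsWHA.cls_counitRep (hW : IsWHA S) (φ : Module.Dual ℂ W) :
    cls ϵ (counitRep S φ) = cls (φ ∘ₗ inv S ∘ₗ εL W) 1 := by
  rw [hW.cls_counit_memR (hW.counitRep_mem φ)]
  congr 2
  ext z
  simp [counit_counitRep_mul]

/-- `ε_R([φ ⊗ h]) = [ε ⊗ ε_R(wh)]`, where `w ∈ W_R` represents `φ ∘ S⁻¹ ∘ ε_L`. -/
theorem IsWHA.counitR_dMul_cls (hW : IsWHA S) (φ : Module.Dual ℂ W) (h : W) :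
    counitR hW.dMul (cls ϵ 1) hW.dComul hW.dCounit (cls φ h) =
      cls ϵ (εR W (counitRep S φ * h)) := by
  rw [hW.counitR_dMul, εR_eq, Lin.map_ten (g := fun z => cls ϵ z) (by fun_prop)]
  refine ten_congr fun a b => ?_
  rw [hW.dMul_cls_counit, hW.dCounit_cls, ← counit_counitRep_mul, mul_assoc]
  exact (Lin.map_smul (f := fun z => cls ϵ z) (by fun_prop) _ _).symm

/-- `∑ (φ⁽²⁾ ∘ S⁻¹) φ⁽¹⁾ = φ ∘ S⁻¹ ∘ ε_L`. -/
theorem IsWHA.comp_inv_dualMul (hW : IsWHA S) (φ : Module.Dual ℂ W) :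
    (ten (dualComul W φ) fun p q => dualMul W (q ∘ₗ inv S) p) = φ ∘ₗ inv S ∘ₗ εL W := by
  ext y
  rw [Lin.map_ten (g := fun θ : Module.Dual ℂ W => θ y) (by fun_prop)]
  calc _ = ten (Δ y) fun a b => ten (dualComul W φ) fun p q => p b * q (inv S a) := by
        rw [ten_comm]
        refine ten_congr fun p q => ?_
        rw [dualMul_apply]
        simp [mul_comm]
    _ = φ (ten (Δ y) fun a b => b * inv S a) := by
        rw [map_ten]
        simp only [ten_dualComul_mul]
    _ = _ := by
        rw [hW.sw_mul_inv]; rfl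

theorem IsWHA.dAntipode_right (hW : IsWHA S) :
    TensorProduct.lift hW.dMul ∘ₗ LinearMap.rTensor _ hW.dAntipode ∘ₗ hW.dComul =
      counitR hW.dMul (cls ϵ 1) hW.dComul hW.dCounit := by
  refine double_ext fun φ h => ?_
  rw [hW.counitR_dMul_cls]
  simp only [LinearMap.comp_apply, hW.dComul_cls, map_ten, LinearMap.rTensor_tmul,
    TensorProduct.lift.tmul]
  calc _ = ten (Δ h) fun a b => ten (dualComul W φ) fun p q =>
        hW.dMul (cls ϵ (S a)) (hW.dMul (cls (dualMul W (q ∘ₗ inv S) p) 1) (cls ϵ b)) := by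
        rw [ten_comm]
        refine ten_congr fun p q => ten_congr fun a b => ?_
        rw [hW.dAntipode_cls, hW.dMul_assoc, hW.dMul_cls_one, hW.dMul_cls_counit, one_mul]
    _ = ten (Δ h) fun a b => cls ϵ (S a * (counitRep S φ * b)) := by
        refine ten_congr fun a b => ?_
        rw [← Lin.map_ten (g := fun θ => hW.dMul (cls ϵ (S a)) (hW.dMul (cls θ 1) (cls ϵ b)))
          (by fun_prop) (dualComul W φ) (fun p q => dualMul W (q ∘ₗ inv S) p),
          hW.comp_inv_dualMul, ← hW.cls_counitRep, hW.dMul_cls_counit, hW.dMul_cls_counit]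
    _ = _ := by
        rw [← Lin.map_ten (g := fun z => cls ϵ z) (by fun_prop) (Δ h)
          (fun a b => S a * (counitRep S φ * b)), ← hW.sw_antipode_mul,
          hW.sw_memR_mul (hW.counitRep_mem φ) h (fun a b => S a * b)]

/-- `∑ (φ⁽²⁾ ∘ S⁻¹ ∘ ε_L) (φ⁽¹⁾ ∘ S⁻¹) = φ ∘ S⁻¹`. -/
theorem IsWHA.comp_inv_εL_dualMul (hW : IsWHA S) (φ : Module.Dual ℂ W) :
    (ten (dualComul W φ) fun p q => dualMul W (q ∘ₗ inv S ∘ₗ εL W) (p ∘ₗ inv S)) =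
      φ ∘ₗ inv S := by
  ext y
  rw [Lin.map_ten (g := fun θ : Module.Dual ℂ W => θ y) (by fun_prop)]
  calc _ = ten (Δ y) fun a b => ten (dualComul W φ) fun p q =>
        p (inv S b) * q (inv S (εL W a)) := by
        rw [ten_comm]
        refine ten_congr fun p q => ?_
        rw [dualMul_apply]
        simp [mul_comm]
    _ = φ (inv S (ten (Δ y) fun a b => εL W a * b)) := by
        simp only [map_ten, ten_dualComul_mul, hW.inv_antimul]
    _ = _ := by
        rw [hW.εL_mul]; rfl

theorem IsWHA.dAntipode_mul (hW : IsWHA S) : TensorProduct.lift hW.dMul ∘ₗ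
      TensorProduct.map (TensorProduct.lift hW.dMul ∘ₗ LinearMap.rTensor _ hW.dAntipode)
        hW.dAntipode ∘ₗ
      LinearMap.rTensor _ hW.dComul ∘ₗ hW.dComul = hW.dAntipode := by
  have hR : ∀ d, TensorProduct.lift hW.dMul (LinearMap.rTensor _ hW.dAntipode (hW.dComul d)) =
      counitR hW.dMul (cls ϵ 1) hW.dComul hW.dCounit d := LinearMap.congr_fun hW.dAntipode_right
  refine double_ext fun φ h => ?_
  calc _ = ten (dualComul W φ) fun p q => ten (Δ h) fun a b =>
        hW.dMul (cls ϵ (εR W (counitRep S q * a)))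
          (hW.dMul (cls ϵ (S b)) (cls (p ∘ₗ inv S) 1)) := by
        simp only [LinearMap.comp_apply]
        rw [hW.dComul_cls φ h]
        simp only [map_ten, LinearMap.rTensor_tmul, TensorProduct.map_tmul,
          TensorProduct.lift.tmul, LinearMap.comp_apply, hR, hW.counitR_dMul_cls,
          hW.dAntipode_cls]
    _ = ten (dualComul W φ) fun p q => hW.dMul (cls ϵ (S h))
        (cls (dualMul W (q ∘ₗ inv S ∘ₗ εL W) (p ∘ₗ inv S)) 1) := by
        refine ten_congr fun p q => ?_
        rw [← hW.dMul_cls_one, ← hW.cls_counitRep, ← hW.dMul_assoc, hW.dMul_cls_counit,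
          ← hW.sw_εR_memR_mul (hW.counitRep_mem q),
          Lin.map_ten (g := fun z => hW.dMul (cls ϵ z) (cls (p ∘ₗ inv S) 1)) (by fun_prop)]
        refine ten_congr fun a b => ?_
        rw [← hW.dMul_assoc, hW.dMul_cls_counit]
    _ = _ := by
        rw [← Lin.map_ten (g := fun θ => hW.dMul (cls ϵ (S h)) (cls θ 1)) (by fun_prop)
          (dualComul W φ) (fun p q => dualMul W (q ∘ₗ inv S ∘ₗ εL W) (p ∘ₗ inv S)),
          hW.comp_inv_εL_dualMul, hW.dAntipode_cls]

end

/-! ### The quantum double -/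

section

variable {W : Type*} [Ring W] [Algebra ℂ W] [Coalgebra ℂ W] [FiniteDimensional ℂ W]
  {S : W →ₗ[ℂ] W}

/-- The quantum double is a weak Hopf algebra. -/
theorem IsWHA.isWeakHopfAlgebra_double (hW : IsWHA S) :
    IsWeakHopfAlgebra hW.dMul (cls ϵ (1 : W)) hW.dComul hW.dCounit hW.dAntipode where
  mul_assoc := hW.dMul_assoc
  one_mul d := by
    induction d using double_induction with
    | h₁ φ h => rw [hW.dMul_cls_one, counit_dualMul]
    | h₂ d e hd he => rw [map_add, hd, he]
  mul_one d := by
    induction d using double_induction with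
    | h₁ φ h => rw [hW.dMul_cls_counit, mul_one]
    | h₂ d e hd he => rw [map_add, LinearMap.add_apply, hd, he]
  coassoc := hW.dComul_coassoc
  counit_left := hW.dComul_counit_left
  counit_right := hW.dComul_counit_right
  comul_mul := hW.dComul_dMul
  comul_one := hW.dComul_one
  comul_one' := hW.dComul_one'
  counit_mul := hW.dCounit_dMul
  counit_mul' := hW.dCounit_dMul'
  antipode_left := hW.dAntipode_left
  antipode_right := hW.dAntipode_right
  antipode_mul := hW.dAntipode_mul

end

end WeakHopf

theorem mainTheorem3 {W : Type*} [Ring W] [Algebra ℂ W] [Coalgebra ℂ W]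
    [FiniteDimensional ℂ W] (S : W →ₗ[ℂ] W)
    (hW : WeakHopf.IsWeakHopfAlgebra (LinearMap.mul ℂ W) 1
      Coalgebra.comul Coalgebra.counit S) :
    -- the antipode is invertible, so that `S⁻¹` below is its inverse
    Function.Bijective S ∧
    -- the product of `Ŵᶜᵒᵖ ⊗ W` is associative
    (∀ a b c : Module.Dual ℂ W ⊗[ℂ] W,
      WeakHopf.preMul S (WeakHopf.preMul S a b) c =
        WeakHopf.preMul S a (WeakHopf.preMul S b c)) ∧
    -- `J` is a two-sided ideal
    (∀ a : Module.Dual ℂ W ⊗[ℂ] W, ∀ j ∈ WeakHopf.doubleIdeal W,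
      WeakHopf.preMul S a j ∈ WeakHopf.doubleIdeal W ∧
        WeakHopf.preMul S j a ∈ WeakHopf.doubleIdeal W) ∧
    -- the stated operations are well defined on `D(W)` and make it a weak Hopf algebra
    ∃ (m : WeakHopf.QuantumDouble W →ₗ[ℂ]
          WeakHopf.QuantumDouble W →ₗ[ℂ] WeakHopf.QuantumDouble W)
      (Δ : WeakHopf.QuantumDouble W →ₗ[ℂ]
          WeakHopf.QuantumDouble W ⊗[ℂ] WeakHopf.QuantumDouble W)
      (ε : WeakHopf.QuantumDouble W →ₗ[ℂ] ℂ)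
      (σ : WeakHopf.QuantumDouble W →ₗ[ℂ] WeakHopf.QuantumDouble W),
      (∀ a b : Module.Dual ℂ W ⊗[ℂ] W,
        m (WeakHopf.toDouble a) (WeakHopf.toDouble b) =
          WeakHopf.toDouble (WeakHopf.preMul S a b)) ∧
      (∀ a : Module.Dual ℂ W ⊗[ℂ] W,
        Δ (WeakHopf.toDouble a) =
          TensorProduct.map WeakHopf.toDouble WeakHopf.toDouble (WeakHopf.preComul a)) ∧
      (∀ a : Module.Dual ℂ W ⊗[ℂ] W,
        ε (WeakHopf.toDouble a) = WeakHopf.preCounit S a) ∧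
      (∀ a : Module.Dual ℂ W ⊗[ℂ] W,
        σ (WeakHopf.toDouble a) = WeakHopf.toDouble (WeakHopf.preAntipode S a)) ∧
      WeakHopf.IsWeakHopfAlgebra m
        (WeakHopf.toDouble (Coalgebra.counit ⊗ₜ[ℂ] (1 : W))) Δ ε σ := by
  have h : WeakHopf.IsWHA S := hW
  exact ⟨h.bijective, WeakHopf.preMul_assoc h, fun a j hj =>
    ⟨by rw [h.preMul_right_eq_zero a j hj]; exact zero_mem _,
      by rw [h.preMul_left_eq_zero a j hj]; exact zero_mem _⟩,
    h.dMul, h.dComul, h.dCounit, h.dAntipode, h.dMul_toDouble, h.dComul_toDouble,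
    fun _ => rfl, h.dAntipode_toDouble, h.isWeakHopfAlgebra_double⟩
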